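/- **Setting.** Let $k$ be a field of characteristic $0$, $F=k((t))$, $O=k[[t]]$, $\mathfrak m=tk[[t]]$, and $\omega_x=\mathfrak m/\mathfrak m^2$. Let $\Gamma$ be a lattice (a free abelian group of finite rank), $T=\Gamma\otimes\mathbb G_m$, and $c$ a symmetric $\mathbb Z$-bilinear form $\Gamma\times\Gamma\to\mathbb Z$. Let $T(F)$ and $T(O)$ be the group ind-scheme and the group scheme over $k$ with $R$-points $\Gamma\otimes R((t))^\times$ and $\Gamma\otimes R[[t]]^\times$; write $f^\gamma=\gamma\otimes f$. The valuation defines a projection $T(F)\to\Gamma$ with fibres $T(F)^\gamma$, and $T(F)^\gamma_{red}=t^\gamma\, T(O)$. A *symmetric Heisenberg extension of level $c$* is a central $\mathbb G_m$-superextension $\tilde T$ of $T(F)$ (a central extension by $\mathbb G_m$ with a parity homomorphism $T(F)\to\mathbb Z/2$) with a splitting $i:T(O)\to\tilde T$ and an automorphism $\sigma$ of the group $\tilde T$, such that * the parity over $T(F)^\gamma$ is $c(\gamma,\gamma)$ mod $2$; * the super commutator pairing, i.e. $(-1)^{p(a_1)p(a_2)}\tilde a_1\tilde a_2\tilde a_1^{-1}\tilde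 a_2^{-1}$ for lifts $\tilde a_j$ of points $a_j$ of parity $p(a_j)$, sends $f_1^{\gamma_1},f_2^{\gamma_2}$ to $\{f_1,f_2\}^{-c(\gamma_1,\gamma_2)}$, where $\{\ ,\ \}$ is the Contou-Carrère symbol, normalized by $\{a,t\}=a$ for invertible constants $a$; * $\sigma^2=\mathrm{id}$, $\sigma|_{\mathbb G_m}=\mathrm{id}$, $\sigma$ lifts $a\mapsto a^{-1}$, and $\sigma(i(b))=i(b^{-1})$. With isomorphisms of extensions compatible with $i$ and $\sigma$ these form a groupoid ${\mathcal H}s^c$. Consider $\tilde T$ as a super line bundle $\lambda$ on $T(F)$, and let $\lambda^\gamma$ be the space of sections $\ell$ of $\lambda$ over $T(F)^{-\gamma}_{red}$ that are $T(O)$-equivariant: $\ell(ab)=\ell(a)\,i(b)$. For a parameter $\tau$ of $F$ (an element of $\mathfrak m$ with $d\tau:=\tau \bmod \mathfrak m^2\ne 0$) and $\ell\in\lambda^\gamma$, put $\ell_\tau:=\ell(\tau^{-\gamma})$. **Lemma.** (i) For every symmetric Heisenberg extension $\tilde T$ of level $c$, each $\lambda^\gamma$ is a super line of parity $c(\gamma,\gamma)$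 mod $2$. There are isomorphisms $$\mu=\mu_{\gamma_1\gamma_2}:\lambda^{\gamma_1}\otimes\lambda^{\gamma_2}\to\lambda^{\gamma_1+\gamma_2}\otimes\omega_x^{\otimes c(\gamma_1,\gamma_2)},\qquad \sigma=\sigma_\gamma:\lambda^\gamma\to\lambda^{-\gamma}$$ such that $\big(\mu(\ell_1\otimes\ell_2)\,(d\tau)^{-c(\gamma_1,\gamma_2)}\big)_\tau=(\ell_1)_\tau\cdot(\ell_2)_\tau$ (product in $\tilde T$) for every parameter $\tau$ of $F$, and $\sigma(\ell)(a^{-1})=\sigma(\ell(a))$, and such that (a)–(c) hold. The isomorphisms with these properties are unique. (a) $\mu(\mu(\ell_1,\ell_2),\ell_3)=\mu(\ell_1,\mu(\ell_2,\ell_3))$ in $\lambda^{\gamma_1+\gamma_2+\gamma_3}\otimes\omega_x^{\otimes (c(\gamma_1,\gamma_2)+c(\gamma_2,\gamma_3)+c(\gamma_1,\gamma_3))}$ for $\ell_j\in\lambda^{\gamma_j}$. (b) $\mu_{\gamma_1\gamma_2}=(-1)^{c(\gamma_1,\gamma_2)}\mu_{\gamma_2\gamma_1}\,\mathfrak s$,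 where $\mathfrak s:\lambda^{\gamma_1}\otimes\lambda^{\gamma_2}\to\lambda^{\gamma_2}\otimes\lambda^{\gamma_1}$ is the commutativity constraint of super lines. (c) $\sigma_{-\gamma}\sigma_\gamma=\mathrm{id}$, and $\mu$ commutes with $\sigma$. (ii) The construction $\tilde T\mapsto(\{\lambda^\gamma\},\mu,\sigma)$ is functorial (an isomorphism of extensions acts on sections by transport of structure), and it is an equivalence from the groupoid ${\mathcal H}s^c$ to the groupoid of triples $(\{\lambda^\gamma\}_{\gamma\in\Gamma},\mu,\sigma)$, where the $\lambda^\gamma$ are super lines of parity $c(\gamma,\gamma)$ mod $2$, and $\mu$, $\sigma$ are isomorphisms as displayed in (i) with the properties (a), (b), (c); the morphisms are the families of isomorphisms of lines that commute with $\mu$ and $\sigma$. -/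

import Mathlib

open CategoryTheory TensorProduct
open scoped LaurentSeries PowerSeries

universe u v

noncomputable section

namespace SymHeis

/-! ### Exponential and logarithm of nilpotent elements, in characteristic zero -/

/-- `exp x = ∑ xⁱ / i!` for a nilpotent element `x` of a `k`-algebra. -/
def nilExp (k : Type u) [Field k] {A : Type*} [CommRing A] [Algebra k A] (x : A) : A :=
  ∑ i ∈ Finset.range (nilpotencyClass x), ((i.factorial : k)⁻¹) • x ^ i

/-- `log (1 + x) = ∑ (-1)ⁱ xⁱ⁺¹ / (i + 1)` for a nilpotent element `x` of a `k`-algebra. -/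
def nilLog (k : Type u) [Field k] {A : Type*} [CommRing A] [Algebra k A] (x : A) : A :=
  ∑ i ∈ Finset.range (nilpotencyClass x), ((-1 : k) ^ i / ((i : k) + 1)) • x ^ (i + 1)

/-! ### Laurent series: base change, valuation -/

/-- Base change of Laurent series: apply a ring homomorphism to all the coefficients. -/
def laurentMap {R S : Type*} [CommRing R] [CommRing S] (φ : R →+* S) : R⸨X⸩ →+* S⸨X⸩ where
  toFun f := HahnSeries.map f φ
  map_one' := by
    ext n
    simp [HahnSeries.coeff_one, apply_ite φ]
  map_mul' f g := by
    ext n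
    have hf : (HahnSeries.map f φ).support ⊆ f.support := by
      intro i hi h0
      exact hi (by simp [HahnSeries.map, h0])
    have hg : (HahnSeries.map g φ).support ⊆ g.support := by
      intro i hi h0
      exact hi (by simp [HahnSeries.map, h0])
    rw [HahnSeries.coeff_mul_left' f.isPWO_support hf]
    simp only [HahnSeries.map_coeff, HahnSeries.coeff_mul, map_sum, map_mul]
    refine (Finset.sum_subset ?_ ?_).symm
    · intro x hx
      simp only [Finset.mem_antidiagonal] at hx ⊢
      exact ⟨hx.1, hg hx.2.1, hx.2.2⟩
    · intro x hx hx'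
      simp only [Finset.mem_antidiagonal] at hx hx'
      have : (HahnSeries.map g φ).coeff x.2 = 0 := by
        by_contra h
        exact hx' ⟨hx.1, h, hx.2.2⟩
      rw [HahnSeries.map_coeff] at this
      rw [this, mul_zero]
  map_zero' := by
    ext n
    simp
  map_add' f g := by
    ext n
    simp

/-- The coordinate `t` of the Laurent series ring, as a unit. -/
def tUnit (R : Type*) [CommRing R] : (R⸨X⸩)ˣ where
  val := HahnSeries.single 1 1
  inv := HahnSeries.single (-1) 1
  val_inv := by simp
  inv_val := by simp

/-- The valuation `v f` of a unit of `R((t))` at a point `p` of `Spec R`: the order of the image of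
`f` in `κ(p)((t))`. -/
def ordAt {R : Type*} [CommRing R] (p : PrimeSpectrum R) : Additive (R⸨X⸩)ˣ →+ ℤ where
  toFun f := HahnSeries.order
    (laurentMap (algebraMap R p.asIdeal.ResidueField) (f.toMul : (R⸨X⸩)ˣ))
  map_zero' := by simp
  map_add' f g := by
    have h (f : (R⸨X⸩)ˣ) :
        laurentMap (algebraMap R p.asIdeal.ResidueField) (f : R⸨X⸩) ≠ 0 :=
      (f.isUnit.map _).ne_zero
    simp only [toMul_add, Units.val_mul, map_mul]
    exact HahnSeries.order_mul (h _) (h _)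

/-! ### The Contou-Carrère symbol -/

/-- A factorization `f = a tⁿ f₊ f₋` of a unit of `R((t))`, where `n` is an integer, `a` is a unit
of `R`, `f₊ ∈ 1 + t R[[t]]`, and `f₋ = 1 + ν(t⁻¹)`, where `ν` is a polynomial without constant term
whose coefficients are nilpotent. It is unique if it exists (and `R ≠ 0`), and every unit
of `R((t))` has one Zariski-locally on `Spec R`. -/
structure UnitFactorization {R : Type*} [CommRing R] (f : (R⸨X⸩)ˣ) where
  ord : ℤ
  lead : Rˣ
  plus : (R⟦X⟧)ˣ
  plus_const : PowerSeries.constantCoeff (plus : R⟦X⟧) = 1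
  minus : Polynomial R
  minus_const : minus.coeff 0 = 0
  minus_nil : ∀ i, IsNilpotent (minus.coeff i)
  eq : (f : R⸨X⸩) = HahnSeries.C (lead : R) * HahnSeries.single ord 1 *
    HahnSeries.ofPowerSeries ℤ R (plus : R⟦X⟧) *
      (1 + Polynomial.aeval (HahnSeries.single (-1) 1 : R⸨X⸩) minus)

/-- `Res (log f₋ · d log g₊)`. -/
def resLog (k : Type u) [Field k] {R : Type*} [CommRing R] [Algebra k R] {f g : (R⸨X⸩)ˣ}
    (F : UnitFactorization f) (G : UnitFactorization g) : R :=
  (nilLog k (Polynomial.aeval (HahnSeries.single (-1) 1 : R⸨X⸩) F.minus) *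
    HahnSeries.ofPowerSeries ℤ R
      (PowerSeries.derivative R (G.plus : R⟦X⟧) * ((G.plus⁻¹ : (R⟦X⟧)ˣ) : R⟦X⟧))).coeff (-1)

/-- The Contou-Carrère symbol of the units `f = a tⁿ f₊ f₋` and `g = b tᵐ g₊ g₋` over a ring that
contains `ℚ`:
`{f, g} = (-1)^{nm} a^m b^{-n} exp (Res (log f₋ · d log g₊)) exp (- Res (log g₋ · d log f₊))`. -/
def factoredSymbol (k : Type u) [Field k] {R : Type*} [CommRing R] [Algebra k R] {f g : (R⸨X⸩)ˣ}
    (F : UnitFactorization f) (G : UnitFactorization g) : R :=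
  (((-1 : Rˣ) ^ (F.ord * G.ord) * F.lead ^ G.ord * G.lead ^ (-F.ord) : Rˣ) : R) *
    nilExp k (resLog k F G) * nilExp k (-resLog k G F)

/-- `z` is the Contou-Carrère symbol of `f` and `g`: after every base change that makes `f` and `g`
factor, `z` is given by the explicit formula. Since `f` and `g` factor Zariski-locally
on `Spec R`, exactly one unit `z` has this property. -/
def IsContouCarrere (k : Type u) [Field k] {R : Type u} [CommRing R] [Algebra k R]
    (f g : (R⸨X⸩)ˣ) (z : Rˣ) : Prop :=
  ∀ (S : Type u) [CommRing S] [Algebra k S] (φ : R →ₐ[k] S)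
    (F : UnitFactorization (Units.map (laurentMap (φ : R →+* S)).toMonoidHom f))
    (G : UnitFactorization (Units.map (laurentMap (φ : R →+* S)).toMonoidHom g)),
    φ (z : R) = factoredSymbol k F G

/-- The Contou-Carrère symbol `{f, g} ∈ Rˣ` of two units of `R((t))`; in particular `{a, t} = a`
for `a ∈ Rˣ` and `{t, t} = -1`. -/
def contouCarrere (k : Type u) [Field k] {R : Type u} [CommRing R] [Algebra k R]
    (f g : (R⸨X⸩)ˣ) : Rˣ :=
  Classical.epsilon (IsContouCarrere k f g)

/-- The unit `(-1)^s` of `R`, for a locally constant function `s : Spec R → ℤ/2`: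
it equals `1 - 2e`, where `e` is the idempotent of the open and closed subset `s = 1`. -/
def signUnit {R : Type*} [CommRing R] (s : LocallyConstant (PrimeSpectrum R) (ZMod 2)) : Rˣ :=
  let e := PrimeSpectrum.isIdempotentElemEquivClopens.symm
    (⟨s ⁻¹' {1}, s.isLocallyConstant.isClopen_fiber 1⟩ :
      TopologicalSpace.Clopens (PrimeSpectrum R))
  have he : (1 - 2 * (e : R)) * (1 - 2 * (e : R)) = 1 := by
    have h : (e : R) * e = e := e.2
    linear_combination 4 * h
  ⟨1 - 2 * (e : R), 1 - 2 * (e : R), he, he⟩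

/-! ### The loop group and the arc group of the torus `Γ ⊗ 𝔾ₘ` -/

/-- The group `Γ ⊗ M`, written multiplicatively, for a lattice `Γ` and a commutative group `M`. -/
abbrev TorusPts (Γ : Type v) [AddCommGroup Γ] (M : Type*) [CommGroup M] : Type _ :=
  Multiplicative (Γ ⊗[ℤ] Additive M)

/-- The element `f^γ = γ ⊗ f`. -/
def expPt {Γ : Type v} [AddCommGroup Γ] {M : Type*} [CommGroup M] (f : M) (γ : Γ) :
    TorusPts Γ M :=
  Multiplicative.ofAdd (γ ⊗ₜ[ℤ] Additive.ofMul f)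

/-- Functoriality of `Γ ⊗ M` in `M`. -/
def torusMap (Γ : Type v) [AddCommGroup Γ] {M N : Type*} [CommGroup M] [CommGroup N] (f : M →* N) :
    TorusPts Γ M →* TorusPts Γ N :=
  AddMonoidHom.toMultiplicative
    (LinearMap.lTensor Γ (MonoidHom.toAdditive f).toIntLinearMap).toAddMonoidHom

/-- The `R`-points `Γ ⊗ R((t))ˣ` of the loop group `T(F)`. -/
abbrev Loop (Γ : Type v) [AddCommGroup Γ] (R : Type u) [CommRing R] : Type _ :=
  TorusPts Γ (R⸨X⸩)ˣ

/-- The `R`-points `Γ ⊗ R[[t]]ˣ` of the arc group `T(O)`. -/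
abbrev Arc (Γ : Type v) [AddCommGroup Γ] (R : Type u) [CommRing R] : Type _ :=
  TorusPts Γ (R⟦X⟧)ˣ

/-- The inclusion `T(O)(R) → T(F)(R)`. -/
def arcToLoop (Γ : Type v) [AddCommGroup Γ] (R : Type u) [CommRing R] : Arc Γ R →* Loop Γ R :=
  torusMap Γ (Units.map (HahnSeries.ofPowerSeries ℤ R).toMonoidHom)

/-- Functoriality of `T(F)(R)` in `R`. -/
def loopMap (Γ : Type v) [AddCommGroup Γ] {R S : Type u} [CommRing R] [CommRing S] (φ : R →+* S) :
    Loop Γ R →* Loop Γ S :=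
  torusMap Γ (Units.map (laurentMap φ).toMonoidHom)

/-- Functoriality of `T(O)(R)` in `R`. -/
def arcMap (Γ : Type v) [AddCommGroup Γ] {R S : Type u} [CommRing R] [CommRing S] (φ : R →+* S) :
    Arc Γ R →* Arc Γ S :=
  torusMap Γ (Units.map (PowerSeries.map φ).toMonoidHom)

/-- The projection `T(F) → Γ` induced by the valuation, at a point `p` of `Spec R`. -/
def loopVal {Γ : Type v} [AddCommGroup Γ] {R : Type u} [CommRing R] (p : PrimeSpectrum R)
    (a : Loop Γ R) : Γ :=
  TensorProduct.rid ℤ Γ (LinearMap.lTensor Γ (ordAt p).toIntLinearMap a.toAdd)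

/-- The `R`-points of the component `T(F)_red^γ = t^γ · T(O)` of the reduced ind-scheme. -/
def redComp {Γ : Type v} [AddCommGroup Γ] (γ : Γ) (R : Type u) [CommRing R] : Set (Loop Γ R) :=
  {a | ∃ b : Arc Γ R, a = expPt (tUnit R) γ * arcToLoop Γ R b}

/-! ### Superextensions and symmetric Heisenberg extensions -/

section

variable (k : Type u) [Field k] (Γ : Type v) [AddCommGroup Γ]

/-- A central `𝔾ₘ`-superextension of the group ind-scheme `T(F)`: a central extension of group
functors on commutative `k`-algebras that is a Zariski `𝔾ₘ`-torsor over `T(F)`, together with a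
parity homomorphism `T(F) → ℤ/2`. (The super line over a point `a` is the line of the
`𝔾ₘ`-torsor over `a`, placed in degree `parity a`.) -/
structure LoopSuperExt where
  /-- The functor of points of the extension. -/
  H : CommAlgCat.{u} k ⥤ GrpCat.{u}
  /-- The inclusion of `𝔾ₘ`. -/
  incl (R : CommAlgCat.{u} k) : (R : Type u)ˣ →* H.obj R
  /-- The projection to `T(F)`. -/
  proj (R : CommAlgCat.{u} k) : H.obj R →* Loop Γ R
  incl_nat {R S : CommAlgCat.{u} k} (φ : R ⟶ S) (z : (R : Type u)ˣ) :
    H.map φ (incl R z) = incl S (Units.map (φ.hom : R →* S) z)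
  proj_nat {R S : CommAlgCat.{u} k} (φ : R ⟶ S) (h : H.obj R) :
    proj S (H.map φ h) = loopMap Γ (φ.hom : R →+* S) (proj R h)
  incl_injective (R : CommAlgCat.{u} k) : Function.Injective (incl R)
  proj_eq_one_iff (R : CommAlgCat.{u} k) (h : H.obj R) : proj R h = 1 ↔ ∃ z, incl R z = h
  central (R : CommAlgCat.{u} k) (z : (R : Type u)ˣ) (h : H.obj R) :
    incl R z * h = h * incl R z
  /-- Points of `T(F)` lift Zariski-locally. -/
  exists_lift (R : CommAlgCat.{u} k) (a : Loop Γ R) :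
    ∃ s : Finset R, Ideal.span (s : Set R) = ⊤ ∧ ∀ r ∈ s,
      ∃ h : H.obj (CommAlgCat.of k (Localization.Away r)),
        proj _ h = loopMap Γ (algebraMap R (Localization.Away r)) a
  /-- Points of the extension glue in the Zariski topology. -/
  glue (R : CommAlgCat.{u} k) (s : Finset R) (_hs : Ideal.span (s : Set R) = ⊤)
    (h : ∀ r : R, H.obj (CommAlgCat.of k (Localization.Away r)))
    (compat : ∀ r ∈ s, ∀ r' ∈ s, ∀ (S : CommAlgCat.{u} k)
      (φ : CommAlgCat.of k (Localization.Away r) ⟶ S)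
      (ψ : CommAlgCat.of k (Localization.Away r') ⟶ S),
      (∀ x : R, φ.hom (algebraMap R (Localization.Away r) x) =
        ψ.hom (algebraMap R (Localization.Away r') x)) → H.map φ (h r) = H.map ψ (h r')) :
    ∃ h₀ : H.obj R, ∀ r ∈ s,
      H.map (CommAlgCat.ofHom (IsScalarTower.toAlgHom k R (Localization.Away r))) h₀ = h r
  /-- The parity of a point of `T(F)`. -/
  parity (R : CommAlgCat.{u} k) : Loop Γ R → LocallyConstant (PrimeSpectrum R) (ZMod 2)
  parity_mul (R : CommAlgCat.{u} k) (a b : Loop Γ R) :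
    parity R (a * b) = parity R a + parity R b
  parity_nat {R S : CommAlgCat.{u} k} (φ : R ⟶ S) (a : Loop Γ R) (p : PrimeSpectrum S) :
    parity S (loopMap Γ (φ.hom : R →+* S) a) p =
      parity R a (PrimeSpectrum.comap (φ.hom : R →+* S) p)

variable {k Γ}

/-- A symmetric Heisenberg extension of level `c`: a superextension `T(F)~` of `T(F)` with a
splitting `i` over `T(O)`, such that the parity over `T(F)^γ` is `c(γ, γ)` mod `2` and the super
commutator pairing is `{f₁^γ₁, f₂^γ₂} = {f₁, f₂}^{-c(γ₁, γ₂)}`, and with an involution `σ` that is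
the identity on `𝔾ₘ`, lifts `a ↦ a⁻¹`, and preserves `i`.
The super commutator pairing of `a₁`, `a₂` is `(-1)^{parity a₁ · parity a₂}` times the commutator
of lifts `h₁`, `h₂` of `a₁`, `a₂`. -/
structure SymHeisExt (c : LinearMap.BilinForm ℤ Γ) extends LoopSuperExt k Γ where
  /-- The splitting over `T(O)`. -/
  split (R : CommAlgCat.{u} k) : Arc Γ R →* H.obj R
  split_nat {R S : CommAlgCat.{u} k} (φ : R ⟶ S) (b : Arc Γ R) :
    H.map φ (split R b) = split S (arcMap Γ (φ.hom : R →+* S) b)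
  proj_split (R : CommAlgCat.{u} k) (b : Arc Γ R) : proj R (split R b) = arcToLoop Γ R b
  parity_eq (R : CommAlgCat.{u} k) (a : Loop Γ R) (p : PrimeSpectrum R) :
    parity R a p = (c (loopVal p a) (loopVal p a) : ZMod 2)
  comm_pairing (R : CommAlgCat.{u} k) (f₁ f₂ : ((R : Type u)⸨X⸩)ˣ) (γ₁ γ₂ : Γ) (h₁ h₂ : H.obj R)
    (hh₁ : proj R h₁ = expPt f₁ γ₁) (hh₂ : proj R h₂ = expPt f₂ γ₂) :
    incl R (signUnit (parity R (expPt f₁ γ₁) * parity R (expPt f₂ γ₂))) *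
        (h₁ * h₂ * h₁⁻¹ * h₂⁻¹) =
      incl R (contouCarrere k f₁ f₂ ^ (-c γ₁ γ₂))
  /-- The symmetric structure. -/
  symm (R : CommAlgCat.{u} k) : H.obj R →* H.obj R
  symm_nat {R S : CommAlgCat.{u} k} (φ : R ⟶ S) (h : H.obj R) :
    H.map φ (symm R h) = symm S (H.map φ h)
  symm_symm (R : CommAlgCat.{u} k) (h : H.obj R) : symm R (symm R h) = h
  symm_incl (R : CommAlgCat.{u} k) (z : (R : Type u)ˣ) : symm R (incl R z) = incl R z
  proj_symm (R : CommAlgCat.{u} k) (h : H.obj R) : proj R (symm R h) = (proj R h)⁻¹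
  symm_split (R : CommAlgCat.{u} k) (b : Arc Γ R) : symm R (split R b) = split R b⁻¹

namespace SymHeisExt

variable {c : LinearMap.BilinForm ℤ Γ}

/-- An isomorphism of symmetric Heisenberg extensions. (The parity is preserved
automatically, since it is determined by `c`.) -/
@[ext]
structure Iso (E E' : SymHeisExt (k := k) c) where
  equiv (R : CommAlgCat.{u} k) : E.H.obj R ≃* E'.H.obj R
  nat {R S : CommAlgCat.{u} k} (φ : R ⟶ S) (h : E.H.obj R) :
    equiv S (E.H.map φ h) = E'.H.map φ (equiv R h)
  equiv_incl (R : CommAlgCat.{u} k) (z : (R : Type u)ˣ) :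
    equiv R (E.incl R z) = E'.incl R z
  proj_equiv (R : CommAlgCat.{u} k) (h : E.H.obj R) :
    E'.proj R (equiv R h) = E.proj R h
  equiv_split (R : CommAlgCat.{u} k) (b : Arc Γ R) :
    equiv R (E.split R b) = E'.split R b
  equiv_symm (R : CommAlgCat.{u} k) (h : E.H.obj R) :
    equiv R (E.symm R h) = E'.symm R (equiv R h)

/-- The identity. -/
def Iso.refl (E : SymHeisExt (k := k) c) : Iso E E where
  equiv R := MulEquiv.refl _
  nat _ _ := rfl
  equiv_incl _ _ := rfl
  proj_equiv _ _ := rfl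
  equiv_split _ _ := rfl
  equiv_symm _ _ := rfl

/-- Composition. -/
def Iso.trans {E E' E'' : SymHeisExt (k := k) c} (e : Iso E E') (e' : Iso E' E'') : Iso E E'' where
  equiv R := (e.equiv R).trans (e'.equiv R)
  nat φ h := by simp [e.nat, e'.nat]
  equiv_incl R z := by simp [e.equiv_incl, e'.equiv_incl]
  proj_equiv R h := by simp [e.proj_equiv, e'.proj_equiv]
  equiv_split R b := by simp [e.equiv_split, e'.equiv_split]
  equiv_symm R h := by simp [e.equiv_symm, e'.equiv_symm]

/-- The inverse. -/
def Iso.inv {E E' : SymHeisExt (k := k) c} (e : Iso E E') : Iso E' E where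
  equiv R := (e.equiv R).symm
  nat φ h := by
    rw [MulEquiv.symm_apply_eq, e.nat, MulEquiv.apply_symm_apply]
  equiv_incl R z := by rw [MulEquiv.symm_apply_eq, e.equiv_incl]
  proj_equiv R h := by rw [← e.proj_equiv, MulEquiv.apply_symm_apply]
  equiv_split R b := by rw [MulEquiv.symm_apply_eq, e.equiv_split]
  equiv_symm R h := by rw [MulEquiv.symm_apply_eq, e.equiv_symm, MulEquiv.apply_symm_apply]

/-- The groupoid of symmetric Heisenberg extensions of level `c`. -/
instance : Groupoid (SymHeisExt (k := k) c) where
  Hom E E' := Iso E E'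
  id E := Iso.refl E
  comp e e' := e.trans e'
  inv e := e.inv
  id_comp _ := rfl
  comp_id _ := rfl
  assoc _ _ _ := rfl
  inv_comp e := by
    apply Iso.ext
    funext R
    exact (e.equiv R).symm_trans_self
  comp_inv e := by
    apply Iso.ext
    funext R
    exact (e.equiv R).self_trans_symm

/-- The `R`-points of `T(F)~` over `T(F)_red^γ`. -/
abbrev Over (E : SymHeisExt (k := k) c) (γ : Γ) (R : CommAlgCat.{u} k) : Type u :=
  {h : E.H.obj R // E.proj R h ∈ redComp γ R}

/-- The space `λ^γ` of `T(O)`-equivariant sections, over `T(F)_red^{-γ}`, of the line bundle `λ`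
associated with the `𝔾ₘ`-torsor `T(F)~`. A section `ℓ` is encoded by the function `f` on the torsor
such that `ℓ(a) = f(h) h ∈ λ_a` for each point `h` over `a`, so that `f(z h) = z⁻¹ f(h)`
for `z ∈ 𝔾ₘ`; equivariance, `ℓ(a b) = ℓ(a) i(b)`, means that `f(h i(b)) = f(h)`. -/
def line (E : SymHeisExt (k := k) c) (γ : Γ) :
    Submodule k ((R : CommAlgCat.{u} k) → E.Over (-γ) R → R) where
  carrier := {f |
    (∀ (R S : CommAlgCat.{u} k) (φ : R ⟶ S) (h : E.Over (-γ) R) (h' : E.Over (-γ) S),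
      h'.1 = E.H.map φ h.1 → f S h' = φ.hom (f R h)) ∧
    (∀ (R : CommAlgCat.{u} k) (z : (R : Type u)ˣ) (h h' : E.Over (-γ) R),
      h'.1 = E.incl R z * h.1 → f R h' = ((z⁻¹ : (R : Type u)ˣ) : R) * f R h) ∧
    (∀ (R : CommAlgCat.{u} k) (b : Arc Γ R) (h h' : E.Over (-γ) R),
      h'.1 = h.1 * E.split R b → f R h' = f R h)}
  add_mem' {f g} hf hg := by
    refine ⟨fun R S φ h h' e ↦ ?_, fun R z h h' e ↦ ?_, fun R b h h' e ↦ ?_⟩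
    · simp [hf.1 R S φ h h' e, hg.1 R S φ h h' e]
    · simp [hf.2.1 R z h h' e, hg.2.1 R z h h' e, mul_add]
    · simp [hf.2.2 R b h h' e, hg.2.2 R b h h' e]
  zero_mem' := by
    refine ⟨fun R S φ h h' e ↦ ?_, fun R z h h' e ↦ ?_, fun R b h h' e ↦ ?_⟩ <;> simp
  smul_mem' x f hf := by
    refine ⟨fun R S φ h h' e ↦ ?_, fun R z h h' e ↦ ?_, fun R b h h' e ↦ ?_⟩
    · simp [hf.1 R S φ h h' e]
    · simp [hf.2.1 R z h h' e]
    · simp [hf.2.2 R b h h' e]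

/-- The parity of the super line `λ^γ`: the parity of the superextension over the
`k`-point `t^{-γ}` of `T(F)_red^{-γ}`. -/
def lineParity (E : SymHeisExt (k := k) c) (γ : Γ) : ZMod 2 :=
  E.parity (CommAlgCat.of k k) (expPt (tUnit k) (-γ)) ⊥

/-- The map of points over `T(F)_red^γ` given by an isomorphism. -/
def Iso.over {E E' : SymHeisExt (k := k) c} (e : Iso E E') (γ : Γ) (R : CommAlgCat.{u} k)
    (h : E.Over γ R) : E'.Over γ R :=
  ⟨e.equiv R h.1, by rw [e.proj_equiv]; exact h.2⟩

/-- The map on equivariant sections given by an isomorphism of extensions: transport of structure,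
i.e. the section `a ↦ ℓ(a) = f(h) h` goes to the section `a ↦ f(h) e(h)`. -/
def Iso.lineMap {E E' : SymHeisExt (k := k) c} (e : Iso E E') (γ : Γ) :
    E.line γ →ₗ[k] E'.line γ where
  toFun f := ⟨fun R h ↦ f.1 R (e.inv.over (-γ) R h), by
    refine ⟨fun R S φ h h' eq ↦ ?_, fun R z h h' eq ↦ ?_, fun R b h h' eq ↦ ?_⟩
    · exact f.2.1 R S φ _ _ (by simp only [Iso.over]; rw [eq, e.inv.nat])
    · exact f.2.2.1 R z _ _ (by simp only [Iso.over]; rw [eq, map_mul, e.inv.equiv_incl])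
    · exact f.2.2.2 R b _ _ (by simp only [Iso.over]; rw [eq, map_mul, e.inv.equiv_split])⟩
  map_add' _ _ := rfl
  map_smul' _ _ := rfl

/-- The isomorphism on equivariant sections given by an isomorphism of extensions. -/
def Iso.lineEquiv {E E' : SymHeisExt (k := k) c} (e : Iso E E') (γ : Γ) :
    E.line γ ≃ₗ[k] E'.line γ :=
  LinearEquiv.ofLinearMap (e.lineMap γ) (e.inv.lineMap γ)
    (by
      refine LinearMap.ext fun f ↦ Subtype.ext (funext fun R ↦ funext fun h ↦ ?_)
      exact congrArg (f.1 R) (Subtype.ext ((e.equiv R).apply_symm_apply h.1)))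
    (by
      refine LinearMap.ext fun f ↦ Subtype.ext (funext fun R ↦ funext fun h ↦ ?_)
      exact congrArg (f.1 R) (Subtype.ext ((e.equiv R).symm_apply_apply h.1)))

end SymHeisExt

end

/-! ### The cotangent line and its integer tensor powers -/

section

variable (k : Type u) [Field k]

/-- The cotangent `k`-line `ω = 𝔪 / 𝔪²` at the closed point of `Spec k[[t]]`. -/
abbrev Cot : Type u := (IsLocalRing.maximalIdeal k⟦X⟧).Cotangent

/-- The tensor power `ω^{⊗ n}` of the cotangent line, for an integer `n`. The element `x w^{⊗ n}`,
for a nonzero `w ∈ ω` and `x ∈ k`, is encoded by the function `φ` on the set of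
nonzero vectors with `φ(w) = x`; it satisfies `φ(z w) = z^{-n} φ(w)` for `z ∈ kˣ`. -/
def cotPow (n : ℤ) : Submodule k ({w : Cot k // w ≠ 0} → k) where
  carrier := {φ | ∀ (z : kˣ) (w w' : {w : Cot k // w ≠ 0}), w'.1 = (z : k) • w.1 →
    φ w' = ((z ^ (-n) : kˣ) : k) * φ w}
  add_mem' {f g} hf hg z w w' h := by simp only [Pi.add_apply, hf z w w' h, hg z w w' h, mul_add]
  zero_mem' z w w' h := by simp
  smul_mem' x f hf z w w' h := by
    simp only [Pi.smul_apply, hf z w w' h, smul_eq_mul]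
    ring

/-- The identification `ω^{⊗ m} ⊗ ω^{⊗ n} → ω^{⊗ (m + n)}`. -/
def cotPowMul (m n : ℤ) : cotPow k m ⊗[k] cotPow k n →ₗ[k] cotPow k (m + n) :=
  TensorProduct.lift <| LinearMap.mk₂ k
    (fun φ ψ ↦ ⟨φ.1 * ψ.1, fun z w w' h ↦ by
      simp only [Pi.mul_apply, φ.2 z w w' h, ψ.2 z w w' h, neg_add, zpow_add, Units.val_mul]
      ring⟩)
    (fun _ _ _ ↦ Subtype.ext (add_mul _ _ _))
    (fun _ _ _ ↦ Subtype.ext (smul_mul_assoc _ _ _))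
    (fun _ _ _ ↦ Subtype.ext (mul_add _ _ _))
    (fun _ _ _ ↦ Subtype.ext (mul_smul_comm _ _ _))

variable {k}

/-- The contraction `V ⊗ ω^{⊗ n} → V`, `ℓ ↦ ℓ w^{⊗ (-n)}`, with a nonzero cotangent vector `w`. -/
def contract {V : Type*} [AddCommGroup V] [Module k V] {n : ℤ} (w : {w : Cot k // w ≠ 0}) :
    V ⊗[k] cotPow k n →ₗ[k] V :=
  (TensorProduct.rid k V).toLinearMap ∘ₗ
    LinearMap.lTensor V ((LinearMap.proj w).comp (cotPow k n).subtype)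

/-! ### The data `({λ^γ}, μ, σ)` -/

variable {Γ : Type v} [AddCommGroup Γ]

/-- `V^γ ⊗ ω^{⊗ n}` for a family of vector spaces `V^γ`. -/
abbrev Tw (V : Γ → Type*) [∀ γ, AddCommGroup (V γ)] [∀ γ, Module k (V γ)] (γ : Γ) (n : ℤ) :
    Type _ :=
  V γ ⊗[k] cotPow k n

/-- Change of the indices of `V^γ ⊗ ω^{⊗ n}` along equalities. -/
def castTw {V : Γ → Type*} [∀ γ, AddCommGroup (V γ)] [∀ γ, Module k (V γ)] {γ γ' : Γ} {n n' : ℤ}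
    (hγ : γ = γ') (hn : n = n') (x : Tw (k := k) V γ n) : Tw (k := k) V γ' n' :=
  hγ ▸ hn ▸ x

/-- The sign `(-1)^s`, for `s ∈ ℤ/2`. -/
def sgn (s : ZMod 2) : ℤˣ := if s = 0 then 1 else -1

/-- The commutativity constraint `V ⊗ W → W ⊗ V` of super vector spaces, for `V` purely of
parity `p` and `W` purely of parity `q`. -/
def superComm {V W : Type*} [AddCommGroup V] [Module k V] [AddCommGroup W] [Module k W]
    (p q : ZMod 2) : V ⊗[k] W →ₗ[k] W ⊗[k] V :=
  ((sgn (p * q) : ℤ) : k) • (TensorProduct.comm k V W).toLinearMap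

section

variable {c : LinearMap.BilinForm ℤ Γ} {V : Γ → Type*} [∀ γ, AddCommGroup (V γ)]
  [∀ γ, Module k (V γ)]
  (μ : ∀ γ₁ γ₂ : Γ, V γ₁ ⊗[k] V γ₂ ≃ₗ[k] Tw (k := k) V (γ₁ + γ₂) (c γ₁ γ₂))

/-- `(V^γ₁ ⊗ V^γ₂) ⊗ ω^{⊗ m} → V^{γ₁+γ₂} ⊗ ω^{⊗ (c(γ₁,γ₂) + m)}`, induced by `μ`. -/
def muTw (γ₁ γ₂ : Γ) (m : ℤ) :
    (V γ₁ ⊗[k] V γ₂) ⊗[k] cotPow k m →ₗ[k] Tw (k := k) V (γ₁ + γ₂) (c γ₁ γ₂ + m) :=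
  (cotPowMul k (c γ₁ γ₂) m).lTensor (V (γ₁ + γ₂)) ∘ₗ
    (TensorProduct.assoc k (V (γ₁ + γ₂)) (cotPow k (c γ₁ γ₂)) (cotPow k m)).toLinearMap ∘ₗ
      (μ γ₁ γ₂).toLinearMap.rTensor (cotPow k m)

/-- The triple product `μ (μ (ℓ₁, ℓ₂), ℓ₃)`. -/
def muLeft {γ₁ γ₂ γ₃ : Γ} (l₁ : V γ₁) (l₂ : V γ₂) (l₃ : V γ₃) :
    Tw (k := k) V (γ₁ + γ₂ + γ₃) (c (γ₁ + γ₂) γ₃ + c γ₁ γ₂) :=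
  muTw μ (γ₁ + γ₂) γ₃ (c γ₁ γ₂)
    (TensorProduct.rightComm k (V (γ₁ + γ₂)) (cotPow k (c γ₁ γ₂)) (V γ₃)
      (μ γ₁ γ₂ (l₁ ⊗ₜ l₂) ⊗ₜ l₃))

/-- The triple product `μ (ℓ₁, μ (ℓ₂, ℓ₃))`. -/
def muRight {γ₁ γ₂ γ₃ : Γ} (l₁ : V γ₁) (l₂ : V γ₂) (l₃ : V γ₃) :
    Tw (k := k) V (γ₁ + (γ₂ + γ₃)) (c γ₁ (γ₂ + γ₃) + c γ₂ γ₃) :=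
  muTw μ γ₁ (γ₂ + γ₃) (c γ₂ γ₃)
    ((TensorProduct.assoc k (V γ₁) (V (γ₂ + γ₃)) (cotPow k (c γ₂ γ₃))).symm
      (l₁ ⊗ₜ μ γ₂ γ₃ (l₂ ⊗ₜ l₃)))

end

/-- The structure on a family of super vector spaces (`V^γ`, purely of parity `par γ`) that makes it
a datum `({λ^γ}, μ, σ)` of level `c`, for a symmetric form `c`: each `V^γ` is a super line of parity
`c(γ, γ)` mod `2`, and `μ`, `σ` are isomorphisms with the properties (a) `assoc`, (b) `comm`,
and (c) `sigma_sigma`, `mu_sigma`. -/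
@[ext]
structure LineDatum (c : LinearMap.BilinForm ℤ Γ) (hc : ∀ x y, c x y = c y x) (V : Γ → Type*)
    [∀ γ, AddCommGroup (V γ)] [∀ γ, Module k (V γ)] (par : Γ → ZMod 2) where
  finrank_eq (γ : Γ) : Module.finrank k (V γ) = 1
  parity_eq (γ : Γ) : par γ = (c γ γ : ZMod 2)
  mu (γ₁ γ₂ : Γ) : V γ₁ ⊗[k] V γ₂ ≃ₗ[k] Tw (k := k) V (γ₁ + γ₂) (c γ₁ γ₂)
  sigma (γ : Γ) : V γ ≃ₗ[k] V (-γ)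
  assoc (γ₁ γ₂ γ₃ : Γ) (l₁ : V γ₁) (l₂ : V γ₂) (l₃ : V γ₃) :
    castTw (add_assoc γ₁ γ₂ γ₃)
        (by simp only [map_add, LinearMap.add_apply]; ring :
          c (γ₁ + γ₂) γ₃ + c γ₁ γ₂ = c γ₁ (γ₂ + γ₃) + c γ₂ γ₃)
        (muLeft mu l₁ l₂ l₃) =
      muRight mu l₁ l₂ l₃
  comm (γ₁ γ₂ : Γ) (l : V γ₁ ⊗[k] V γ₂) :
    mu γ₁ γ₂ l = ((((c γ₁ γ₂).negOnePow : ℤˣ) : ℤ) : k) •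
      castTw (add_comm γ₂ γ₁) (hc γ₂ γ₁) (mu γ₂ γ₁ (superComm (par γ₁) (par γ₂) l))
  sigma_sigma (γ : Γ) (l : V γ) : sigma (-γ) (sigma γ l) = cast (by rw [neg_neg]) l
  mu_sigma (γ₁ γ₂ : Γ) (l₁ : V γ₁) (l₂ : V γ₂) :
    (sigma (γ₁ + γ₂)).toLinearMap.rTensor (cotPow k (c γ₁ γ₂)) (mu γ₁ γ₂ (l₁ ⊗ₜ l₂)) =
      castTw (neg_add γ₁ γ₂).symm (by simp) (mu (-γ₁) (-γ₂) (sigma γ₁ l₁ ⊗ₜ sigma γ₂ l₂))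

/-- A family of linear isomorphisms `V^γ ≃ V'^γ` is compatible with `μ` and `σ`. -/
def LineDatum.IsHom {c : LinearMap.BilinForm ℤ Γ} {hc : ∀ x y, c x y = c y x}
    {V V' : Γ → Type*} [∀ γ, AddCommGroup (V γ)] [∀ γ, Module k (V γ)]
    [∀ γ, AddCommGroup (V' γ)] [∀ γ, Module k (V' γ)] {par par' : Γ → ZMod 2}
    (D : LineDatum (k := k) c hc V par) (D' : LineDatum (k := k) c hc V' par')
    (e : ∀ γ, V γ ≃ₗ[k] V' γ) : Prop :=
  (∀ (γ₁ γ₂ : Γ) (l₁ : V γ₁) (l₂ : V γ₂),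
    (e (γ₁ + γ₂)).toLinearMap.rTensor (cotPow k (c γ₁ γ₂)) (D.mu γ₁ γ₂ (l₁ ⊗ₜ l₂)) =
      D'.mu γ₁ γ₂ (e γ₁ l₁ ⊗ₜ e γ₂ l₂)) ∧
  ∀ (γ : Γ) (l : V γ), e (-γ) (D.sigma γ l) = D'.sigma γ (e γ l)

end

section

variable (k : Type u) [Field k] {Γ : Type v} [AddCommGroup Γ]

/-- A triple `({λ^γ}, μ, σ)` of level `c`. -/
structure Triple (c : LinearMap.BilinForm ℤ Γ) (hc : ∀ x y, c x y = c y x) where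
  V : Γ → Type (u + 1)
  [acg : ∀ γ, AddCommGroup (V γ)]
  [mod : ∀ γ, Module k (V γ)]
  par : Γ → ZMod 2
  datum : LineDatum (k := k) c hc V par

attribute [instance] Triple.acg Triple.mod

variable {k}

/-- An isomorphism of triples. (The parities agree automatically.) -/
@[ext]
structure TripleIso {c : LinearMap.BilinForm ℤ Γ} {hc : ∀ x y, c x y = c y x}
    (A B : Triple k c hc) where
  equiv (γ : Γ) : A.V γ ≃ₗ[k] B.V γ
  isHom : A.datum.IsHom B.datum equiv

namespace TripleIso

variable {c : LinearMap.BilinForm ℤ Γ} {hc : ∀ x y, c x y = c y x}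

/-- The identity. -/
def refl (A : Triple k c hc) : TripleIso A A where
  equiv γ := LinearEquiv.refl k _
  isHom := ⟨fun γ₁ γ₂ l₁ l₂ ↦ by simp, fun _ _ ↦ rfl⟩

/-- Composition. -/
def trans {A B C : Triple k c hc} (e : TripleIso A B) (e' : TripleIso B C) : TripleIso A C where
  equiv γ := (e.equiv γ).trans (e'.equiv γ)
  isHom := ⟨fun γ₁ γ₂ l₁ l₂ ↦ by
      rw [LinearEquiv.coe_trans, LinearMap.rTensor_comp_apply, e.isHom.1, e'.isHom.1]
      rfl,
    fun γ l ↦ by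
      simp only [LinearEquiv.trans_apply, e.isHom.2, e'.isHom.2]⟩

/-- The inverse. -/
def inv {A B : Triple k c hc} (e : TripleIso A B) : TripleIso B A where
  equiv γ := (e.equiv γ).symm
  isHom := ⟨fun γ₁ γ₂ l₁ l₂ ↦ by
      have h := e.isHom.1 γ₁ γ₂ ((e.equiv γ₁).symm l₁) ((e.equiv γ₂).symm l₂)
      simp only [LinearEquiv.apply_symm_apply] at h
      rw [← h, ← LinearMap.rTensor_comp_apply]
      simp,
    fun γ l ↦ by
      rw [LinearEquiv.symm_apply_eq, e.isHom.2, LinearEquiv.apply_symm_apply]⟩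

end TripleIso

/-- The groupoid of triples `({λ^γ}, μ, σ)` of level `c`. -/
instance {c : LinearMap.BilinForm ℤ Γ} {hc : ∀ x y, c x y = c y x} :
    Groupoid (Triple k c hc) where
  Hom A B := TripleIso A B
  id A := TripleIso.refl A
  comp e e' := e.trans e'
  inv e := e.inv
  id_comp _ := rfl
  comp_id _ := rfl
  assoc _ _ _ := rfl
  inv_comp e := by
    apply TripleIso.ext
    funext γ
    exact (e.equiv γ).symm_trans_self
  comp_inv e := by
    apply TripleIso.ext
    funext γ
    exact (e.equiv γ).self_trans_symm

/-! ### The construction `T(F)~ ↦ ({λ^γ}, μ, σ)` -/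

/-- The data `μ`, `σ` on the super lines `λ^γ` of `T(F)~` are the ones that come from the product and
the symmetric structure of `T(F)~`. For every parameter `τ` of `F`, let `ℓ_τ = ℓ(τ^{-γ})` be the
value of the section `ℓ ∈ λ^γ` at the `k`-point `τ^{-γ}`. Then
`(μ(ℓ₁, ℓ₂) (dτ)^{-c(γ₁, γ₂)})_τ = (ℓ₁)_τ · (ℓ₂)_τ`, the product being that of `T(F)~`;
and the section `σ(ℓ)` takes at `a⁻¹` the value `σ(ℓ(a))`. -/
def SymHeisExt.IsCanonical {c : LinearMap.BilinForm ℤ Γ} {hc : ∀ x y, c x y = c y x}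
    (E : SymHeisExt (k := k) c)
    (D : LineDatum (k := k) c hc (fun γ ↦ E.line γ) E.lineParity) : Prop :=
  (∀ (τ : IsLocalRing.maximalIdeal k⟦X⟧) (hτ : (IsLocalRing.maximalIdeal k⟦X⟧).toCotangent τ ≠ 0)
    (f : (k⸨X⸩)ˣ) (_ : (f : k⸨X⸩) = HahnSeries.ofPowerSeries ℤ k τ.1)
    (γ₁ γ₂ : Γ) (l₁ : E.line γ₁) (l₂ : E.line γ₂)
    (h₁ : E.Over (-γ₁) (CommAlgCat.of k k)) (h₂ : E.Over (-γ₂) (CommAlgCat.of k k))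
    (h₁₂ : E.Over (-(γ₁ + γ₂)) (CommAlgCat.of k k)),
    E.proj _ h₁.1 = expPt f (-γ₁) → E.proj _ h₂.1 = expPt f (-γ₂) → h₁₂.1 = h₁.1 * h₂.1 →
      (contract ⟨_, hτ⟩ (D.mu γ₁ γ₂ (l₁ ⊗ₜ l₂))).1 _ h₁₂ = l₁.1 _ h₁ * l₂.1 _ h₂) ∧
  ∀ (γ : Γ) (l : E.line γ) (R : CommAlgCat.{u} k) (h : E.Over (-γ) R) (h' : E.Over (-(-γ)) R),
    h'.1 = E.symm R h.1 → (D.sigma γ l).1 R h' = l.1 R h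

/-- The functor `T(F)~ ↦ ({λ^γ}, μ, σ)`, where `λ^γ` are the super lines of equivariant sections,
given a choice `D` of the data `μ`, `σ` that is compatible with isomorphisms. An isomorphism of
extensions acts on sections by transport of structure. -/
def toTriple {c : LinearMap.BilinForm ℤ Γ} {hc : ∀ x y, c x y = c y x}
    (D : ∀ E : SymHeisExt (k := k) c, LineDatum (k := k) c hc (fun γ ↦ E.line γ) E.lineParity)
    (hD : ∀ (E E' : SymHeisExt (k := k) c) (e : SymHeisExt.Iso E E'),
      (D E).IsHom (D E') e.lineEquiv) :
    SymHeisExt (k := k) c ⥤ Triple k c hc where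
  obj E := { V := fun γ ↦ E.line γ, par := E.lineParity, datum := D E }
  map {E E'} e := { equiv := SymHeisExt.Iso.lineEquiv e, isHom := hD E E' e }
  map_id _ := rfl
  map_comp _ _ := rfl

end

end SymHeis

end

/-!
A symmetric Heisenberg extension `T(F)~` is determined by its restriction to the discrete set of
points `t^{-γ}`, and conversely. Locally on `Spec R`, every unit of `R((t))` factors uniquely as
`tⁿ u m`, where `u ∈ R[[t]]ˣ` and `m` lies in the group `Minus R` of the units `1 + ν(t⁻¹)` with
nilpotent coefficients (`exists_local_factor`, `facVal_injective`); the factors are found by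
splitting a logarithm, which requires characteristic `0`. So every point of the loop group `T(F)` is
locally a product `t^{-γ} b x` with `b ∈ T(O)` and `x ∈ Γ ⊗ Minus R`, and each of the three factors
has a lift to the extension. The points `b` lift by the given splitting. A point `x` has a unique
lift that is inverted by `σ` and is trivial over reduced rings (`SymHeisExt.minusLift`): two such
lifts differ by a unipotent square root of `1`, and one obtains one by dividing a lift that is
trivial over the reduction of `R` by a unipotent square root. The `k`-points `t^{-γ}` have lifts
`q(γ)`, unique up to scalars; a choice of these is a `SymHeisExt.Frame`. The super commutator
condition determines all commutators of these lifts, and hence the product of two elements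
`q(γ) i(b) x̃` (`Frame.lift_mul`): it is governed by the constants `m`, `s` with
`q(γ₁) q(γ₂) = m(γ₁, γ₂) q(γ₁ + γ₂)` and `σ(q(γ)) = s(γ) q(-γ)`, and by one half of the
Contou-Carrère symbol, a bimultiplicative function of factorizations whose antisymmetrization is the
symbol up to a sign (`halfFac`, `symbolFac`). Uniqueness of the factorizations makes it possible to
glue everything in the Zariski topology, and therefore two extensions that have frames with the same
constants are isomorphic (`Frame.iso`), and an isomorphism is determined by its values on a frame
(`Frame.iso_ext`).

On the other side, the value of an equivariant section at `q(γ)` is a coordinate on the line `λ^γ`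
(`Frame.co`). In such coordinates, and after contraction with `dt`, the isomorphisms `μ` and `σ`
become constants `m(γ₁, γ₂)` and `s(γ)`, and the properties (a), (b), (c) become the four identities
`IsCoeff` (`LineDatum.HasCoeff.isCoeff`, `LineDatum.ofCoeff`). The conditions that relate `μ` and
`σ` to the group `T(F)~` say that these constants are those of the frame
(`Frame.hasCoeff_of_isCanonical`, `Frame.isCanonical_of_hasCoeff`). Here the dependence on the
parameter `τ = t u` comes from the commutator of `i(u^{-γ₁})` and `q(γ₂)`, which is a power of the
constant term of `u`, like the ratio of `dτ` and `dt`. This gives existence and uniqueness in (i).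
The functor in (ii) is fully faithful, because families of isomorphisms of lines correspond to
changes of frame, and it commutes with the data exactly if the constants agree. It is essentially
surjective, because for constants that satisfy `IsCoeff` the set of pairs of a unit and a point of
the loop group is an extension, with the cocycle `m · half symbol⁻¹` (`CoeffData.cocycle`,
`stdExt`), where `m` is spread out over the components of the loop group (`constUnits`, `loopDeg`).
-/

universe w

noncomputable section

namespace SymHeis

/-! ### Exponential and logarithm of nilpotent elements -/

section ExpLog

variable (k : Type u) [Field k] {A B : Type*} [CommRing A] [Algebra k A] [CommRing B] [Algebra k B]

theorem nilExp_eq_sum {x : A} {N : ℕ} (h : x ^ N = 0) :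
    nilExp k x = ∑ i ∈ Finset.range N, ((i.factorial : k)⁻¹) • x ^ i := by
  have hN : nilpotencyClass x ≤ N := csInf_le' h
  have hx : x ^ nilpotencyClass x = 0 := pow_nilpotencyClass ⟨N, h⟩
  refine Finset.sum_subset (Finset.range_mono hN) fun i _ hi ↦ ?_
  rw [pow_eq_zero_of_le (by simpa using hi) hx, smul_zero]

theorem nilLog_eq_sum {x : A} {N : ℕ} (h : x ^ N = 0) :
    nilLog k x = ∑ i ∈ Finset.range N, ((-1 : k) ^ i / ((i : k) + 1)) • x ^ (i + 1) := by
  have hN : nilpotencyClass x ≤ N := csInf_le' h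
  have hx : x ^ nilpotencyClass x = 0 := pow_nilpotencyClass ⟨N, h⟩
  refine Finset.sum_subset (Finset.range_mono hN) fun i _ hi ↦ ?_
  rw [pow_eq_zero_of_le (Nat.le_succ_of_le (by simpa using hi)) hx, smul_zero]

variable {k}

theorem nilExp_map (φ : A →ₐ[k] B) {x : A} (hx : IsNilpotent x) :
    nilExp k (φ x) = φ (nilExp k x) := by
  obtain ⟨N, hN⟩ := hx
  rw [nilExp_eq_sum k hN, nilExp_eq_sum k (N := N) (by rw [← map_pow, hN, map_zero])]
  simp

theorem nilLog_map (φ : A →ₐ[k] B) {x : A} (hx : IsNilpotent x) :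
    nilLog k (φ x) = φ (nilLog k x) := by
  obtain ⟨N, hN⟩ := hx
  rw [nilLog_eq_sum k hN, nilLog_eq_sum k (N := N) (by rw [← map_pow, hN, map_zero])]
  simp

@[simp] theorem nilExp_zero : nilExp k (0 : A) = 1 := by
  simp [nilExp_eq_sum k (x := (0 : A)) (N := 1) (by simp)]

@[simp] theorem nilLog_zero : nilLog k (0 : A) = 0 := by
  simp [nilLog_eq_sum k (x := (0 : A)) (N := 1) (by simp)]

/-- `nilLog x` lies in every ideal that contains `x`. -/
theorem nilLog_mem {I : Ideal A} {x : A} (hx : x ∈ I) : nilLog k x ∈ I :=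
  I.sum_mem fun i _ ↦ I.smul_of_tower_mem _ (I.pow_mem_of_mem hx _ i.succ_pos)

theorem isNilpotent_nilLog {x : A} (hx : IsNilpotent x) : IsNilpotent (nilLog k x) :=
  mem_nilradical.1 (nilLog_mem (mem_nilradical.2 hx))

theorem nilExp_sub_one_eq {x : A} {N : ℕ} (h : x ^ N = 0) : nilExp k x - 1 =
    ∑ i ∈ Finset.range N, algebraMap k A ((i + 1).factorial : k)⁻¹ * x ^ (i + 1) := by
  rw [nilExp_eq_sum k (N := N + 1) (by rw [pow_succ, h, zero_mul]), Finset.sum_range_succ']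
  simp [Algebra.smul_def]

theorem nilExp_sub_one_mem {I : Ideal A} {x : A} (hx : x ∈ I) (h : IsNilpotent x) :
    nilExp k x - 1 ∈ I := by
  obtain ⟨N, hN⟩ := h
  rw [nilExp_sub_one_eq hN]
  exact I.sum_mem fun i _ ↦ I.mul_mem_left _ (I.pow_mem_of_mem hx _ i.succ_pos)

theorem isUnit_nilExp {x : A} (hx : IsNilpotent x) : IsUnit (nilExp k x) := by
  have := mem_nilradical.1 (nilExp_sub_one_mem (k := k) (mem_nilradical.2 hx) hx)
  simpa using this.isUnit_one_add

theorem nilExp_eq_one {x : A} (hx : IsNilpotent x) (h : nilExp k x = 1) : x = 0 := by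
  obtain ⟨N, hN⟩ := id hx
  rw [nilExp_eq_sum k (N := N + 2) (by rw [pow_add, hN, zero_mul]), Finset.sum_range_succ',
    Finset.sum_range_succ'] at h
  have h1 : x * (1 + x * ∑ i ∈ Finset.range N, (((i + 1 + 1).factorial : k)⁻¹) • x ^ i) = 0 := by
    rw [mul_add, Finset.mul_sum, Finset.mul_sum]
    simp only [Nat.factorial_zero, Nat.cast_one, inv_one, pow_zero, one_smul, zero_add, pow_one,
      Nat.factorial_one, add_eq_right] at h
    rw [← h, add_comm, mul_one]
    congr 1
    refine Finset.sum_congr rfl fun i _ ↦ ?_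
    rw [mul_smul_comm, mul_smul_comm]
    congr 1
    ring
  have h2 : IsUnit (1 + x * ∑ i ∈ Finset.range N, (((i + 1 + 1).factorial : k)⁻¹) • x ^ i) :=
    (Commute.isNilpotent_mul_right (Commute.all _ _) hx).isUnit_one_add
  exact (h2.mul_left_eq_zero).1 h1

variable [CharZero k]

theorem nilExp_add {x y : A} (hx : IsNilpotent x) (hy : IsNilpotent y) :
    nilExp k (x + y) = nilExp k x * nilExp k y := by
  let _ : Algebra ℚ A := Algebra.compHom A (algebraMap ℚ k)
  have key (z : A) : nilExp k z = IsNilpotent.exp z := by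
    refine Finset.sum_congr rfl fun i _ ↦ ?_
    have : ((i.factorial : ℚ)⁻¹ • z ^ i : A) = (algebraMap ℚ k ((i.factorial : ℚ)⁻¹)) • z ^ i := rfl
    rw [this]
    simp
  rw [key, key, key, IsNilpotent.exp_add_of_commute (Commute.all x y) hx hy]

theorem nilExp_neg_mul {x : A} (hx : IsNilpotent x) : nilExp k (-x) * nilExp k x = 1 := by
  rw [← nilExp_add hx.neg hx, neg_add_cancel, nilExp_zero]

theorem nilExp_injOn {x y : A} (hx : IsNilpotent x) (hy : IsNilpotent y)
    (h : nilExp k x = nilExp k y) : x = y := by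
  refine sub_eq_zero.1 (nilExp_eq_one (k := k)
    (Commute.isNilpotent_sub (Commute.all _ _) hx hy) ?_)
  rw [sub_eq_add_neg, nilExp_add hx hy.neg, h, mul_comm, nilExp_neg_mul hy]

open Polynomial in
/-- `exp` is inverse to `log`: the derivative in `s` of `(1 + s x) exp (- log (1 + s x))` vanishes,
so that its values at `s = 1` and `s = 0` agree. -/
theorem nilExp_nilLog {x : A} (hx : IsNilpotent x) : nilExp k (nilLog k x) = 1 + x := by
  obtain ⟨N, hN⟩ := hx
  have hN' : x ^ (N + 1) = 0 := by rw [pow_succ, hN, zero_mul]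
  -- `y = s x`, where `s` is the variable of `A[X]`, and `L = log (1 + s x)`
  set y : A[X] := Polynomial.X * C x with hy
  have hyN : y ^ N = 0 := by rw [hy, mul_pow, ← C_pow, hN, C_0, mul_zero]
  have hyN' : y ^ (N + 1) = 0 := by rw [pow_succ, hyN, zero_mul]
  have hyn : IsNilpotent y := ⟨N, hyN⟩
  set L : A[X] := nilLog k y with hL
  have hLn : IsNilpotent (-L) := (isNilpotent_nilLog hyn).neg
  have dy : derivative y = C x := by simp [hy]
  have dL : (1 + y) * derivative L = C x := by
    rw [hL, nilLog_eq_sum k hyN, derivative_sum, Finset.mul_sum]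
    have : ∀ i ∈ Finset.range N, (1 + y) * derivative (((-1 : k) ^ i / ((i : k) + 1)) • y ^ (i + 1))
        = C x * ((-y) ^ i - (-y) ^ (i + 1)) := by
      intro i _
      have h0 : ((i : k) + 1) ≠ 0 := by exact_mod_cast Nat.succ_ne_zero i
      rw [derivative_smul, derivative_pow_succ, dy]
      have : C ((i : A) + 1) = algebraMap k A[X] ((i : k) + 1) := by simp
      rw [this, mul_assoc, ← Algebra.smul_def, smul_smul, div_mul_cancel₀ _ h0, Algebra.smul_def]
      simp only [map_pow, map_neg, map_one]
      rw [neg_pow y i, neg_pow y (i+1)]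
      ring
    rw [Finset.sum_congr rfl this, ← Finset.mul_sum, Finset.sum_range_sub' (fun i ↦ (-y) ^ i)]
    rw [neg_pow y N, hyN]
    simp
  have dexp : derivative (nilExp k (-L)) = - derivative L * nilExp k (-L) := by
    obtain ⟨K, hK⟩ := hLn
    have hK' : (-L) ^ (K + 1) = 0 := by rw [pow_succ, hK, zero_mul]
    conv_lhs => rw [nilExp_eq_sum k hK']
    rw [nilExp_eq_sum k hK, derivative_sum, Finset.sum_range_succ', Finset.mul_sum]
    simp only [pow_zero, derivative_smul, derivative_one, smul_zero, add_zero]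
    refine Finset.sum_congr rfl fun i _ ↦ ?_
    have h0 : ((i : k) + 1) ≠ 0 := by exact_mod_cast Nat.succ_ne_zero i
    rw [derivative_pow_succ]
    have : C ((i : A) + 1) = algebraMap k A[X] ((i : k) + 1) := by simp
    rw [this, mul_assoc, ← Algebra.smul_def, smul_smul, Nat.factorial_succ]
    push_cast
    rw [mul_inv, mul_assoc, mul_comm, mul_assoc, mul_inv_cancel₀ h0, mul_one, derivative_neg,
      mul_comm, mul_smul_comm]
  have d0 : derivative ((1 + y) * nilExp k (-L)) = 0 := by
    rw [derivative_mul, dexp, derivative_add, derivative_one, dy, zero_add, ← dL]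
    ring
  have hconst : (1 + y) * nilExp k (-L) = C (((1 + y) * nilExp k (-L)).coeff 0) := by
    ext n
    rcases n with _ | n
    · simp
    · have := congrArg (fun p : A[X] ↦ p.coeff n) d0
      simp only [coeff_derivative, coeff_zero] at this
      have h0 : ((n : k) + 1) ≠ 0 := by exact_mod_cast Nat.succ_ne_zero n
      have h1 : ((n : A) + 1) = algebraMap k A ((n : k) + 1) := by simp
      rw [h1, mul_comm, ← Algebra.smul_def] at this
      rw [coeff_C_succ]
      exact (smul_eq_zero_iff_right h0).1 this
  have hev (r : k) : (1 + r • x) * nilExp k (-nilLog k (r • x)) =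
      ((1 + y) * nilExp k (-L)).coeff 0 := by
    let ev : A[X] →ₐ[k] A := (aeval (algebraMap k A r) : A[X] →ₐ[A] A).restrictScalars k
    have evy : ev y = r • x := by
      change aeval _ (Polynomial.X * C x) = _
      rw [map_mul, aeval_X, aeval_C, Algebra.smul_def]
      rfl
    have := congrArg ev hconst
    rw [map_mul, map_add, map_one, evy, ← nilExp_map ev hLn, map_neg ev L,
      show ev L = nilLog k (r • x) by rw [hL, ← nilLog_map ev hyn, evy]] at this
    rw [this]
    exact (aeval_C _ _).trans rfl
  have e0 := hev 0
  have e1 := hev 1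
  simp only [zero_smul, nilLog_zero, neg_zero, nilExp_zero, add_zero, mul_one, one_smul] at e0 e1
  rw [← e0] at e1
  have hl := isNilpotent_nilLog (k := k) ⟨N, hN⟩
  calc nilExp k (nilLog k x) = ((1 + x) * nilExp k (-nilLog k x)) * nilExp k (nilLog k x) := by
        rw [e1, one_mul]
    _ = 1 + x := by rw [mul_assoc, nilExp_neg_mul hl, mul_one]

theorem nilLog_mul {x y z : A} (hx : IsNilpotent x) (hy : IsNilpotent y)
    (h : 1 + z = (1 + x) * (1 + y)) : nilLog k z = nilLog k x + nilLog k y := by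
  have hz : IsNilpotent z := by
    have : z = x + y * (1 + x) := by linear_combination h
    rw [this]
    exact Commute.isNilpotent_add (Commute.all _ _) hx
      (Commute.isNilpotent_mul_right (Commute.all _ _) hy)
  have hlx := isNilpotent_nilLog (k := k) hx
  have hly := isNilpotent_nilLog (k := k) hy
  refine nilExp_injOn (k := k) (isNilpotent_nilLog hz)
    (Commute.isNilpotent_add (Commute.all _ _) hlx hly) ?_
  rw [nilExp_add hlx hly, nilExp_nilLog hx, nilExp_nilLog hy, nilExp_nilLog hz, h]

/-- A unipotent unit has a unipotent square root. -/
theorem exists_sq_eq (k : Type u) [Field k] [CharZero k] [Algebra k A] {x : A}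
    (hx : IsNilpotent x) : ∃ y : A, IsNilpotent y ∧ (1 + y) * (1 + y) = 1 + x := by
  have hl : IsNilpotent ((2 : k)⁻¹ • nilLog k x) := by
    rw [Algebra.smul_def]
    exact Commute.isNilpotent_mul_left (Commute.all _ _) (isNilpotent_nilLog hx)
  refine ⟨nilExp k ((2 : k)⁻¹ • nilLog k x) - 1,
    mem_nilradical.1 (nilExp_sub_one_mem (mem_nilradical.2 hl) hl), ?_⟩
  rw [add_sub_cancel, ← nilExp_add hl hl, ← add_smul, ← two_mul, mul_inv_cancel₀ two_ne_zero,
    one_smul, nilExp_nilLog hx]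

end ExpLog

/-! ### Laurent series with nilpotent coefficients -/

section Laurent

variable {R S T : Type*} [CommRing R] [CommRing S] [CommRing T]

@[simp] theorem laurentMap_coeff (φ : R →+* S) (f : R⸨X⸩) (n : ℤ) :
    (laurentMap φ f).coeff n = φ (f.coeff n) := rfl

@[simp] theorem laurentMap_single (φ : R →+* S) (n : ℤ) (r : R) :
    laurentMap φ (HahnSeries.single n r) = HahnSeries.single n (φ r) := by
  ext i
  simp only [laurentMap_coeff, HahnSeries.coeff_single]
  split_ifs <;> simp

theorem coeff_ofPowerSeries (f : R⟦X⟧) (n : ℤ) :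
    (HahnSeries.ofPowerSeries ℤ R f).coeff n = if n < 0 then 0 else PowerSeries.coeff n.natAbs f :=
  PowerSeries.coeff_coe f n

@[simp] theorem laurentMap_ofPowerSeries (φ : R →+* S) (f : R⟦X⟧) :
    laurentMap φ (HahnSeries.ofPowerSeries ℤ R f) =
      HahnSeries.ofPowerSeries ℤ S (PowerSeries.map φ f) := by
  ext n
  rw [laurentMap_coeff, coeff_ofPowerSeries, coeff_ofPowerSeries]
  split_ifs <;> simp

/-- Base change of Laurent series along a homomorphism of algebras. -/
def laurentAlgMap {k : Type*} [Field k] [Algebra k R] [Algebra k S] (φ : R →ₐ[k] S) :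
    R⸨X⸩ →ₐ[k] S⸨X⸩ where
  __ := laurentMap (φ : R →+* S)
  commutes' r := by
    change laurentMap (φ : R →+* S) (algebraMap k R⸨X⸩ r) = _
    rw [HahnSeries.algebraMap_apply', HahnSeries.algebraMap_apply', laurentMap_ofPowerSeries,
      PowerSeries.algebraMap_apply, PowerSeries.algebraMap_apply, PowerSeries.map_C]
    simp

/-- The inclusion of power series into Laurent series, as a homomorphism of algebras. -/
def ofPowerSeriesAlgHom (k R : Type*) [Field k] [CommRing R] [Algebra k R] : R⟦X⟧ →ₐ[k] R⸨X⸩ where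
  __ := HahnSeries.ofPowerSeries ℤ R
  commutes' _ := rfl

theorem algebraMap_laurent (k : Type*) [Field k] [Algebra k R] (r : k) :
    algebraMap k R⸨X⸩ r = HahnSeries.C (algebraMap k R r) := by
  rw [HahnSeries.algebraMap_apply', PowerSeries.algebraMap_apply, HahnSeries.ofPowerSeries_C]

/-- The ideal of Laurent series all of whose coefficients are nilpotent. -/
def nilCoeffs (R : Type*) [CommRing R] : Ideal R⸨X⸩ where
  carrier := {f | ∀ n, IsNilpotent (f.coeff n)}
  add_mem' hf hg n := Commute.isNilpotent_add (Commute.all _ _) (hf n) (hg n)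
  zero_mem' n := by simp
  smul_mem' f g hg n := by
    rw [smul_eq_mul, HahnSeries.coeff_mul]
    exact mem_nilradical.1 (Ideal.sum_mem _ fun x _ ↦
      Ideal.mul_mem_left _ _ (mem_nilradical.2 (hg _)))

theorem nilCoeffs_map (φ : R →+* S) {f : R⸨X⸩} (h : f ∈ nilCoeffs R) :
    laurentMap φ f ∈ nilCoeffs S := fun n ↦ (h n).map φ

theorem nilCoeffs_eq_zero [IsReduced R] {f : R⸨X⸩} (h : f ∈ nilCoeffs R) : f = 0 := by
  ext n
  exact (h n).eq_zero

/-- The polynomials in `t⁻¹` without constant term whose coefficients are nilpotent. -/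
def negNil (R : Type*) [CommRing R] : NonUnitalSubring R⸨X⸩ where
  carrier := {f | f ∈ nilCoeffs R ∧ ∀ n, 0 ≤ n → f.coeff n = 0}
  add_mem' hf hg := ⟨add_mem hf.1 hg.1, fun n hn ↦ by simp [hf.2 n hn, hg.2 n hn]⟩
  zero_mem' := ⟨zero_mem _, by simp⟩
  neg_mem' hf := ⟨neg_mem hf.1, fun n hn ↦ by simp [hf.2 n hn]⟩
  mul_mem' {f g} hf hg := ⟨Ideal.mul_mem_left _ _ hg.1, fun n hn ↦ by
    rw [HahnSeries.coeff_mul]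
    refine Finset.sum_eq_zero fun x hx ↦ ?_
    rw [Finset.mem_antidiagonal] at hx
    by_cases h : 0 ≤ x.1
    · rw [hf.2 _ h, zero_mul]
    · rw [hg.2 x.2 (by omega), mul_zero]⟩

theorem negNil_C_mul (r : R) {f : R⸨X⸩} (h : f ∈ negNil R) : HahnSeries.C r * f ∈ negNil R :=
  ⟨Ideal.mul_mem_left _ _ h.1, fun n hn ↦ by simp [h.2 n hn]⟩

theorem negNil_pow {f : R⸨X⸩} (h : f ∈ negNil R) (n : ℕ) : f ^ (n + 1) ∈ negNil R := by
  induction n with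
  | zero => simpa using h
  | succ n ih => rw [pow_succ]; exact mul_mem ih h

theorem negNil_map (φ : R →+* S) {f : R⸨X⸩} (h : f ∈ negNil R) : laurentMap φ f ∈ negNil S :=
  ⟨nilCoeffs_map φ h.1, fun n hn ↦ by simp [h.2 n hn]⟩

theorem coeff_aeval_inv (p : Polynomial R) (n : ℤ) :
    (Polynomial.aeval (HahnSeries.single (-1) 1 : R⸨X⸩) p).coeff n =
      if n ≤ 0 then p.coeff n.natAbs else 0 := by
  induction p using Polynomial.induction_on' with
  | add p q hp hq => rw [map_add, HahnSeries.coeff_add, hp, hq]; split_ifs <;> simp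
  | monomial m r =>
    rw [Polynomial.aeval_monomial, HahnSeries.single_pow, HahnSeries.algebraMap_apply',
      PowerSeries.algebraMap_apply, HahnSeries.ofPowerSeries_C, HahnSeries.C_apply,
      HahnSeries.single_mul_single, HahnSeries.coeff_single,
      Polynomial.coeff_monomial]
    simp only [one_pow, mul_one, zero_add, smul_neg, nsmul_eq_mul, Algebra.algebraMap_self,
      RingHom.id_apply]
    split_ifs <;> first | rfl | omega

theorem aeval_mem_negNil {p : Polynomial R} (h0 : p.coeff 0 = 0)
    (h : ∀ i, IsNilpotent (p.coeff i)) :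
    Polynomial.aeval (HahnSeries.single (-1) 1 : R⸨X⸩) p ∈ negNil R := by
  refine ⟨fun n ↦ ?_, fun n hn ↦ ?_⟩
  · rw [coeff_aeval_inv]
    split_ifs
    exacts [h _, IsNilpotent.zero]
  · rw [coeff_aeval_inv]
    split_ifs
    · rw [show n.natAbs = 0 by omega, h0]
    · rfl

theorem exists_aeval_eq {f : R⸨X⸩} (h : f ∈ negNil R) : ∃ p : Polynomial R,
    p.coeff 0 = 0 ∧ (∀ i, IsNilpotent (p.coeff i)) ∧
      Polynomial.aeval (HahnSeries.single (-1) 1 : R⸨X⸩) p = f := by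
  have hc (i : ℕ) : (∑ j ∈ Finset.range ((-f.order).toNat + 1),
      Polynomial.monomial j (f.coeff (-j))).coeff i = f.coeff (-i) := by
    rw [Polynomial.finsetSum_coeff]
    simp only [Polynomial.coeff_monomial]
    rw [Finset.sum_ite_eq' (Finset.range _) i (fun j ↦ f.coeff (-(j : ℤ)))]
    split_ifs with hi
    · rfl
    · rw [HahnSeries.coeff_eq_zero_of_lt_order]
      simp only [Finset.mem_range, not_lt] at hi
      omega
  refine ⟨∑ j ∈ Finset.range ((-f.order).toNat + 1), Polynomial.monomial j (f.coeff (-j)),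
    ?_, fun i ↦ ?_, ?_⟩
  · rw [hc]; exact h.2 _ (by simp)
  · rw [hc]; exact h.1 _
  · ext n
    rw [coeff_aeval_inv]
    split_ifs with hn
    · rw [hc]; congr 1; omega
    · exact (h.2 n (by omega)).symm

theorem isNilpotent_of_mem_negNil {f : R⸨X⸩} (h : f ∈ negNil R) : IsNilpotent f := by
  obtain ⟨p, -, hp, rfl⟩ := exists_aeval_eq h
  exact (Polynomial.isNilpotent_iff.2 hp).map _

/-- The group of the units `1 + ν(t⁻¹)` of `R((t))`, where `ν` is a polynomial without constant term
whose coefficients are nilpotent. -/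
def Minus (R : Type*) [CommRing R] : Subgroup (R⸨X⸩)ˣ where
  carrier := {f | (f : R⸨X⸩) - 1 ∈ negNil R}
  one_mem' := by simp
  mul_mem' {f g} hf hg := by
    have : ((f * g : (R⸨X⸩)ˣ) : R⸨X⸩) - 1 =
        ((f : R⸨X⸩) - 1) * (g - 1) + ((f : R⸨X⸩) - 1) + (g - 1) := by
      rw [Units.val_mul]; ring
    rw [Set.mem_ofPred_eq, this]
    exact add_mem (add_mem (mul_mem hf hg) hf) hg
  inv_mem' {f} hf := by
    obtain ⟨N, hN⟩ := isNilpotent_of_mem_negNil hf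
    set x : R⸨X⸩ := (f : R⸨X⸩) - 1
    have h1 : ((f⁻¹ : (R⸨X⸩)ˣ) : R⸨X⸩) - 1 = ∑ i ∈ Finset.range N, (-x) ^ (i + 1) := by
      have h2 : (f : R⸨X⸩) * (1 + ∑ i ∈ Finset.range N, (-x) ^ (i + 1)) = 1 := by
        have h3 := mul_neg_geom_sum (-x) (N + 1)
        rw [Finset.sum_range_succ', pow_zero, neg_pow x (N + 1), pow_succ x, hN] at h3
        rw [show (f : R⸨X⸩) = 1 - -x by simp [x], add_comm, h3]
        ring
      rw [Units.inv_eq_of_mul_eq_one_right h2, add_sub_cancel_left]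
    rw [Set.mem_ofPred_eq, h1]
    exact sum_mem fun i _ ↦ negNil_pow (neg_mem hf) i

end Laurent

/-! ### Units of the Laurent series ring -/

section UnitGroups

variable {R S T : Type*} [CommRing R] [CommRing S] [CommRing T]

/-- Base change of units of the Laurent series ring. -/
abbrev laurentUnits (φ : R →+* S) : (R⸨X⸩)ˣ →* (S⸨X⸩)ˣ := Units.map (laurentMap φ).toMonoidHom

/-- The inclusion of the units of power series into the units of Laurent series. -/
abbrev arcUnit (R : Type*) [CommRing R] : (R⟦X⟧)ˣ →* (R⸨X⸩)ˣ :=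
  Units.map (HahnSeries.ofPowerSeries ℤ R).toMonoidHom

/-- Base change of units of the power series ring. -/
abbrev arcUnits (φ : R →+* S) : (R⟦X⟧)ˣ →* (S⟦X⟧)ˣ := Units.map (PowerSeries.map φ).toMonoidHom

theorem coe_arcUnit (f : (R⟦X⟧)ˣ) :
    ((arcUnit R f : (R⸨X⸩)ˣ) : R⸨X⸩) = HahnSeries.ofPowerSeries ℤ R f := rfl

@[simp] theorem laurentUnits_arcUnit (φ : R →+* S) (u : (R⟦X⟧)ˣ) :
    laurentUnits φ (arcUnit R u) = arcUnit S (arcUnits φ u) :=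
  Units.ext (laurentMap_ofPowerSeries φ _)

@[simp] theorem laurentUnits_tUnit (φ : R →+* S) : laurentUnits φ (tUnit R) = tUnit S :=
  Units.ext (by simp [tUnit])

theorem tUnit_zpow (n : ℤ) : ((tUnit R ^ n : (R⸨X⸩)ˣ) : R⸨X⸩) = HahnSeries.single n 1 := by
  have hnat (m : ℕ) : ((tUnit R ^ m : (R⸨X⸩)ˣ) : R⸨X⸩) = HahnSeries.single (m : ℤ) 1 := by
    rw [Units.val_pow_eq_pow_val]
    simp [tUnit, HahnSeries.single_pow]
  rcases n with m | m
  · simpa using hnat m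
  · rw [zpow_negSucc]
    refine Units.inv_eq_of_mul_eq_one_right ?_
    rw [hnat, HahnSeries.single_mul_single]
    simp [Int.negSucc_eq]

/-- Base change of `Minus`. -/
def minusMap (φ : R →+* S) : Minus R →* Minus S :=
  ((laurentUnits φ).comp (Minus R).subtype).codRestrict (Minus S) fun m ↦ by
    have := negNil_map φ m.2
    rwa [map_sub, map_one] at this

theorem minus_eq_one_of_isReduced [IsReduced R] (m : Minus R) : m = 1 :=
  Subtype.ext (Units.ext (sub_eq_zero.1 (nilCoeffs_eq_zero m.2.1)))

/-- The subgroups `R[[t]]ˣ` and `Minus R` of `R((t))ˣ` meet trivially. -/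
theorem arcUnit_mul_minus_inj {u u' : (R⟦X⟧)ˣ} {m m' : Minus R}
    (h : arcUnit R u * m = arcUnit R u' * m') : u = u' ∧ m = m' := by
  have h1 : arcUnit R (u'⁻¹ * u) = ((m' * m⁻¹ : Minus R) : (R⸨X⸩)ˣ) := by
    rw [map_mul, map_inv, Subgroup.coe_mul, Subgroup.coe_inv, eq_mul_inv_iff_mul_eq, mul_assoc, h,
      inv_mul_cancel_left]
  have h2 : ((m' * m⁻¹ : Minus R) : (R⸨X⸩)ˣ) = 1 := by
    refine Units.ext (sub_eq_zero.1 ?_)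
    ext n
    by_cases hn : 0 ≤ n
    · exact (m' * m⁻¹).2.2 n hn
    · rw [← h1, coe_arcUnit, HahnSeries.coeff_sub, coeff_ofPowerSeries, if_pos (by omega)]
      simp only [Units.val_one, HahnSeries.coeff_one, HahnSeries.coeff_zero]
      rw [if_neg (by omega), sub_zero]
  have h3 : m' = m := by
    rw [← mul_inv_eq_one]
    exact Subtype.ext h2
  refine ⟨?_, h3.symm⟩
  have h4 : arcUnit R u = arcUnit R u' := by
    rw [h3] at h
    exact mul_right_cancel h
  exact Units.ext (HahnSeries.ofPowerSeries_injective (congrArg Units.val h4))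

/-! ### The valuation of units of the Laurent series ring -/

theorem ordAt_eq_iff (p : PrimeSpectrum R) (f : (R⸨X⸩)ˣ) (n : ℤ) :
    ordAt p (Additive.ofMul f) = n ↔
      (f : R⸨X⸩).coeff n ∉ p.asIdeal ∧ ∀ i < n, (f : R⸨X⸩).coeff i ∈ p.asIdeal := by
  have h0 : laurentMap (algebraMap R p.asIdeal.ResidueField) (f : R⸨X⸩) ≠ 0 :=
    (f.isUnit.map _).ne_zero
  change HahnSeries.order (laurentMap (algebraMap R p.asIdeal.ResidueField) (f : R⸨X⸩)) = n ↔ _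
  have hc (i : ℤ) : (f : R⸨X⸩).coeff i ∈ p.asIdeal ↔
      (laurentMap (algebraMap R p.asIdeal.ResidueField) (f : R⸨X⸩)).coeff i = 0 := by
    rw [laurentMap_coeff, Ideal.algebraMap_residueField_eq_zero]
  simp only [hc]
  constructor
  · rintro rfl
    exact ⟨fun h ↦ h0 (HahnSeries.coeff_order_eq_zero.1 h),
      fun i hi ↦ HahnSeries.coeff_eq_zero_of_lt_order hi⟩
  · rintro ⟨h1, h2⟩
    refine le_antisymm (HahnSeries.order_le_of_coeff_ne_zero h1) (not_lt.1 fun h3 ↦ ?_)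
    exact h0 (HahnSeries.coeff_order_eq_zero.1 (h2 _ h3))

theorem ordAt_le {p : PrimeSpectrum R} {f : (R⸨X⸩)ˣ} {n : ℤ} (h : (f : R⸨X⸩).coeff n ∉ p.asIdeal) :
    ordAt p (Additive.ofMul f) ≤ n := by
  obtain ⟨-, h2⟩ := (ordAt_eq_iff p f _).1 rfl
  exact not_lt.1 fun h3 ↦ h (h2 n h3)

theorem ordAt_comap (φ : R →+* S) (p : PrimeSpectrum S) (f : (R⸨X⸩)ˣ) :
    ordAt p (Additive.ofMul (laurentUnits φ f)) =
      ordAt (PrimeSpectrum.comap φ p) (Additive.ofMul f) := by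
  rw [ordAt_eq_iff]
  exact (ordAt_eq_iff (PrimeSpectrum.comap φ p) f _).1 rfl

theorem ordAt_tUnit (p : PrimeSpectrum R) : ordAt p (Additive.ofMul (tUnit R)) = 1 := by
  rw [ordAt_eq_iff]
  refine ⟨?_, fun i hi ↦ ?_⟩
  · simpa [tUnit] using (p.2.one_notMem)
  · simp [tUnit, hi.ne]

theorem ordAt_arcUnit (p : PrimeSpectrum R) (u : (R⟦X⟧)ˣ) :
    ordAt p (Additive.ofMul (arcUnit R u)) = 0 := by
  rw [ordAt_eq_iff, coe_arcUnit]
  refine ⟨fun h ↦ p.2.ne_top (Ideal.eq_top_of_isUnit_mem _ h ?_), fun i hi ↦ ?_⟩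
  · rw [coeff_ofPowerSeries]
    simpa using PowerSeries.isUnit_iff_constantCoeff.1 u.isUnit
  · rw [coeff_ofPowerSeries, if_pos hi]
    exact zero_mem _

theorem ordAt_minus (p : PrimeSpectrum R) (m : Minus R) :
    ordAt p (Additive.ofMul (m : (R⸨X⸩)ˣ)) = 0 := by
  rw [ordAt_eq_iff]
  have hc (n : ℤ) : ((m : (R⸨X⸩)ˣ) : R⸨X⸩).coeff n =
      (1 : R⸨X⸩).coeff n + (((m : (R⸨X⸩)ˣ) : R⸨X⸩) - 1).coeff n := by
    simp
  refine ⟨?_, fun i hi ↦ ?_⟩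
  · rw [hc, m.2.2 0 le_rfl]
    simpa using p.2.one_notMem
  · rw [hc, HahnSeries.coeff_one, if_neg hi.ne, zero_add]
    exact nilradical_le_prime p.asIdeal (mem_nilradical.2 (m.2.1 i))

theorem ordAt_factored (p : PrimeSpectrum R) (n : ℤ) (u : (R⟦X⟧)ˣ) (m : Minus R) :
    ordAt p (Additive.ofMul (tUnit R ^ n * arcUnit R u * m)) = n := by
  rw [ofMul_mul, ofMul_mul, ofMul_zpow, map_add, map_add, map_zsmul, ordAt_tUnit, ordAt_arcUnit,
    ordAt_minus]
  simp

/-! ### Existence of factorizations -/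

section Existence

variable (k : Type*) [Field k] [Algebra k R]

theorem nilExp_sub_one_mem_negNil {x : R⸨X⸩} (hx : x ∈ negNil R) : nilExp k x - 1 ∈ negNil R := by
  obtain ⟨N, hN⟩ := isNilpotent_of_mem_negNil hx
  rw [nilExp_sub_one_eq hN]
  refine sum_mem fun i _ ↦ ?_
  rw [algebraMap_laurent]
  exact negNil_C_mul _ (negNil_pow hx i)

theorem nilExp_ofPowerSeries {P : R⟦X⟧} (h : IsNilpotent P) :
    nilExp k (HahnSeries.ofPowerSeries ℤ R P) = HahnSeries.ofPowerSeries ℤ R (nilExp k P) :=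
  nilExp_map (ofPowerSeriesAlgHom k R) h

/-- A unit of `R((t))` that reduces to a unit of order zero factors: divide by the power series
part, and split the logarithm of the quotient into its parts of negative and nonnegative degrees. -/
theorem exists_factor_of_order_zero [CharZero k] {f : (R⸨X⸩)ˣ} (h0 : IsUnit ((f : R⸨X⸩).coeff 0))
    (hneg : ∀ i < 0, IsNilpotent ((f : R⸨X⸩).coeff i)) :
    ∃ (u : (R⟦X⟧)ˣ) (m : Minus R), f = arcUnit R u * m := by
  -- `x` is the negative part, `U` the power series part
  have split (g : R⸨X⸩) : ∃ (x : R⸨X⸩) (U : R⟦X⟧), g = x + HahnSeries.ofPowerSeries ℤ R U ∧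
      (∀ n, 0 ≤ n → x.coeff n = 0) ∧ (∀ n < 0, x.coeff n = g.coeff n) ∧
      ∀ n : ℕ, PowerSeries.coeff n U = g.coeff n := by
    have hU (n : ℤ) := coeff_ofPowerSeries (PowerSeries.mk fun n ↦ g.coeff (n : ℤ)) n
    refine ⟨g - HahnSeries.ofPowerSeries ℤ R (PowerSeries.mk fun n ↦ g.coeff n),
      PowerSeries.mk fun n ↦ g.coeff n, by simp, fun n hn ↦ ?_, fun n hn ↦ ?_, fun n ↦ by simp⟩
    · rw [HahnSeries.coeff_sub, hU, if_neg (by omega), PowerSeries.coeff_mk,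
        Int.natAbs_of_nonneg hn, sub_self]
    · rw [HahnSeries.coeff_sub, hU, if_pos hn, sub_zero]
  obtain ⟨x, U, hf, hx0, hxn, hU⟩ := split (f : R⸨X⸩)
  have hx : x ∈ negNil R := by
    refine ⟨fun n ↦ ?_, hx0⟩
    by_cases hn : 0 ≤ n
    · rw [hx0 n hn]; exact IsNilpotent.zero
    · rw [hxn n (by omega)]; exact hneg n (by omega)
  have hUu : IsUnit U := PowerSeries.isUnit_iff_constantCoeff.2 (by
    rw [← PowerSeries.coeff_zero_eq_constantCoeff_apply, hU]; exact h0)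
  obtain ⟨U, rfl⟩ := hUu
  set y : R⸨X⸩ := x * ((arcUnit R U)⁻¹ : (R⸨X⸩)ˣ) with hy
  have hyn : IsNilpotent y :=
    Commute.isNilpotent_mul_right (Commute.all _ _) (isNilpotent_of_mem_negNil hx)
  have hynil : y ∈ nilCoeffs R := Ideal.mul_mem_right _ _ hx.1
  have hfy : (f : R⸨X⸩) = arcUnit R U * (1 + y) := by
    rw [hf, hy, mul_add, mul_one, mul_left_comm, Units.mul_inv, mul_one, add_comm]
    rfl
  have hLn : IsNilpotent (nilLog k y) := isNilpotent_nilLog hyn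
  have hLnil : nilLog k y ∈ nilCoeffs R := nilLog_mem hynil
  obtain ⟨a, P, hL, ha0, han, hP⟩ := split (nilLog k y)
  have ha : a ∈ negNil R := by
    refine ⟨fun n ↦ ?_, ha0⟩
    by_cases hn : 0 ≤ n
    · rw [ha0 n hn]; exact IsNilpotent.zero
    · rw [han n (by omega)]; exact hLnil n
  have hPn : IsNilpotent P := by
    have h1 : IsNilpotent (HahnSeries.ofPowerSeries ℤ R P) := by
      rw [← sub_eq_iff_eq_add'.2 hL]
      exact Commute.isNilpotent_sub (Commute.all _ _) hLn (isNilpotent_of_mem_negNil ha)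
    exact (IsNilpotent.map_iff HahnSeries.ofPowerSeries_injective).1 h1
  have hexp : 1 + y = nilExp k a * HahnSeries.ofPowerSeries ℤ R (nilExp k P) := by
    have hPn' : IsNilpotent (HahnSeries.ofPowerSeries ℤ R P) := hPn.map _
    rw [← nilExp_nilLog (k := k) hyn, hL, nilExp_add (isNilpotent_of_mem_negNil ha) hPn',
      nilExp_ofPowerSeries k hPn]
  obtain ⟨e, he⟩ := isUnit_nilExp (k := k) hPn
  obtain ⟨d, hd⟩ := isUnit_nilExp (k := k) (isNilpotent_of_mem_negNil ha)
  refine ⟨U * e, ⟨d, ?_⟩, Units.ext ?_⟩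
  · change (d : R⸨X⸩) - 1 ∈ negNil R
    rw [hd]
    exact nilExp_sub_one_mem_negNil k ha
  · rw [hfy, hexp, map_mul]
    simp only [Units.val_mul, coe_arcUnit, he, hd]
    ring

theorem exists_factor [CharZero k] {f : (R⸨X⸩)ˣ} {n : ℤ} (h0 : IsUnit ((f : R⸨X⸩).coeff n))
    (hneg : ∀ i < n, IsNilpotent ((f : R⸨X⸩).coeff i)) :
    ∃ (u : (R⟦X⟧)ˣ) (m : Minus R), f = tUnit R ^ n * arcUnit R u * m := by
  have hc (i : ℤ) : ((tUnit R ^ (-n) * f : (R⸨X⸩)ˣ) : R⸨X⸩).coeff i = (f : R⸨X⸩).coeff (i + n) := by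
    rw [Units.val_mul, tUnit_zpow, HahnSeries.coeff_single_mul]
    simp
  obtain ⟨u, m, h⟩ := exists_factor_of_order_zero k (f := tUnit R ^ (-n) * f)
    (by rw [hc, zero_add]; exact h0) (fun i hi ↦ by rw [hc]; exact hneg _ (by omega))
  refine ⟨u, m, ?_⟩
  rw [mul_assoc, ← h, zpow_neg, mul_inv_cancel_left]

/-- Every unit of `R((t))` factors Zariski-locally: if `n` is the order of `f` at `p`, then the
coefficient of `tⁿ` in `f`, and that of `t⁻ⁿ` in `f⁻¹`, are units near `p`, so that the order of `f`
is `n` near `p`, and the lower coefficients are nilpotent. -/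
theorem exists_local_factor [CharZero k] (p : PrimeSpectrum R) (f : (R⸨X⸩)ˣ) :
    ∃ r ∉ p.asIdeal, ∃ (n : ℤ) (u : ((Localization.Away r)⟦X⟧)ˣ) (m : Minus (Localization.Away r)),
      laurentUnits (algebraMap R (Localization.Away r)) f =
        tUnit (Localization.Away r) ^ n * arcUnit _ u * m := by
  set n := ordAt p (Additive.ofMul f) with hn
  have h1 := ((ordAt_eq_iff p f n).1 rfl).1
  have h2 : ordAt p (Additive.ofMul f⁻¹) = -n := by rw [ofMul_inv, map_neg]
  have h3 := ((ordAt_eq_iff p f⁻¹ (-n)).1 h2).1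
  refine ⟨(f : R⸨X⸩).coeff n * ((f⁻¹ : (R⸨X⸩)ˣ) : R⸨X⸩).coeff (-n), ?_, n, ?_⟩
  · exact fun h ↦ (p.2.mem_or_mem h).elim h1 h3
  set r := (f : R⸨X⸩).coeff n * ((f⁻¹ : (R⸨X⸩)ˣ) : R⸨X⸩).coeff (-n) with hr
  have hu : IsUnit (algebraMap R (Localization.Away r) r) := IsLocalization.Away.algebraMap_isUnit r
  rw [hr, map_mul] at hu
  have hu1 := isUnit_of_mul_isUnit_left hu
  have hu2 := isUnit_of_mul_isUnit_right hu
  refine exists_factor k (n := n) hu1 fun i hi ↦ ?_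
  rw [← mem_nilradical, nilradical_eq_sInf, Ideal.mem_sInf]
  intro J (hJ : J.IsPrime)
  set q : PrimeSpectrum (Localization.Away r) := ⟨J, hJ⟩
  set f' := laurentUnits (algebraMap R (Localization.Away r)) f
  have h4 : ordAt q (Additive.ofMul f') ≤ n := ordAt_le
    fun h ↦ q.2.ne_top (Ideal.eq_top_of_isUnit_mem _ h hu1)
  have h5 : ordAt q (Additive.ofMul f'⁻¹) ≤ -n := by
    refine ordAt_le fun h ↦ q.2.ne_top (Ideal.eq_top_of_isUnit_mem _ h ?_)
    exact hu2
  rw [ofMul_inv, map_neg] at h5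
  exact ((ordAt_eq_iff q f' n).1 (by omega)).2 i hi

end Existence

end UnitGroups

/-! ### Zariski-local properties and sheaves -/

section Zariski

variable {k : Type u} [Field k]

/-- The localization `R → R_r`. -/
def awayHom (R : CommAlgCat.{u} k) (r : R) : R ⟶ CommAlgCat.of k (Localization.Away r) :=
  CommAlgCat.ofHom (IsScalarTower.toAlgHom k R (Localization.Away r))

/-- The universal property of the localization. -/
theorem exists_awayHom_comp {R S : CommAlgCat.{u} k} (χ : R ⟶ S) (r : R) (h : IsUnit (χ.hom r)) :
    ∃ φ : CommAlgCat.of k (Localization.Away r) ⟶ S, awayHom R r ≫ φ = χ := by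
  have hy : ∀ y : Submonoid.powers r, IsUnit (χ.hom y) := by
    rintro ⟨_, n, rfl⟩
    rw [map_pow]
    exact h.pow n
  refine ⟨CommAlgCat.ofHom (IsLocalization.liftAlgHom (M := Submonoid.powers r)
    (f := χ.hom) hy), ?_⟩
  ext x
  exact IsLocalization.lift_eq (M := Submonoid.powers r) hy x

theorem isUnit_awayHom (R : CommAlgCat.{u} k) (r : R) : IsUnit ((awayHom R r).hom r) :=
  IsLocalization.Away.algebraMap_isUnit r

/-- A property of algebras over `R` holds Zariski-locally on `Spec R`: each point has a principal
open neighbourhood over which it holds. -/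
def Locally (R : CommAlgCat.{u} k) (P : ∀ ⦃S : CommAlgCat.{u} k⦄, (R ⟶ S) → Prop) : Prop :=
  ∀ p : PrimeSpectrum R, ∃ r ∉ p.asIdeal, P (awayHom R r)

/-- A property of algebras over `R` is stable under base change. -/
def Stable (R : CommAlgCat.{u} k) (P : ∀ ⦃S : CommAlgCat.{u} k⦄, (R ⟶ S) → Prop) : Prop :=
  ∀ ⦃S T : CommAlgCat.{u} k⦄ (φ : R ⟶ S) (ψ : S ⟶ T), P φ → P (φ ≫ ψ)

theorem Locally.mono {R : CommAlgCat.{u} k} {P Q : ∀ ⦃S : CommAlgCat.{u} k⦄, (R ⟶ S) → Prop}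
    (h : Locally R P) (hPQ : ∀ ⦃S⦄ (φ : R ⟶ S), P φ → Q φ) : Locally R Q := fun p ↦ by
  obtain ⟨r, hr, h⟩ := h p
  exact ⟨r, hr, hPQ _ h⟩

theorem Locally.and {R : CommAlgCat.{u} k} {P Q : ∀ ⦃S : CommAlgCat.{u} k⦄, (R ⟶ S) → Prop}
    (h : Locally R P) (hP : Stable R P) (h' : Locally R Q) (hQ : Stable R Q) :
    Locally R fun _ φ ↦ P φ ∧ Q φ := fun p ↦ by
  obtain ⟨r, hr, h⟩ := h p
  obtain ⟨r', hr', h'⟩ := h' p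
  refine ⟨r * r', fun hm ↦ (p.2.mem_or_mem hm).elim hr hr', ?_⟩
  have hu := isUnit_awayHom R (r * r')
  rw [map_mul] at hu
  obtain ⟨φ, hφ⟩ := exists_awayHom_comp (awayHom R (r * r')) r (isUnit_of_mul_isUnit_left hu)
  obtain ⟨ψ, hψ⟩ := exists_awayHom_comp (awayHom R (r * r')) r' (isUnit_of_mul_isUnit_right hu)
  exact ⟨hφ ▸ hP _ φ h, hψ ▸ hQ _ ψ h'⟩

/-- Properties that hold locally hold locally after base change. -/
theorem Locally.comp {R S : CommAlgCat.{u} k} {P : ∀ ⦃S : CommAlgCat.{u} k⦄, (R ⟶ S) → Prop}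
    (h : Locally R P) (hP : Stable R P) (χ : R ⟶ S) : Locally S fun _ φ ↦ P (χ ≫ φ) := fun p ↦ by
  obtain ⟨r, hr, h⟩ := h (PrimeSpectrum.comap (χ.hom : R →+* S) p)
  refine ⟨χ.hom r, hr, ?_⟩
  obtain ⟨φ, hφ⟩ := exists_awayHom_comp (χ ≫ awayHom S (χ.hom r)) r (isUnit_awayHom S _)
  exact hφ ▸ hP _ φ h

/-- By quasi-compactness, finitely many of the neighbourhoods cover `Spec R`. -/
theorem Locally.exists_cover {R : CommAlgCat.{u} k}
    {P : ∀ ⦃S : CommAlgCat.{u} k⦄, (R ⟶ S) → Prop} (h : Locally R P) :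
    ∃ s : Finset R, Ideal.span (s : Set R) = ⊤ ∧ ∀ r ∈ s, P (awayHom R r) := by
  have h1 : Ideal.span {r : R | P (awayHom R r)} = ⊤ := by
    by_contra hne
    obtain ⟨M, hM, hle⟩ := Ideal.exists_le_maximal _ hne
    obtain ⟨r, hr, hP⟩ := h ⟨M, hM.isPrime⟩
    exact hr (hle (Ideal.subset_span hP))
  obtain ⟨s, hs, h2⟩ := Submodule.mem_span_finite_of_mem_span ((Ideal.eq_top_iff_one _).1 h1)
  exact ⟨s, (Ideal.eq_top_iff_one _).2 h2, fun r hr ↦ hs hr⟩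

theorem Locally.of_cover {R : CommAlgCat.{u} k}
    {P : ∀ ⦃S : CommAlgCat.{u} k⦄, (R ⟶ S) → Prop} (s : Finset R)
    (hs : Ideal.span (s : Set R) = ⊤) (h : ∀ r ∈ s, P (awayHom R r)) : Locally R P := fun p ↦ by
  by_contra! hp
  refine p.2.ne_top (top_le_iff.1 (hs ▸ Ideal.span_le.2 fun r hr ↦ ?_))
  by_contra hr'
  exact hp r hr' (h r hr)

variable (k) in
/-- A sheaf of nonempty sets on affine `k`-schemes for the Zariski topology. -/
structure ZSheaf where
  obj : CommAlgCat.{u} k → Type w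
  nonempty (R : CommAlgCat.{u} k) : Nonempty (obj R)
  map {R S : CommAlgCat.{u} k} (φ : R ⟶ S) : obj R → obj S
  map_comp {R S T : CommAlgCat.{u} k} (φ : R ⟶ S) (ψ : S ⟶ T) (x : obj R) :
    map (φ ≫ ψ) x = map ψ (map φ x)
  sep (R : CommAlgCat.{u} k) (x y : obj R) : Locally R (fun _ φ ↦ map φ x = map φ y) → x = y
  glue (R : CommAlgCat.{u} k) (s : Finset R) (_ : Ideal.span (s : Set R) = ⊤)
    (h : ∀ r : R, obj (CommAlgCat.of k (Localization.Away r)))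
    (compat : ∀ r ∈ s, ∀ r' ∈ s, ∀ (S : CommAlgCat.{u} k)
      (φ : CommAlgCat.of k (Localization.Away r) ⟶ S)
      (ψ : CommAlgCat.of k (Localization.Away r') ⟶ S),
      awayHom R r ≫ φ = awayHom R r' ≫ ψ → map φ (h r) = map ψ (h r')) :
    ∃ h₀ : obj R, ∀ r ∈ s, map (awayHom R r) h₀ = h r

/-- A section of a sheaf that exists locally and is determined by a property stable under base
change exists globally. -/
theorem ZSheaf.exists_of_local (F : ZSheaf.{u, w} k) (R : CommAlgCat.{u} k)
    (Q : ∀ ⦃S : CommAlgCat.{u} k⦄, (R ⟶ S) → F.obj S → Prop)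
    (stable : ∀ ⦃S T : CommAlgCat.{u} k⦄ (φ : R ⟶ S) (ψ : S ⟶ T) (x : F.obj S),
      Q φ x → Q (φ ≫ ψ) (F.map ψ x))
    (unique : ∀ ⦃S : CommAlgCat.{u} k⦄ (φ : R ⟶ S) (x y : F.obj S), Q φ x → Q φ y → x = y)
    (ex : Locally R fun _ φ ↦ ∃ x, Q φ x) :
    ∃ x₀ : F.obj R, (∀ ⦃S : CommAlgCat.{u} k⦄ (φ : R ⟶ S) (x : F.obj S), Q φ x → F.map φ x₀ = x) ∧
      Locally R fun _ φ ↦ Q φ (F.map φ x₀) := by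
  classical
  obtain ⟨s, hs, hex⟩ := ex.exists_cover
  choose x hx using hex
  obtain ⟨x₀, hx₀⟩ := F.glue R s hs
    (fun r ↦ if hr : r ∈ s then x r hr else (F.nonempty _).some) (by
    intro r hr r' hr' S φ ψ h
    simp only [hr, hr', dif_pos]
    refine unique (awayHom R r ≫ φ) _ _ (stable _ _ _ (hx r hr)) ?_
    rw [h]
    exact stable _ _ _ (hx r' hr'))
  have hx₀' (r) (hr : r ∈ s) : F.map (awayHom R r) x₀ = x r hr := by
    rw [hx₀ r hr, dif_pos hr]
  have hloc : Locally R fun _ φ ↦ Q φ (F.map φ x₀) :=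
    Locally.of_cover s hs fun r hr ↦ by rw [hx₀' r hr]; exact hx r hr
  refine ⟨x₀, fun S φ y hy ↦ F.sep S _ _ ?_, hloc⟩
  refine (hloc.comp (P := fun _ φ ↦ Q φ (F.map φ x₀)) (fun S T φ ψ h ↦ ?_) φ).mono
    fun T ψ h ↦ ?_
  · simp only [F.map_comp]
    exact stable _ _ _ h
  · rw [← F.map_comp]
    exact unique _ _ _ h (stable _ _ _ hy)

theorem eq_of_locally {R : CommAlgCat.{u} k} {x y : R}
    (h : Locally R fun _ φ ↦ φ.hom x = φ.hom y) : x = y := by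
  let I : Ideal R := Submodule.annihilator (Ideal.span {x - y})
  have hI (a : R) : a ∈ I ↔ a * (x - y) = 0 := by
    simp [I]
  by_contra hxy
  have hne : I ≠ ⊤ := fun h1 ↦ hxy (sub_eq_zero.1 (by
    simpa using (hI 1).1 (h1 ▸ Submodule.mem_top)))
  obtain ⟨M, hM, hle⟩ := Ideal.exists_le_maximal _ hne
  obtain ⟨r, hr, hr'⟩ := h ⟨M, hM.isPrime⟩
  obtain ⟨⟨_, n, rfl⟩, hc⟩ := (IsLocalization.eq_iff_exists (Submonoid.powers r) _).1 hr'
  refine hr (hM.isPrime.mem_of_pow_mem n (hle ((hI _).2 ?_)))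
  rw [mul_sub, sub_eq_zero]
  exact hc

/-- The structure sheaf of `Spec R` is a sheaf. -/
theorem exists_glue {R : CommAlgCat.{u} k} (s : Finset R) (hs : Ideal.span (s : Set R) = ⊤)
    (h : ∀ r : R, CommAlgCat.of k (Localization.Away r))
    (compat : ∀ r ∈ s, ∀ r' ∈ s, ∀ (S : CommAlgCat.{u} k)
      (φ : CommAlgCat.of k (Localization.Away r) ⟶ S)
      (ψ : CommAlgCat.of k (Localization.Away r') ⟶ S),
      awayHom R r ≫ φ = awayHom R r' ≫ ψ → φ.hom (h r) = ψ.hom (h r')) :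
    ∃ x : R, ∀ r ∈ s, (awayHom R r).hom x = h r := by
  obtain ⟨x, hx, -⟩ := Localization.existsUnique_algebraMap_eq_of_span_eq_top (s : Set R) hs
    (fun r ↦ h r) (fun a b ↦ by
      have h1 : IsUnit ((awayHom R (a * b : R)).hom (a : R)) := by
        have := isUnit_awayHom R (a * b : R)
        rw [map_mul] at this
        exact isUnit_of_mul_isUnit_left this
      have h2 : IsUnit ((awayHom R (a * b : R)).hom (b : R)) := by
        have := isUnit_awayHom R (a * b : R)
        rw [map_mul] at this
        exact isUnit_of_mul_isUnit_right this
      obtain ⟨φ, hφ⟩ := exists_awayHom_comp _ _ h1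
      obtain ⟨ψ, hψ⟩ := exists_awayHom_comp _ _ h2
      have key := compat a a.2 b b.2 _ φ ψ (by rw [hφ, hψ])
      convert key using 1
      · congr 1
        refine IsLocalization.ringHom_ext (Submonoid.powers (a : R)) ?_
        ext x
        have := congrArg (fun χ ↦ χ.hom x) hφ
        refine Eq.trans ?_ this.symm
        simp [IsLocalization.Away.awayToAwayRight]
        rfl
      · congr 1
        refine IsLocalization.ringHom_ext (Submonoid.powers (b : R)) ?_
        ext x
        have := congrArg (fun χ ↦ χ.hom x) hψ
        refine Eq.trans ?_ this.symm
        simp [IsLocalization.Away.awayToAwayLeft]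
        rfl)
  exact ⟨x, fun r hr ↦ hx ⟨r, hr⟩⟩

variable (k) in
/-- The sheaf `𝔾ₘ`. -/
def unitsSheaf : ZSheaf.{u, u} k where
  obj R := (R : Type u)ˣ
  nonempty R := ⟨1⟩
  map {R S} φ := Units.map (φ.hom : R →* S)
  map_comp φ ψ x := rfl
  sep R x y h := Units.ext (eq_of_locally (h.mono fun _ _ h ↦ congrArg Units.val h))
  glue R s hs h compat := by
    obtain ⟨x, hx⟩ := exists_glue s hs (fun r ↦ (h r).val)
      fun r hr r' hr' S φ ψ e ↦ congrArg Units.val (compat r hr r' hr' S φ ψ e)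
    obtain ⟨y, hy⟩ := exists_glue s hs (fun r ↦ (h r).inv)
      fun r hr r' hr' S φ ψ e ↦ congrArg Units.inv (compat r hr r' hr' S φ ψ e)
    have hxy : x * y = 1 := eq_of_locally (Locally.of_cover s hs fun r hr ↦ by
      rw [map_mul, hx r hr, hy r hr, map_one]; exact (h r).val_inv)
    exact ⟨⟨x, y, hxy, by rw [mul_comm, hxy]⟩, fun r hr ↦ Units.ext (hx r hr)⟩

theorem laurent_eq_of_locally {R : CommAlgCat.{u} k} {x y : (R : Type u)⸨X⸩}
    (h : Locally R fun S φ ↦ laurentMap (φ.hom : R →+* S) x = laurentMap (φ.hom : R →+* S) y) :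
    x = y := by
  ext n
  exact eq_of_locally (h.mono fun _ _ h ↦ congrArg (fun f ↦ HahnSeries.coeff f n) h)

theorem laurent_exists_glue {R : CommAlgCat.{u} k} (s : Finset R)
    (hs : Ideal.span (s : Set R) = ⊤) (h : ∀ r : R, (Localization.Away r)⸨X⸩)
    (compat : ∀ r ∈ s, ∀ r' ∈ s, ∀ (S : CommAlgCat.{u} k)
      (φ : CommAlgCat.of k (Localization.Away r) ⟶ S)
      (ψ : CommAlgCat.of k (Localization.Away r') ⟶ S),
      awayHom R r ≫ φ = awayHom R r' ≫ ψ →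
        laurentMap (φ.hom : Localization.Away r →+* S) (h r) =
          laurentMap (ψ.hom : Localization.Away r' →+* S) (h r')) :
    ∃ x : (R : Type u)⸨X⸩, ∀ r ∈ s,
      laurentMap ((awayHom R r).hom : R →+* Localization.Away r) x = h r := by
  have hc (n : ℤ) := exists_glue s hs (fun r ↦ (h r).coeff n) fun r hr r' hr' S φ ψ e ↦
    congrArg (fun f ↦ HahnSeries.coeff f n) (compat r hr r' hr' S φ ψ e)
  choose x hx using hc
  -- the orders of the finitely many local sections are bounded below
  obtain ⟨N, hN⟩ : ∃ N : ℤ, ∀ r ∈ s, N ≤ (h r).order := by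
    obtain ⟨N, hN⟩ := (s.image fun r ↦ (h r).order).finite_toSet.bddBelow
    exact ⟨N, fun r hr ↦ hN (by simpa using ⟨r, hr, rfl⟩)⟩
  have hb : BddBelow (Function.support x) := by
    refine ⟨N, fun n hn ↦ not_lt.1 fun hlt ↦ hn ?_⟩
    refine eq_of_locally (Locally.of_cover s hs fun r hr ↦ ?_)
    rw [hx n r hr, HahnSeries.coeff_eq_zero_of_lt_order (hlt.trans_le (hN r hr)), map_zero]
  refine ⟨HahnSeries.ofSuppBddBelow x hb, fun r hr ↦ ?_⟩
  ext n
  exact hx n r hr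

variable (k) in
/-- The sheaf `R ↦ R((t))ˣ`. -/
def laurentSheaf : ZSheaf.{u, u} k where
  obj R := ((R : Type u)⸨X⸩)ˣ
  nonempty R := ⟨1⟩
  map {R S} φ := laurentUnits (φ.hom : R →+* S)
  map_comp φ ψ x := rfl
  sep R x y h := Units.ext (laurent_eq_of_locally (h.mono fun _ _ h ↦ congrArg Units.val h))
  glue R s hs h compat := by
    obtain ⟨x, hx⟩ := laurent_exists_glue s hs (fun r ↦ (h r).val)
      fun r hr r' hr' S φ ψ e ↦ congrArg Units.val (compat r hr r' hr' S φ ψ e)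
    obtain ⟨y, hy⟩ := laurent_exists_glue s hs (fun r ↦ (h r).inv)
      fun r hr r' hr' S φ ψ e ↦ congrArg Units.inv (compat r hr r' hr' S φ ψ e)
    have hxy : x * y = 1 := laurent_eq_of_locally (Locally.of_cover s hs fun r hr ↦ by
      rw [map_mul, hx r hr, hy r hr, map_one]; exact (h r).val_inv)
    exact ⟨⟨x, y, hxy, by rw [mul_comm, hxy]⟩, fun r hr ↦ Units.ext (hx r hr)⟩

end Zariski

/-! ### The group `Γ ⊗ M` -/

section Torus

variable {Γ : Type v} [AddCommGroup Γ] {M N P : Type*} [CommGroup M] [CommGroup N] [CommGroup P]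

theorem expPt_mul (f g : M) (γ : Γ) : expPt (f * g) γ = expPt f γ * expPt g γ :=
  congrArg Multiplicative.ofAdd (TensorProduct.tmul_add γ (Additive.ofMul f) (Additive.ofMul g))

theorem expPt_add (f : M) (γ γ' : Γ) : expPt f (γ + γ') = expPt f γ * expPt f γ' :=
  congrArg Multiplicative.ofAdd (TensorProduct.add_tmul γ γ' (Additive.ofMul f))

@[simp] theorem expPt_one (γ : Γ) : expPt (1 : M) γ = 1 :=
  congrArg Multiplicative.ofAdd (TensorProduct.tmul_zero (Additive M) γ)

@[simp] theorem expPt_zero (f : M) : expPt f (0 : Γ) = 1 :=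
  congrArg Multiplicative.ofAdd (TensorProduct.zero_tmul Γ (Additive.ofMul f))

theorem expPt_neg (f : M) (γ : Γ) : expPt f (-γ) = (expPt f γ)⁻¹ := by
  rw [eq_inv_iff_mul_eq_one, ← expPt_add, neg_add_cancel, expPt_zero]

theorem expPt_zsmul (f : M) (n : ℤ) (γ : Γ) : expPt f (n • γ) = expPt (f ^ n) γ :=
  congrArg Multiplicative.ofAdd (TensorProduct.smul_tmul n γ (Additive.ofMul f))

@[simp] theorem torusMap_expPt (f : M →* N) (x : M) (γ : Γ) :
    torusMap Γ f (expPt x γ) = expPt (f x) γ := rfl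

theorem torus_induction {C : TorusPts Γ M → Prop} (x : TorusPts Γ M) (one : C 1)
    (exp : ∀ f γ, C (expPt f γ)) (mul : ∀ x y, C x → C y → C (x * y)) : C x :=
  TensorProduct.induction_on (motive := fun z ↦ C (Multiplicative.ofAdd z)) x.toAdd one
    (fun γ f ↦ exp f.toMul γ) (fun _ _ hx hy ↦ mul _ _ hx hy)

theorem torus_hom_ext {G : Type*} [Monoid G] {φ ψ : TorusPts Γ M →* G}
    (h : ∀ f γ, φ (expPt f γ) = ψ (expPt f γ)) : φ = ψ := by
  refine MonoidHom.ext fun x ↦ ?_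
  induction x using torus_induction with
  | one => rw [map_one, map_one]
  | exp f γ => exact h f γ
  | mul x y hx hy => rw [map_mul, map_mul, hx, hy]

theorem torusMap_comp (f : M →* N) (g : N →* P) (x : TorusPts Γ M) :
    torusMap Γ (g.comp f) x = torusMap Γ g (torusMap Γ f x) :=
  DFunLike.congr_fun (torus_hom_ext (φ := torusMap Γ (g.comp f))
    (ψ := (torusMap Γ g).comp (torusMap Γ f)) fun _ _ ↦ rfl) x

theorem torusMap_id (x : TorusPts Γ M) : torusMap Γ (MonoidHom.id M) x = x :=
  DFunLike.congr_fun (torus_hom_ext (φ := torusMap Γ (MonoidHom.id M))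
    (ψ := MonoidHom.id _) fun _ _ ↦ rfl) x

/-- The homomorphism `Γ ⊗ M → P` defined by a bimultiplicative map. -/
def torusLift (h : Γ → M →* P) (hadd : ∀ γ γ' m, h (γ + γ') m = h γ m * h γ' m) :
    TorusPts Γ M →* P :=
  AddMonoidHom.toMultiplicativeLeft (β := P) <| TensorProduct.liftAddHom
    (AddMonoidHom.mk' (fun γ ↦ MonoidHom.toAdditive (h γ)) fun γ γ' ↦ by
      ext m
      exact hadd γ γ' m)
    (fun n γ m ↦ by
      let F : Γ →+ (Additive M →+ Additive P) :=
        AddMonoidHom.mk' (fun γ ↦ MonoidHom.toAdditive (h γ)) fun γ γ' ↦ by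
          ext m
          exact hadd γ γ' m
      change F (n • γ) m = F γ (n • m)
      rw [map_zsmul, map_zsmul]
      rfl)

@[simp] theorem torusLift_expPt (h : Γ → M →* P) (hadd) (m : M) (γ : Γ) :
    torusLift h hadd (expPt m γ) = h γ m := rfl

/-- The pairing `Γ ⊗ M × Γ ⊗ N → P` defined by a bilinear form `c` on `Γ` and a pairing
`M × N → P`: it sends `f^γ`, `g^γ'` to `(f, g)^{c(γ, γ')}`. -/
def torusPairing (c : LinearMap.BilinForm ℤ Γ) (h : M →* N →* P) :
    TorusPts Γ M →* TorusPts Γ N →* P :=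
  torusLift (fun γ ↦
    { toFun m := torusLift (fun γ' ↦ (zpowGroupHom (c γ γ')).comp (h m)) fun γ₁ γ₂ n ↦ by
        simp [zpow_add]
      map_one' := torus_hom_ext fun n γ' ↦ by simp
      map_mul' m m' := torus_hom_ext fun n γ' ↦ by simp [mul_zpow] })
    fun γ γ' m ↦ torus_hom_ext fun n γ'' ↦ by simp [zpow_add]

@[simp] theorem torusPairing_expPt (c : LinearMap.BilinForm ℤ Γ) (h : M →* N →* P) (f : M) (g : N)
    (γ γ' : Γ) : torusPairing c h (expPt f γ) (expPt g γ') = h f g ^ c γ γ' := rfl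

theorem torusPairing_ext {φ ψ : TorusPts Γ M →* TorusPts Γ N →* P}
    (h : ∀ f γ g γ', φ (expPt f γ) (expPt g γ') = ψ (expPt f γ) (expPt g γ')) : φ = ψ :=
  torus_hom_ext fun f γ ↦ torus_hom_ext fun g γ' ↦ h f γ g γ'

theorem torusPairing_eq_one {c : LinearMap.BilinForm ℤ Γ} {h : M →* N →* P} {M' N' : Type*}
    [CommGroup M'] [CommGroup N'] (i : M' →* M) (j : N' →* N) (hij : ∀ x y, h (i x) (j y) = 1)
    (x : TorusPts Γ M') (y : TorusPts Γ N') :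
    torusPairing c h (torusMap Γ i x) (torusMap Γ j y) = 1 := by
  have : (((torusPairing c h).comp (torusMap Γ i)).compr₂ (MonoidHom.id P)).compl₂ (torusMap Γ j) =
      1 := torusPairing_ext fun f γ g γ' ↦ by simp [hij]
  exact DFunLike.congr_fun (DFunLike.congr_fun this x) y

/-! ### Coordinates with respect to a basis of the lattice -/

variable {ι : Type*} (b : Module.Basis ι ℤ Γ)

/-- The coordinates of a point of `Γ ⊗ M` with respect to a basis of `Γ`. -/
def torusCoord (M : Type*) [CommGroup M] (i : ι) : TorusPts Γ M →* M :=
  torusLift (fun γ ↦ zpowGroupHom (b.coord i γ)) fun γ γ' m ↦ by simp [zpow_add]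

@[simp] theorem torusCoord_expPt (i : ι) (f : M) (γ : Γ) :
    torusCoord b M i (expPt f γ) = f ^ b.coord i γ := rfl

theorem torusCoord_torusMap (f : M →* N) (i : ι) (x : TorusPts Γ M) :
    torusCoord b N i (torusMap Γ f x) = f (torusCoord b M i x) := by
  have : (torusCoord b N i).comp (torusMap Γ f) = f.comp (torusCoord b M i) :=
    torus_hom_ext fun g γ ↦ by simp
  exact DFunLike.congr_fun this x

variable [Fintype ι]

theorem prod_expPt_torusCoord (x : TorusPts Γ M) : ∏ i, expPt (torusCoord b M i x) (b i) = x := by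
  induction x using torus_induction with
  | one => simp
  | exp f γ =>
    simp only [torusCoord_expPt, ← expPt_zsmul]
    conv_rhs => rw [← b.sum_repr γ]
    have h (s : Finset ι) : ∏ i ∈ s, expPt f (b.coord i γ • b i) =
        expPt f (∑ i ∈ s, b.repr γ i • b i) := by
      classical
      induction s using Finset.induction_on with
      | empty => simp
      | insert a s ha ih => rw [Finset.prod_insert ha, Finset.sum_insert ha, expPt_add, ih]; rfl
    exact h _
  | mul x y hx hy =>
    simp only [map_mul, expPt_mul, Finset.prod_mul_distrib]
    rw [hx, hy]

theorem torusCoord_ext {x y : TorusPts Γ M} (h : ∀ i, torusCoord b M i x = torusCoord b M i y) :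
    x = y := by
  rw [← prod_expPt_torusCoord b x, ← prod_expPt_torusCoord b y]
  simp [h]

theorem torusCoord_prod [DecidableEq ι] (f : ι → M) (j : ι) :
    torusCoord b M j (∏ i, expPt (f i) (b i)) = f j := by
  rw [map_prod, Finset.prod_eq_single j]
  · simp
  · intro i _ hij
    simp [Finsupp.single_eq_of_ne hij.symm]
  · simp

/-- Injectivity of `Γ ⊗ M → Γ ⊗ N`, `Γ` being free. -/
theorem torusMap_injective [Module.Free ℤ Γ] [Module.Finite ℤ Γ] {f : M →* N}
    (hf : Function.Injective f) : Function.Injective (torusMap Γ f) := fun x y h ↦ by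
  refine torusCoord_ext (Module.Free.chooseBasis ℤ Γ) fun i ↦ hf ?_
  rw [← torusCoord_torusMap, h, torusCoord_torusMap]

variable (Γ) in
/-- If `M × N → P`, `(x, y) ↦ f(x) g(y)`, is injective, then the same is true after tensoring
with `Γ`. -/
theorem torusMap_mul_inj [Module.Free ℤ Γ] [Module.Finite ℤ Γ] {f : M →* P} {g : N →* P}
    (hfg : ∀ x y x' y', f x * g y = f x' * g y' → x = x' ∧ y = y') {x x' : TorusPts Γ M}
    {y y' : TorusPts Γ N}
    (h : torusMap Γ f x * torusMap Γ g y = torusMap Γ f x' * torusMap Γ g y') :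
    x = x' ∧ y = y' := by
  let b := Module.Free.chooseBasis ℤ Γ
  have h1 (i) := hfg (torusCoord b M i x) (torusCoord b N i y) (torusCoord b M i x')
    (torusCoord b N i y') (by simp only [← torusCoord_torusMap, ← map_mul, h])
  exact ⟨torusCoord_ext b fun i ↦ (h1 i).1, torusCoord_ext b fun i ↦ (h1 i).2⟩

end Torus

/-! ### Factorizations of units -/

section Fac

variable {R S T : Type*} [CommRing R] [CommRing S] [CommRing T]

/-- The group of the factorizations `tⁿ u m`, with `u ∈ R[[t]]ˣ` and `m ∈ Minus R`, of units
of `R((t))`. -/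
abbrev Fac (R : Type*) [CommRing R] := Multiplicative ℤ × (R⟦X⟧)ˣ × Minus R

/-- The unit of `R((t))` that is factored. -/
def facVal (R : Type*) [CommRing R] : Fac R →* (R⸨X⸩)ˣ :=
  (zpowersHom _ (tUnit R)).coprod ((arcUnit R).coprod (Minus R).subtype)

theorem facVal_apply (x : Fac R) :
    facVal R x = tUnit R ^ x.1.toAdd * (arcUnit R x.2.1 * (x.2.2 : (R⸨X⸩)ˣ)) := rfl

/-- Base change of factorizations. -/
def facMap (φ : R →+* S) : Fac R →* Fac S :=
  (MonoidHom.id _).prodMap ((arcUnits φ).prodMap (minusMap φ))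

theorem facVal_facMap (φ : R →+* S) (x : Fac R) :
    facVal S (facMap φ x) = laurentUnits φ (facVal R x) := by
  rw [facVal_apply, facVal_apply, map_mul, map_mul, map_zpow, laurentUnits_tUnit,
    laurentUnits_arcUnit]
  rfl

/-- Factorizations over a nonzero ring are unique. -/
theorem facVal_injective [Nontrivial R] : Function.Injective (facVal R) := fun x y h ↦ by
  obtain ⟨p⟩ : Nonempty (PrimeSpectrum R) := inferInstance
  have hn : x.1 = y.1 := by
    have hx := ordAt_factored p x.1.toAdd x.2.1 x.2.2
    have hy := ordAt_factored p y.1.toAdd y.2.1 y.2.2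
    rw [mul_assoc, ← facVal_apply] at hx hy
    rw [h] at hx
    exact hx.symm.trans hy
  rw [facVal_apply, facVal_apply, hn, mul_right_inj] at h
  obtain ⟨h1, h2⟩ := arcUnit_mul_minus_inj h
  exact Prod.ext hn (Prod.ext h1 h2)

theorem locally_exists_fac {k : Type u} [Field k] [CharZero k] {R : CommAlgCat.{u} k}
    (f : ((R : Type u)⸨X⸩)ˣ) :
    Locally R fun S φ ↦ ∃ x : Fac S, facVal S x = laurentUnits (φ.hom : R →+* S) f := fun p ↦ by
  obtain ⟨r, hr, n, u, m, h⟩ := exists_local_factor k p f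
  exact ⟨r, hr, (Multiplicative.ofAdd n, u, m), by rw [facVal_apply, ← mul_assoc]; exact h.symm⟩

/-! ### The pairing `exp Res (log f₋ d log g₊)` -/

/-- The logarithmic derivative of a unit of `R[[t]]`. -/
def dlog (u : (R⟦X⟧)ˣ) : R⟦X⟧ :=
  PowerSeries.derivative R (u : R⟦X⟧) * ((u⁻¹ : (R⟦X⟧)ˣ) : R⟦X⟧)

theorem dlog_mul (u v : (R⟦X⟧)ˣ) : dlog (u * v) = dlog u + dlog v := by
  rw [dlog, dlog, dlog, Units.val_mul, Derivation.leibniz, mul_inv, Units.val_mul, smul_eq_mul,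
    smul_eq_mul]
  have hu : (u : R⟦X⟧) * ((u⁻¹ : (R⟦X⟧)ˣ) : R⟦X⟧) = 1 := u.mul_inv
  have hv : (v : R⟦X⟧) * ((v⁻¹ : (R⟦X⟧)ˣ) : R⟦X⟧) = 1 := v.mul_inv
  linear_combination (PowerSeries.derivative R (v : R⟦X⟧) * ((v⁻¹ : (R⟦X⟧)ˣ) : R⟦X⟧)) * hu +
    (PowerSeries.derivative R (u : R⟦X⟧) * ((u⁻¹ : (R⟦X⟧)ˣ) : R⟦X⟧)) * hv

theorem dlog_C (a : Rˣ) : dlog (Units.map (PowerSeries.C (R := R)).toMonoidHom a) = 0 := by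
  rw [dlog]
  have : PowerSeries.derivative R (PowerSeries.C (a : R)) = 0 := by
    ext n
    simp
  rw [Units.coe_map]
  exact (congrArg (· * _) this).trans (zero_mul _)

theorem dlog_map (φ : R →+* S) (u : (R⟦X⟧)ˣ) :
    dlog (arcUnits φ u) = PowerSeries.map φ (dlog u) := by
  have : PowerSeries.derivative S (PowerSeries.map φ (u : R⟦X⟧)) =
      PowerSeries.map φ (PowerSeries.derivative R (u : R⟦X⟧)) := by
    ext n
    simp [PowerSeries.coeff_derivative]
  rw [dlog, dlog, map_mul, ← map_inv]
  exact congrArg (· * _) this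

section

variable (k : Type*) [Field k] [Algebra k R] [Algebra k S]

/-- `Res (log m · d log u)` -/
def resPair (m : Minus R) (u : (R⟦X⟧)ˣ) : R :=
  (nilLog k ((m : (R⸨X⸩)ˣ) - 1 : R⸨X⸩) * HahnSeries.ofPowerSeries ℤ R (dlog u)).coeff (-1)

theorem isNilpotent_resPair (m : Minus R) (u : (R⟦X⟧)ˣ) : IsNilpotent (resPair k m u) :=
  (Ideal.mul_mem_right _ _ (nilLog_mem m.2.1) : _ ∈ nilCoeffs R) (-1)

theorem resPair_mul_right (m : Minus R) (u v : (R⟦X⟧)ˣ) :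
    resPair k m (u * v) = resPair k m u + resPair k m v := by
  rw [resPair, dlog_mul, map_add, mul_add, HahnSeries.coeff_add]
  rfl

theorem resPair_mul_left [CharZero k] (m m' : Minus R) (u : (R⟦X⟧)ˣ) :
    resPair k (m * m') u = resPair k m u + resPair k m' u := by
  rw [resPair, nilLog_mul (isNilpotent_of_mem_negNil m.2) (isNilpotent_of_mem_negNil m'.2)
    (by simp), add_mul, HahnSeries.coeff_add]
  rfl

theorem resPair_map {k} [Field k] [Algebra k R] [Algebra k S] (φ : R →ₐ[k] S) (m : Minus R)
    (u : (R⟦X⟧)ˣ) :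
    resPair k (minusMap (φ : R →+* S) m) (arcUnits (φ : R →+* S) u) = φ (resPair k m u) := by
  have h := nilLog_map (laurentAlgMap φ) (isNilpotent_of_mem_negNil m.2)
  rw [map_sub, map_one] at h
  rw [resPair, dlog_map, ← laurentMap_ofPowerSeries]
  change (nilLog k (laurentAlgMap φ ((m : (R⸨X⸩)ˣ) : R⸨X⸩) - 1) * _).coeff (-1) = _
  rw [h]
  change (laurentMap (φ : R →+* S) _ * laurentMap (φ : R →+* S) _).coeff (-1) = _
  rw [← map_mul, laurentMap_coeff]
  rfl

variable [CharZero k]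

/-- `exp x`, as a unit. -/
def nilExpUnit (x : R) (hx : IsNilpotent x) : Rˣ where
  val := nilExp k x
  inv := nilExp k (-x)
  val_inv := by rw [mul_comm, nilExp_neg_mul hx]
  inv_val := nilExp_neg_mul hx

theorem nilExpUnit_add (x y : R) (hx : IsNilpotent x) (hy : IsNilpotent y)
    (h : IsNilpotent (x + y)) :
    nilExpUnit k (x + y) h = nilExpUnit k x hx * nilExpUnit k y hy :=
  Units.ext (nilExp_add hx hy)

/-- The pairing `exp Res (log m · d log u)`. -/
def resExp : Minus R →* (R⟦X⟧)ˣ →* Rˣ :=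
  MonoidHom.mk' (fun m ↦ MonoidHom.mk' (fun u ↦ nilExpUnit k (resPair k m u)
      (isNilpotent_resPair k m u)) fun u v ↦ by
        simp only [resPair_mul_right]
        exact nilExpUnit_add k _ _ (isNilpotent_resPair k m u) (isNilpotent_resPair k m v) _)
    fun m m' ↦ by
      refine MonoidHom.ext fun u ↦ ?_
      simp only [MonoidHom.mk'_apply, MonoidHom.mul_apply, resPair_mul_left]
      exact nilExpUnit_add k _ _ (isNilpotent_resPair k m u) (isNilpotent_resPair k m' u) _

theorem coe_resExp (m : Minus R) (u : (R⟦X⟧)ˣ) : (resExp k m u : R) = nilExp k (resPair k m u) :=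
  rfl

theorem resExp_map (φ : R →ₐ[k] S) (m : Minus R) (u : (R⟦X⟧)ˣ) :
    resExp k (minusMap (φ : R →+* S) m) (arcUnits (φ : R →+* S) u) =
      Units.map (φ : R →* S) (resExp k m u) :=
  Units.ext (by
    rw [coe_resExp, resPair_map, nilExp_map φ (isNilpotent_resPair k m u)]
    rfl)

end

/-! ### The Contou-Carrère symbol -/

/-- The constant term of a unit of `R[[t]]`. -/
abbrev constUnit (R : Type*) [CommRing R] : (R⟦X⟧)ˣ →* Rˣ :=
  Units.map (PowerSeries.constantCoeff (R := R)).toMonoidHom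

section

variable (k : Type*) [Field k] [CharZero k] [Algebra k R] [Algebra k S]

/-- One half of the Contou-Carrère symbol, in terms of factorizations:
`(tⁿ u m, tⁿ' u' m') ↦ u(0)ⁿ' exp Res (log m · d log u')`. It is bimultiplicative, and the symbol
is its antisymmetrization, up to the sign `(-1)^{n n'}`. -/
def halfFac : Fac R →* Fac R →* Rˣ :=
  MonoidHom.mk' (fun x ↦ MonoidHom.mk'
      (fun y ↦ constUnit R x.2.1 ^ y.1.toAdd * resExp k x.2.2 y.2.1)
      fun y y' ↦ by
        simp only [Prod.fst_mul, Prod.snd_mul, toAdd_mul, zpow_add, map_mul]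
        exact mul_mul_mul_comm _ _ _ _)
    fun x x' ↦ by
      refine MonoidHom.ext fun y ↦ ?_
      simp only [MonoidHom.mk'_apply, MonoidHom.mul_apply, Prod.snd_mul, Prod.fst_mul, map_mul,
        mul_zpow]
      exact mul_mul_mul_comm _ _ _ _

theorem halfFac_apply (x y : Fac R) :
    halfFac k x y = constUnit R x.2.1 ^ y.1.toAdd * resExp k x.2.2 y.2.1 := rfl

theorem halfFac_map (φ : R →ₐ[k] S) (x y : Fac R) :
    halfFac k (facMap (φ : R →+* S) x) (facMap (φ : R →+* S) y) =
      Units.map (φ : R →* S) (halfFac k x y) := by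
  rw [halfFac_apply, halfFac_apply, map_mul, ← resExp_map, map_zpow]
  congr 2

end

/-- The pairing `(-1)^{n n'}`. -/
def signFac (R : Type*) [CommRing R] : Fac R →* Fac R →* Rˣ :=
  MonoidHom.mk' (fun x ↦ MonoidHom.mk' (fun y ↦ (-1) ^ (x.1.toAdd * y.1.toAdd)) fun y y' ↦ by
      simp [mul_add, zpow_add])
    fun x x' ↦ by
      refine MonoidHom.ext fun y ↦ ?_
      simp [add_mul, zpow_add]

theorem signFac_apply (x y : Fac R) : signFac R x y = (-1) ^ (x.1.toAdd * y.1.toAdd) := rfl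

section

variable (k : Type*) [Field k] [CharZero k] [Algebra k R] [Algebra k S]

/-- The Contou-Carrère symbol in terms of factorizations. -/
def symbolFac : Fac R →* Fac R →* Rˣ :=
  signFac R * halfFac k * (halfFac k).flip⁻¹

theorem symbolFac_apply (x y : Fac R) :
    symbolFac k x y = signFac R x y * halfFac k x y * (halfFac k y x)⁻¹ := rfl

theorem symbolFac_map (φ : R →ₐ[k] S) (x y : Fac R) :
    symbolFac k (facMap (φ : R →+* S) x) (facMap (φ : R →+* S) y) =
      Units.map (φ : R →* S) (symbolFac k x y) := by
  have hs : signFac S (facMap (φ : R →+* S) x) (facMap (φ : R →+* S) y) =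
      Units.map (φ : R →* S) (signFac R x y) := by
    rw [signFac_apply, signFac_apply, map_zpow]
    congr 1
    exact Units.ext (by simp)
  rw [symbolFac_apply, symbolFac_apply, map_mul, map_mul, map_inv, halfFac_map, halfFac_map, hs]

end

/-- The element of `Fac R` given by a factorization. -/
def UnitFactorization.toFac {f : (R⸨X⸩)ˣ} (F : UnitFactorization f) : Fac R :=
  (Multiplicative.ofAdd F.ord, Units.map (PowerSeries.C (R := R)).toMonoidHom F.lead * F.plus,
    ⟨(isNilpotent_of_mem_negNil (aeval_mem_negNil F.minus_const F.minus_nil)).isUnit_one_add.unit,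
      by
        change _ - 1 ∈ negNil R
        rw [IsUnit.unit_spec, add_sub_cancel_left]
        exact aeval_mem_negNil F.minus_const F.minus_nil⟩)

theorem UnitFactorization.facVal_toFac {f : (R⸨X⸩)ˣ} (F : UnitFactorization f) :
    facVal R F.toFac = f := by
  refine Units.ext ?_
  rw [F.eq, facVal_apply]
  simp only [toFac, toAdd_ofAdd, Units.val_mul, tUnit_zpow, coe_arcUnit, IsUnit.unit_spec, map_mul]
  rw [Units.coe_map]
  simp only [RingHom.toMonoidHom_eq_coe, MonoidHom.coe_coe]
  rw [HahnSeries.ofPowerSeries_C]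
  ring

/-- A factorization `tⁿ u m` gives one of the form `a tⁿ f₊ f₋`, with `a = u(0)`. -/
theorem exists_unitFactorization {f : (R⸨X⸩)ˣ} (x : Fac R) (h : facVal R x = f) :
    ∃ F : UnitFactorization f, F.toFac = x := by
  obtain ⟨p, h0, hp, hx⟩ := exists_aeval_eq x.2.2.2
  have hlead : Units.map (PowerSeries.C (R := R)).toMonoidHom (constUnit R x.2.1) *
      (Units.map (PowerSeries.C (R := R)).toMonoidHom (constUnit R x.2.1)⁻¹ * x.2.1) = x.2.1 := by
    rw [← mul_assoc, ← map_mul, mul_inv_cancel, map_one, one_mul]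
  let F : UnitFactorization f := {
    ord := x.1.toAdd
    lead := constUnit R x.2.1
    plus := Units.map (PowerSeries.C (R := R)).toMonoidHom (constUnit R x.2.1)⁻¹ * x.2.1
    plus_const := by
      rw [Units.val_mul, map_mul]
      exact (congrArg (· * _) (PowerSeries.constantCoeff_C _)).trans (constUnit R x.2.1).inv_mul
    minus := p
    minus_const := h0
    minus_nil := hp
    eq := by
      have h1 := congrArg Units.val h.symm
      rw [facVal_apply, ← hlead, map_mul] at h1
      rw [h1, hx]
      simp only [Units.val_mul, tUnit_zpow, coe_arcUnit, add_sub_cancel, map_mul]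
      rw [Units.coe_map, Units.coe_map]
      simp only [RingHom.toMonoidHom_eq_coe, MonoidHom.coe_coe, HahnSeries.ofPowerSeries_C]
      ring }
  refine ⟨F, Prod.ext rfl (Prod.ext hlead (Subtype.ext (Units.ext ?_)))⟩
  change 1 + Polynomial.aeval _ p = _
  rw [hx, add_sub_cancel]

theorem factoredSymbol_eq (k : Type u) [Field k] [CharZero k] [Algebra k R] {f g : (R⸨X⸩)ˣ}
    (F : UnitFactorization f) (G : UnitFactorization g) :
    factoredSymbol k F G = symbolFac k F.toFac G.toFac := by
  have hres {f g : (R⸨X⸩)ˣ} (F : UnitFactorization f) (G : UnitFactorization g) :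
      resPair k F.toFac.2.2 G.toFac.2.1 = resLog k F G := by
    rw [resPair, resLog]
    congr 3
    · exact add_sub_cancel_left _ _
    · exact (dlog_mul _ _).trans (by rw [dlog_C, zero_add]; rfl)
  have hconst {f : (R⸨X⸩)ˣ} (F : UnitFactorization f) : constUnit R F.toFac.2.1 = F.lead := by
    refine Units.ext ?_
    change PowerSeries.constantCoeff (PowerSeries.C (F.lead : R) * (F.plus : R⟦X⟧)) = _
    rw [map_mul, F.plus_const, PowerSeries.constantCoeff_C, mul_one]
  rw [symbolFac_apply, signFac_apply, halfFac_apply, halfFac_apply, hconst, hconst, mul_inv,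
    factoredSymbol]
  have h1 : nilExp k (resLog k F G) = (resExp k F.toFac.2.2 G.toFac.2.1 : Rˣ) := by
    rw [coe_resExp, hres]
  have h2 : nilExp k (-resLog k G F) = ((resExp k G.toFac.2.2 F.toFac.2.1)⁻¹ : Rˣ) := by
    rw [← hres]
    rfl
  rw [h1, h2, zpow_neg]
  simp only [UnitFactorization.toFac, toAdd_ofAdd, Units.val_mul]
  ring

end Fac

section Glue

variable {k : Type u} [Field k] [CharZero k]

/-- A natural bimultiplicative function of factorizations extends to a natural pairing of units
of `R((t))`. -/
theorem exists_pairing (Φ : ∀ R : CommAlgCat.{u} k, Fac R →* Fac R →* (R : Type u)ˣ)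
    (hΦ : ∀ {R S : CommAlgCat.{u} k} (φ : R ⟶ S) (x y : Fac R),
      Φ S (facMap (φ.hom : R →+* S) x) (facMap (φ.hom : R →+* S) y) =
        Units.map (φ.hom : R →* S) (Φ R x y)) :
    ∃ h : ∀ R : CommAlgCat.{u} k, ((R : Type u)⸨X⸩)ˣ →* ((R : Type u)⸨X⸩)ˣ →* (R : Type u)ˣ,
      (∀ {R S : CommAlgCat.{u} k} (φ : R ⟶ S) (f g : ((R : Type u)⸨X⸩)ˣ),
        h S (laurentUnits (φ.hom : R →+* S) f) (laurentUnits (φ.hom : R →+* S) g) =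
          Units.map (φ.hom : R →* S) (h R f g)) ∧
      ∀ (R : CommAlgCat.{u} k) (x y : Fac R), h R (facVal R x) (facVal R y) = Φ R x y := by
  -- `Q` describes the local value: `z` is the value of `Φ` at factorizations of `f` and `g`
  let Q (R : CommAlgCat.{u} k) (f g : ((R : Type u)⸨X⸩)ˣ) ⦃S : CommAlgCat.{u} k⦄ (φ : R ⟶ S)
      (z : (S : Type u)ˣ) : Prop := ∃ x y : Fac S, facVal S x = laurentUnits (φ.hom : R →+* S) f ∧
        facVal S y = laurentUnits (φ.hom : R →+* S) g ∧ z = Φ S x y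
  have stable (R : CommAlgCat.{u} k) (f g : ((R : Type u)⸨X⸩)ˣ) ⦃S T : CommAlgCat.{u} k⦄
      (φ : R ⟶ S) (ψ : S ⟶ T) (z : (S : Type u)ˣ) (hz : Q R f g φ z) :
      Q R f g (φ ≫ ψ) (Units.map (ψ.hom : S →* T) z) := by
    obtain ⟨x, y, hx, hy, rfl⟩ := hz
    refine ⟨facMap (ψ.hom : S →+* T) x, facMap (ψ.hom : S →+* T) y, ?_, ?_, (hΦ ψ x y).symm⟩
    · rw [facVal_facMap, hx]; rfl
    · rw [facVal_facMap, hy]; rfl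
  have unique (R : CommAlgCat.{u} k) (f g : ((R : Type u)⸨X⸩)ˣ) ⦃S : CommAlgCat.{u} k⦄ (φ : R ⟶ S)
      (z z' : (S : Type u)ˣ) (hz : Q R f g φ z) (hz' : Q R f g φ z') : z = z' := by
    rcases subsingleton_or_nontrivial S with hS | hS
    · exact Subsingleton.elim _ _
    obtain ⟨x, y, hx, hy, rfl⟩ := hz
    obtain ⟨x', y', hx', hy', rfl⟩ := hz'
    rw [facVal_injective (hx.trans hx'.symm), facVal_injective (hy.trans hy'.symm)]
  have hloc (R : CommAlgCat.{u} k) (f g : ((R : Type u)⸨X⸩)ˣ) :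
      Locally R fun _ φ ↦ ∃ z, Q R f g φ z := by
    have st (f : ((R : Type u)⸨X⸩)ˣ) : Stable R fun S φ ↦
        ∃ x : Fac S, facVal S x = laurentUnits (φ.hom : R →+* S) f := by
      rintro S T φ ψ ⟨x, hx⟩
      exact ⟨facMap (ψ.hom : S →+* T) x, by rw [facVal_facMap, hx]; rfl⟩
    exact ((locally_exists_fac f).and (st f) (locally_exists_fac g) (st g)).mono
      fun S φ ⟨⟨x, hx⟩, ⟨y, hy⟩⟩ ↦ ⟨_, x, y, hx, hy, rfl⟩
  have ex (R : CommAlgCat.{u} k) (f g : ((R : Type u)⸨X⸩)ˣ) : ∃ z : (R : Type u)ˣ,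
      ∀ ⦃S : CommAlgCat.{u} k⦄ (φ : R ⟶ S) (x : (S : Type u)ˣ), Q R f g φ x →
        Units.map (φ.hom : R →* S) z = x :=
    ((unitsSheaf k).exists_of_local R (Q R f g) (stable R f g) (unique R f g) (hloc R f g)).imp
      fun _ h ↦ h.1
  choose h hQ using ex
  have hval (R : CommAlgCat.{u} k) (x y : Fac R) : h R (facVal R x) (facVal R y) = Φ R x y :=
    hQ R _ _ (𝟙 R) _ ⟨x, y, rfl, rfl, rfl⟩
  have hnat {R S : CommAlgCat.{u} k} (φ : R ⟶ S) (f g : ((R : Type u)⸨X⸩)ˣ) :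
      h S (laurentUnits (φ.hom : R →+* S) f) (laurentUnits (φ.hom : R →+* S) g) =
        Units.map (φ.hom : R →* S) (h R f g) := by
    refine (unitsSheaf k).sep S _ _ ((hloc S (laurentUnits (φ.hom : R →+* S) f)
      (laurentUnits (φ.hom : R →+* S) g)).mono fun T ψ hz ↦ ?_)
    obtain ⟨z, hz⟩ := hz
    have h1 := hQ S _ _ ψ z hz
    have h2 := hQ R f g (φ ≫ ψ) z hz
    exact h1.trans h2.symm
  have hbi (R : CommAlgCat.{u} k) (f g f' g' : ((R : Type u)⸨X⸩)ˣ) :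
      h R (f * f') g = h R f g * h R f' g ∧ h R f (g * g') = h R f g * h R f g' := by
    have key : Locally R fun S φ ↦
        Units.map (φ.hom : R →* S) (h R (f * f') g) =
            Units.map (φ.hom : R →* S) (h R f g * h R f' g) ∧
          Units.map (φ.hom : R →* S) (h R f (g * g')) =
            Units.map (φ.hom : R →* S) (h R f g * h R f g') := by
      have st (f g : ((R : Type u)⸨X⸩)ˣ) : Stable R fun _ φ ↦ ∃ z, Q R f g φ z :=
        fun S T φ ψ ⟨z, hz⟩ ↦ ⟨_, stable R f g φ ψ z hz⟩
      refine ((hloc R f g).and (st f g) (hloc R f' g') (st f' g')).mono ?_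
      rintro S φ ⟨⟨_, x, y, hx, hy, -⟩, ⟨_, x', y', hx', hy', -⟩⟩
      simp only [map_mul, ← hnat, ← hx, ← hx', ← hy, ← hy']
      simp only [hval, ← map_mul]
      simp
    exact ⟨(unitsSheaf k).sep R _ _ (key.mono fun S φ h ↦ h.1),
      (unitsSheaf k).sep R _ _ (key.mono fun S φ h ↦ h.2)⟩
  exact ⟨fun R ↦ MonoidHom.mk' (fun f ↦ MonoidHom.mk' (fun g ↦ h R f g)
    fun g g' ↦ (hbi R f g f g').2) fun f f' ↦ MonoidHom.ext fun g ↦ (hbi R f g f' g).1,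
    hnat, hval⟩

/-- The pairing of units of `R((t))` given by one half of the Contou-Carrère symbol. -/
def halfSymbol (R : CommAlgCat.{u} k) :
    ((R : Type u)⸨X⸩)ˣ →* ((R : Type u)⸨X⸩)ˣ →* (R : Type u)ˣ :=
  (exists_pairing (fun _ : CommAlgCat.{u} k ↦ halfFac k) fun φ ↦ halfFac_map k φ.hom).choose R

theorem halfSymbol_map {R S : CommAlgCat.{u} k} (φ : R ⟶ S) (f g : ((R : Type u)⸨X⸩)ˣ) :
    halfSymbol S (laurentUnits (φ.hom : R →+* S) f) (laurentUnits (φ.hom : R →+* S) g) =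
      Units.map (φ.hom : R →* S) (halfSymbol R f g) :=
  (exists_pairing (fun _ : CommAlgCat.{u} k ↦ halfFac k)
    fun φ ↦ halfFac_map k φ.hom).choose_spec.1 φ f g

theorem halfSymbol_facVal {R : CommAlgCat.{u} k} (x y : Fac R) :
    halfSymbol R (facVal R x) (facVal R y) = halfFac k x y :=
  (exists_pairing (fun _ : CommAlgCat.{u} k ↦ halfFac k)
    fun φ ↦ halfFac_map k φ.hom).choose_spec.2 R x y

/-- The Contou-Carrère symbol, as a pairing. -/
def symbol (R : CommAlgCat.{u} k) :
    ((R : Type u)⸨X⸩)ˣ →* ((R : Type u)⸨X⸩)ˣ →* (R : Type u)ˣ :=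
  (exists_pairing (fun _ : CommAlgCat.{u} k ↦ symbolFac k) fun φ ↦ symbolFac_map k φ.hom).choose R

theorem symbol_map {R S : CommAlgCat.{u} k} (φ : R ⟶ S) (f g : ((R : Type u)⸨X⸩)ˣ) :
    symbol S (laurentUnits (φ.hom : R →+* S) f) (laurentUnits (φ.hom : R →+* S) g) =
      Units.map (φ.hom : R →* S) (symbol R f g) :=
  (exists_pairing (fun _ : CommAlgCat.{u} k ↦ symbolFac k)
    fun φ ↦ symbolFac_map k φ.hom).choose_spec.1 φ f g

theorem symbol_facVal {R : CommAlgCat.{u} k} (x y : Fac R) :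
    symbol R (facVal R x) (facVal R y) = symbolFac k x y :=
  (exists_pairing (fun _ : CommAlgCat.{u} k ↦ symbolFac k)
    fun φ ↦ symbolFac_map k φ.hom).choose_spec.2 R x y

/-- The symbol is characterized by its values on pairs of units that factor, since these determine
it locally. -/
theorem contouCarrere_eq_symbol {R : CommAlgCat.{u} k} (f g : ((R : Type u)⸨X⸩)ˣ) :
    contouCarrere k f g = symbol R f g := by
  have h1 : IsContouCarrere k f g (symbol R f g) := by
    intro S _ _ φ F G
    have h2 := symbol_map (CommAlgCat.ofHom φ : R ⟶ CommAlgCat.of k S) f g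
    have h3 := symbol_facVal (R := CommAlgCat.of k S) F.toFac G.toFac
    rw [F.facVal_toFac, G.facVal_toFac] at h3
    rw [factoredSymbol_eq, ← h3]
    exact (congrArg Units.val h2).symm
  have h2 : IsContouCarrere k f g (contouCarrere k f g) := Classical.epsilon_spec ⟨_, h1⟩
  refine (unitsSheaf k).sep R _ _
    (((locally_exists_fac f).and ?_ (locally_exists_fac g) ?_).mono ?_)
  · rintro S T φ ψ ⟨x, hx⟩
    exact ⟨facMap (ψ.hom : S →+* T) x, by rw [facVal_facMap, hx]; rfl⟩
  · rintro S T φ ψ ⟨x, hx⟩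
    exact ⟨facMap (ψ.hom : S →+* T) x, by rw [facVal_facMap, hx]; rfl⟩
  · rintro S φ ⟨⟨x, hx⟩, y, hy⟩
    obtain ⟨F, -⟩ := exists_unitFactorization x hx
    obtain ⟨G, -⟩ := exists_unitFactorization y hy
    exact Units.ext ((h2 S φ.hom F G).trans (h1 S φ.hom F G).symm)

end Glue

/-! ### Points of the loop group -/

section LoopVal

variable {Γ : Type v} [AddCommGroup Γ] {R S : Type u} [CommRing R] [CommRing S]

theorem loopVal_mul (p : PrimeSpectrum R) (a a' : Loop Γ R) :
    loopVal p (a * a') = loopVal p a + loopVal p a' := by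
  simp only [loopVal, toAdd_mul, map_add]

@[simp] theorem loopVal_one (p : PrimeSpectrum R) : loopVal p (1 : Loop Γ R) = 0 := by
  simp [loopVal]

@[simp] theorem loopVal_expPt (p : PrimeSpectrum R) (f : (R⸨X⸩)ˣ) (γ : Γ) :
    loopVal p (expPt f γ) = ordAt p (Additive.ofMul f) • γ := rfl

theorem loopVal_inv (p : PrimeSpectrum R) (a : Loop Γ R) : loopVal p a⁻¹ = -loopVal p a := by
  rw [eq_neg_iff_add_eq_zero, ← loopVal_mul, inv_mul_cancel, loopVal_one]

theorem loopVal_torusMap_eq_zero {M : Type*} [CommGroup M] (f : M →* (R⸨X⸩)ˣ)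
    (p : PrimeSpectrum R) (hf : ∀ m, ordAt p (Additive.ofMul (f m)) = 0) (x : TorusPts Γ M) :
    loopVal p (torusMap Γ f x) = 0 := by
  induction x using torus_induction with
  | one => simp
  | exp m γ => simp [hf]
  | mul x y hx hy => rw [map_mul, loopVal_mul, hx, hy, add_zero]

theorem loopMap_comp {T : Type u} [CommRing T] (φ : R →+* S) (ψ : S →+* T) (a : Loop Γ R) :
    loopMap Γ (ψ.comp φ) a = loopMap Γ ψ (loopMap Γ φ a) := by
  rw [loopMap, loopMap, loopMap, ← torusMap_comp]
  rfl

theorem loopMap_id (a : Loop Γ R) : loopMap Γ (RingHom.id R) a = a :=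
  torusMap_id a

theorem loopVal_loopMap (φ : R →+* S) (p : PrimeSpectrum S) (a : Loop Γ R) :
    loopVal p (loopMap Γ φ a) = loopVal (PrimeSpectrum.comap φ p) a := by
  induction a using torus_induction with
  | one => simp
  | exp f γ => exact congrArg (· • γ) (ordAt_comap φ p f)
  | mul x y hx hy => rw [map_mul, loopVal_mul, loopVal_mul, hx, hy]

@[simp] theorem loopVal_arcToLoop (p : PrimeSpectrum R) (b : Arc Γ R) :
    loopVal p (arcToLoop Γ R b) = 0 :=
  loopVal_torusMap_eq_zero _ p (ordAt_arcUnit p) b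

variable (Γ R) in
/-- The inclusion of `Γ ⊗ Minus R` into the loop group. -/
def minusToLoop : TorusPts Γ (Minus R) →* Loop Γ R := torusMap Γ (Minus R).subtype

@[simp] theorem loopVal_minusToLoop (p : PrimeSpectrum R) (x : TorusPts Γ (Minus R)) :
    loopVal p (minusToLoop Γ R x) = 0 :=
  loopVal_torusMap_eq_zero _ p (ordAt_minus p) x

@[simp] theorem loopMap_tUnit (φ : R →+* S) (γ : Γ) :
    loopMap Γ φ (expPt (tUnit R) γ) = expPt (tUnit S) γ :=
  congrArg (expPt · γ) (laurentUnits_tUnit φ)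

@[simp] theorem loopMap_arcToLoop (φ : R →+* S) (b : Arc Γ R) :
    loopMap Γ φ (arcToLoop Γ R b) = arcToLoop Γ S (arcMap Γ φ b) := by
  rw [loopMap, arcToLoop, arcToLoop, arcMap, ← torusMap_comp, ← torusMap_comp]
  congr 2
  exact MonoidHom.ext fun u ↦ laurentUnits_arcUnit φ u

@[simp] theorem loopMap_minusToLoop (φ : R →+* S) (x : TorusPts Γ (Minus R)) :
    loopMap Γ φ (minusToLoop Γ R x) = minusToLoop Γ S (torusMap Γ (minusMap φ) x) := by
  rw [loopMap, minusToLoop, minusToLoop, ← torusMap_comp, ← torusMap_comp]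
  rfl

theorem arcToLoop_injective [Module.Free ℤ Γ] [Module.Finite ℤ Γ] :
    Function.Injective (arcToLoop Γ R) :=
  torusMap_injective fun _ _ h ↦
    Units.ext (HahnSeries.ofPowerSeries_injective (congrArg Units.val h))

variable (Γ R) in
/-- The homomorphism `γ ↦ t^{-γ}`. -/
def tPow : Multiplicative Γ →* Loop Γ R :=
  MonoidHom.mk' (fun γ ↦ expPt (tUnit R) (-γ.toAdd)) fun γ γ' ↦ by
    rw [← expPt_add, toAdd_mul, neg_add]

variable (Γ R) in
/-- The group of factorizations `t^{-γ} b x`, with `b` in the arc group and `x ∈ Γ ⊗ Minus R`, of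
points of the loop group. -/
abbrev LoopFac := Multiplicative Γ × Arc Γ R × TorusPts Γ (Minus R)

variable (Γ R) in
/-- The point of the loop group that is factored. -/
def loopFacVal : LoopFac Γ R →* Loop Γ R :=
  (tPow Γ R).coprod ((arcToLoop Γ R).coprod (minusToLoop Γ R))

theorem loopFacVal_apply (x : LoopFac Γ R) : loopFacVal Γ R x =
    expPt (tUnit R) (-x.1.toAdd) * (arcToLoop Γ R x.2.1 * minusToLoop Γ R x.2.2) := rfl

variable (Γ) in
/-- Base change of factorizations. -/
def loopFacMap (φ : R →+* S) : LoopFac Γ R →* LoopFac Γ S :=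
  (MonoidHom.id _).prodMap ((arcMap Γ φ).prodMap (torusMap Γ (minusMap φ)))

theorem loopFacVal_map (φ : R →+* S) (x : LoopFac Γ R) :
    loopFacVal Γ S (loopFacMap Γ φ x) = loopMap Γ φ (loopFacVal Γ R x) := by
  rw [loopFacVal_apply, loopFacVal_apply, map_mul, map_mul, loopMap_tUnit, loopMap_arcToLoop,
    loopMap_minusToLoop]
  rfl

theorem loopVal_loopFacVal (p : PrimeSpectrum R) (x : LoopFac Γ R) :
    loopVal p (loopFacVal Γ R x) = -x.1.toAdd := by
  rw [loopFacVal_apply, loopVal_mul, loopVal_mul, loopVal_expPt, ordAt_tUnit]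
  simp

theorem loopFacVal_injective [Module.Free ℤ Γ] [Module.Finite ℤ Γ] [Nontrivial R] :
    Function.Injective (loopFacVal Γ R) := fun x y h ↦ by
  obtain ⟨p⟩ : Nonempty (PrimeSpectrum R) := inferInstance
  have hn : x.1 = y.1 := by
    have h1 := congrArg (loopVal p) h
    rw [loopVal_loopFacVal, loopVal_loopFacVal] at h1
    exact neg_injective (G := Γ) h1
  rw [loopFacVal_apply, loopFacVal_apply, hn, mul_right_inj] at h
  obtain ⟨h1, h2⟩ := torusMap_mul_inj Γ (f := arcUnit R) (g := (Minus R).subtype)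
    (fun u m u' m' h ↦ arcUnit_mul_minus_inj h) h
  exact Prod.ext hn (Prod.ext h1 h2)

end LoopVal

section LoopSheaf

variable {k : Type u} [Field k] {Γ : Type v} [AddCommGroup Γ]

theorem stable_exists_loopFac {R : CommAlgCat.{u} k} (a : Loop Γ R) :
    Stable R fun S φ ↦ ∃ x : LoopFac Γ S, loopFacVal Γ S x = loopMap Γ (φ.hom : R →+* S) a := by
  rintro S T φ ψ ⟨x, hx⟩
  refine ⟨loopFacMap Γ (ψ.hom : S →+* T) x, ?_⟩
  rw [loopFacVal_map, hx, loopMap, loopMap, ← torusMap_comp]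
  rfl

theorem locally_exists_loopFac [CharZero k] {R : CommAlgCat.{u} k} (a : Loop Γ R) :
    Locally R fun S φ ↦ ∃ x : LoopFac Γ S, loopFacVal Γ S x = loopMap Γ (φ.hom : R →+* S) a := by
  induction a using torus_induction with
  | one => exact fun p ↦ ⟨1, p.2.one_notMem, 1, by rw [map_one, map_one]⟩
  | exp f γ =>
    refine (locally_exists_fac f).mono fun S φ ⟨x, hx⟩ ↦
      ⟨(Multiplicative.ofAdd (-(x.1.toAdd • γ)), expPt x.2.1 γ, expPt x.2.2 γ), ?_⟩
    rw [loopFacVal_apply, toAdd_ofAdd, neg_neg, expPt_zsmul]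
    change expPt _ γ * (expPt (arcUnit S x.2.1) γ * expPt (x.2.2 : ((S : Type u)⸨X⸩)ˣ) γ) =
      expPt (laurentUnits _ f) γ
    rw [← expPt_mul, ← expPt_mul, ← hx, facVal_apply]
  | mul a a' h h' =>
    refine (h.and (stable_exists_loopFac a) h' (stable_exists_loopFac a')).mono ?_
    rintro S φ ⟨⟨x, hx⟩, y, hy⟩
    exact ⟨x * y, by rw [map_mul, map_mul, hx, hy]⟩

theorem loopMap_comp_hom {R S T : CommAlgCat.{u} k} (φ : R ⟶ S) (ψ : S ⟶ T) (a : Loop Γ R) :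
    loopMap Γ ((φ ≫ ψ).hom : R →+* T) a =
      loopMap Γ (ψ.hom : S →+* T) (loopMap Γ (φ.hom : R →+* S) a) := by
  have e : ((φ ≫ ψ).hom : R →+* T) = (ψ.hom : S →+* T).comp (φ.hom : R →+* S) := rfl
  rw [e, loopMap_comp]

variable (k Γ) in
/-- The loop group, as a sheaf. -/
def loopSheaf [Module.Free ℤ Γ] [Module.Finite ℤ Γ] : ZSheaf.{u, max u v} k where
  obj R := Loop Γ R
  nonempty R := ⟨1⟩
  map {R S} φ := loopMap Γ (φ.hom : R →+* S)
  map_comp φ ψ x := loopMap_comp_hom φ ψ x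
  sep R x y h := by
    let b := Module.Free.chooseBasis ℤ Γ
    refine torusCoord_ext b fun i ↦ (laurentSheaf k).sep R _ _ (h.mono fun S φ h ↦ ?_)
    have h1 := congrArg (torusCoord b _ i) h
    rwa [loopMap, torusCoord_torusMap, torusCoord_torusMap] at h1
  glue R s hs h compat := by
    classical
    let b := Module.Free.chooseBasis ℤ Γ
    have hc (i) : ∃ f : ((R : Type u)⸨X⸩)ˣ, ∀ r ∈ s, laurentUnits
        ((awayHom R r).hom : R →+* Localization.Away r) f =
          torusCoord b ((Localization.Away r)⸨X⸩)ˣ i (h r) :=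
      (laurentSheaf k).glue R s hs (fun r ↦ torusCoord b ((Localization.Away r)⸨X⸩)ˣ i (h r))
        fun r hr r' hr' S φ ψ e ↦ by
          have h1 := congrArg (torusCoord b _ i) (compat r hr r' hr' S φ ψ e)
          rw [loopMap, loopMap, torusCoord_torusMap, torusCoord_torusMap] at h1
          exact h1
    choose f hf using hc
    refine ⟨∏ i, expPt (M := ((R : Type u)⸨X⸩)ˣ) (f i) (b i),
      fun r hr ↦ torusCoord_ext b fun i ↦ ?_⟩
    rw [loopMap, torusCoord_torusMap, torusCoord_prod]
    exact hf i r hr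

section

variable {R : CommAlgCat.{u} k}

theorem facVal_t (n : ℤ) : facVal R (Multiplicative.ofAdd n, 1, 1) = tUnit R ^ n := by
  simp [facVal_apply]

theorem facVal_zpowersHom (n : Multiplicative ℤ) :
    facVal R (n, 1, 1) = zpowersHom _ (tUnit R) n := by
  simp [facVal_apply]

theorem facVal_arc (u : ((R : Type u)⟦X⟧)ˣ) : facVal R (1, u, 1) = arcUnit R u := by
  simp [facVal_apply]

theorem facVal_minus (m : Minus R) : facVal R (1, 1, m) = m := by
  simp [facVal_apply]

end

/-! ### The pairings on the loop group -/

variable (c : LinearMap.BilinForm ℤ Γ)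

theorem torusPairing_map {R S : CommAlgCat.{u} k} (φ : R ⟶ S)
    (h : ((R : Type u)⸨X⸩)ˣ →* ((R : Type u)⸨X⸩)ˣ →* (R : Type u)ˣ)
    (h' : ((S : Type u)⸨X⸩)ˣ →* ((S : Type u)⸨X⸩)ˣ →* (S : Type u)ˣ)
    (H : ∀ f g, h' (laurentUnits (φ.hom : R →+* S) f) (laurentUnits (φ.hom : R →+* S) g) =
      Units.map (φ.hom : R →* S) (h f g)) (a a' : Loop Γ R) :
    torusPairing c h' (loopMap Γ (φ.hom : R →+* S) a) (loopMap Γ (φ.hom : R →+* S) a') =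
      Units.map (φ.hom : R →* S) (torusPairing c h a a') := by
  have : ((torusPairing c h').comp (loopMap Γ (φ.hom : R →+* S))).compl₂
      (loopMap Γ (φ.hom : R →+* S)) = (torusPairing c h).compr₂ (Units.map (φ.hom : R →* S)) :=
    torusPairing_ext fun f γ g γ' ↦ by
      change h' (laurentUnits (φ.hom : R →+* S) f) (laurentUnits (φ.hom : R →+* S) g) ^ c γ γ' =
        Units.map (φ.hom : R →* S) (h f g ^ c γ γ')
      rw [map_zpow, H]
  exact DFunLike.congr_fun (DFunLike.congr_fun this a) a'

variable [CharZero k]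

/-- One half of the Contou-Carrère symbol on the loop group, for the form `c`. -/
def halfLoop (R : CommAlgCat.{u} k) : Loop Γ R →* Loop Γ R →* (R : Type u)ˣ :=
  torusPairing c (halfSymbol R)

/-- The Contou-Carrère symbol on the loop group, for the form `c`. -/
def symLoop (R : CommAlgCat.{u} k) : Loop Γ R →* Loop Γ R →* (R : Type u)ˣ :=
  torusPairing c (symbol R)

theorem halfLoop_map {R S : CommAlgCat.{u} k} (φ : R ⟶ S) (a a' : Loop Γ R) :
    halfLoop c S (loopMap Γ (φ.hom : R →+* S) a) (loopMap Γ (φ.hom : R →+* S) a') =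
      Units.map (φ.hom : R →* S) (halfLoop c R a a') :=
  torusPairing_map c φ _ _ (halfSymbol_map φ) a a'

theorem symLoop_map {R S : CommAlgCat.{u} k} (φ : R ⟶ S) (a a' : Loop Γ R) :
    symLoop c S (loopMap Γ (φ.hom : R →+* S) a) (loopMap Γ (φ.hom : R →+* S) a') =
      Units.map (φ.hom : R →* S) (symLoop c R a a') :=
  torusPairing_map c φ _ _ (symbol_map φ) a a'

section Values

variable {R : CommAlgCat.{u} k}

theorem halfFac_arc_t (u : ((R : Type u)⟦X⟧)ˣ) (n : ℤ) :
    halfFac k (1, u, 1) (Multiplicative.ofAdd n, 1, 1) = constUnit R u ^ n := by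
  simp [halfFac_apply]

theorem halfSymbol_eq_one {x y : Fac R} (h : halfFac k x y = 1) :
    halfSymbol R (facVal R x) (facVal R y) = 1 := by
  rw [halfSymbol_facVal, h]

/-- The value of the half symbol at a pair of factored points of the loop group: of the nine pairs
of factors, only two contribute. -/
theorem halfLoop_loopFacVal (x y : LoopFac Γ R) :
    halfLoop c R (loopFacVal Γ R x) (loopFacVal Γ R y) =
      halfLoop c R (arcToLoop Γ R x.2.1) (expPt (tUnit R) (-y.1.toAdd)) *
        halfLoop c R (minusToLoop Γ R x.2.2) (arcToLoop Γ R y.2.1) := by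
  have tt (γ : Γ) : expPt (tUnit R) γ = torusMap Γ (zpowersHom _ (tUnit R))
      (expPt (Multiplicative.ofAdd 1) γ) := by simp
  have h1 (γ γ' : Γ) : halfLoop c R (expPt (tUnit R) γ) (expPt (tUnit R) γ') = 1 := by
    rw [halfLoop, torusPairing_expPt]
    have := halfSymbol_eq_one (R := R) (x := (Multiplicative.ofAdd 1, 1, 1))
      (y := (Multiplicative.ofAdd 1, 1, 1)) (by simp [halfFac_apply])
    rw [facVal_t, zpow_one] at this
    rw [this, one_zpow]
  have h2 (γ : Γ) (b : Arc Γ R) : halfLoop c R (expPt (tUnit R) γ) (arcToLoop Γ R b) = 1 := by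
    rw [tt]
    refine torusPairing_eq_one _ (arcUnit R) (fun n u ↦ ?_) _ _
    have := halfSymbol_eq_one (R := R) (x := (n, 1, 1)) (y := (1, u, 1)) (by simp [halfFac_apply])
    rwa [facVal_arc, facVal_zpowersHom] at this
  have h3 (γ : Γ) (b) : halfLoop c R (expPt (tUnit R) γ) (minusToLoop Γ R b) = 1 := by
    rw [tt]
    refine torusPairing_eq_one _ (Minus R).subtype (fun n u ↦ ?_) _ _
    have := halfSymbol_eq_one (R := R) (x := (n, 1, 1)) (y := (1, 1, u)) (by simp [halfFac_apply])
    rwa [facVal_minus, facVal_zpowersHom] at this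
  have h4 (b b' : Arc Γ R) : halfLoop c R (arcToLoop Γ R b) (arcToLoop Γ R b') = 1 := by
    refine torusPairing_eq_one (arcUnit R) (arcUnit R) (fun u u' ↦ ?_) _ _
    have := halfSymbol_eq_one (R := R) (x := (1, u, 1)) (y := (1, u', 1)) (by simp [halfFac_apply])
    rwa [facVal_arc, facVal_arc] at this
  have h5 (b : Arc Γ R) (b') : halfLoop c R (arcToLoop Γ R b) (minusToLoop Γ R b') = 1 := by
    refine torusPairing_eq_one (arcUnit R) (Minus R).subtype (fun u u' ↦ ?_) _ _
    have := halfSymbol_eq_one (R := R) (x := (1, u, 1)) (y := (1, 1, u')) (by simp [halfFac_apply])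
    rwa [facVal_arc, facVal_minus] at this
  have h6 (b) (γ : Γ) : halfLoop c R (minusToLoop Γ R b) (expPt (tUnit R) γ) = 1 := by
    rw [tt]
    refine torusPairing_eq_one (Minus R).subtype _ (fun u n ↦ ?_) _ _
    have := halfSymbol_eq_one (R := R) (x := (1, 1, u)) (y := (n, 1, 1)) (by simp [halfFac_apply])
    rwa [facVal_minus, facVal_zpowersHom] at this
  have h7 (b b') : halfLoop c R (minusToLoop Γ R b) (minusToLoop Γ R b') = 1 := by
    refine torusPairing_eq_one (Minus R).subtype (Minus R).subtype (fun u u' ↦ ?_) _ _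
    have := halfSymbol_eq_one (R := R) (x := (1, 1, u)) (y := (1, 1, u')) (by simp [halfFac_apply])
    rwa [facVal_minus, facVal_minus] at this
  simp only [loopFacVal_apply, map_mul, MonoidHom.mul_apply, h1, h2, h3, h4, h5, h6, h7, mul_one,
    one_mul]

theorem symbol_arc_t (u : ((R : Type u)⟦X⟧)ˣ) (n : ℤ) :
    symbol R (arcUnit R u) (tUnit R ^ n) = constUnit R u ^ n := by
  rw [← facVal_arc, ← facVal_t, symbol_facVal, symbolFac_apply, signFac_apply, halfFac_arc_t]
  simp [halfFac_apply]

theorem symbol_t_t : symbol R (tUnit R) (tUnit R) = -1 := by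
  have h := facVal_t (R := R) 1
  rw [zpow_one] at h
  rw [← h, symbol_facVal, symbolFac_apply, signFac_apply]
  simp [halfFac_apply]

theorem symLoop_t_t (γ γ' : Γ) :
    symLoop c R (expPt (tUnit R) γ) (expPt (tUnit R) γ') = (-1) ^ c γ γ' := by
  rw [symLoop, torusPairing_expPt, symbol_t_t]

theorem symLoop_arc_t (b : Arc Γ R) (γ : Γ) :
    symLoop c R (arcToLoop Γ R b) (expPt (tUnit R) γ) =
      halfLoop c R (arcToLoop Γ R b) (expPt (tUnit R) γ) := by
  induction b using torus_induction with
  | one => simp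
  | exp u γ' =>
    change symbol R (arcUnit R u) (tUnit R) ^ c γ' γ = halfSymbol R (arcUnit R u) (tUnit R) ^ c γ' γ
    have h1 := symbol_arc_t (R := R) u 1
    have h2 : halfSymbol R (arcUnit R u) (tUnit R ^ (1 : ℤ)) = constUnit R u ^ (1 : ℤ) := by
      rw [← facVal_arc, ← facVal_t, halfSymbol_facVal, halfFac_arc_t]
    rw [← h2, zpow_one] at h1
    rw [h1]
  | mul x y hx hy => simp only [map_mul, MonoidHom.mul_apply, hx, hy]

theorem symLoop_minus_t (x : TorusPts Γ (Minus R)) (γ : Γ) :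
    symLoop c R (minusToLoop Γ R x) (expPt (tUnit R) γ) = 1 := by
  have tt : expPt (tUnit R) γ = torusMap Γ (zpowersHom _ (tUnit R))
      (expPt (Multiplicative.ofAdd 1) γ) := by simp
  rw [tt]
  refine torusPairing_eq_one (Minus R).subtype _ (fun u n ↦ ?_) _ _
  have : symbol R (facVal R (1, 1, u)) (facVal R (n, 1, 1)) = 1 := by
    rw [symbol_facVal, symbolFac_apply, signFac_apply]
    simp [halfFac_apply]
  rwa [facVal_minus, facVal_zpowersHom] at this

theorem symLoop_minus_minus (x y : TorusPts Γ (Minus R)) :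
    symLoop c R (minusToLoop Γ R x) (minusToLoop Γ R y) = 1 := by
  refine torusPairing_eq_one (Minus R).subtype (Minus R).subtype (fun u u' ↦ ?_) _ _
  have : symbol R (facVal R (1, 1, u)) (facVal R (1, 1, u')) = 1 := by
    rw [symbol_facVal, symbolFac_apply, signFac_apply]
    simp [halfFac_apply]
  rwa [facVal_minus, facVal_minus] at this

theorem symLoop_minus_arc (x : TorusPts Γ (Minus R)) (b : Arc Γ R) :
    symLoop c R (minusToLoop Γ R x) (arcToLoop Γ R b) =
      halfLoop c R (minusToLoop Γ R x) (arcToLoop Γ R b) := by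
  have h : ((symLoop c R).comp (minusToLoop Γ R)).compl₂ (arcToLoop Γ R) =
      ((halfLoop c R).comp (minusToLoop Γ R)).compl₂ (arcToLoop Γ R) := by
    refine torusPairing_ext fun m γ u γ' ↦ ?_
    change symbol R m (arcUnit R u) ^ c γ γ' = halfSymbol R m (arcUnit R u) ^ c γ γ'
    rw [← facVal_arc, ← facVal_minus m, symbol_facVal, halfSymbol_facVal, symbolFac_apply,
      signFac_apply]
    congr 1
    simp [halfFac_apply]
  exact DFunLike.congr_fun (DFunLike.congr_fun h x) b

/-- The symbol is the antisymmetrization of the half symbol, up to a sign. -/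
theorem symbol_eq_half {f g : ((R : Type u)⸨X⸩)ˣ} {x y : Fac R} (hx : facVal R x = f)
    (hy : facVal R y = g) : symbol R f g =
      (-1) ^ (x.1.toAdd * y.1.toAdd) * halfSymbol R f g * (halfSymbol R g f)⁻¹ := by
  rw [← hx, ← hy, symbol_facVal, symbolFac_apply, halfSymbol_facVal, halfSymbol_facVal,
    signFac_apply]

end Values

end LoopSheaf

/-! ### Signs -/

section Sign

variable {R S : Type*} [CommRing R] [CommRing S]

/-- The sign is `1 - 2 e`, for the idempotent `e` of the set where `s` is `1`. -/
theorem exists_signUnit_eq (s : LocallyConstant (PrimeSpectrum R) (ZMod 2)) :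
    ∃ e : R, e * e = e ∧ (∀ p, s p = 1 ↔ e ∉ p.asIdeal) ∧ (signUnit s : R) = 1 - 2 * e := by
  let K : TopologicalSpace.Clopens (PrimeSpectrum R) :=
    ⟨s ⁻¹' {1}, s.isLocallyConstant.isClopen_fiber 1⟩
  let e := PrimeSpectrum.isIdempotentElemEquivClopens.symm K
  have h := PrimeSpectrum.basicOpen_isIdempotentElemEquivClopens_symm K
  refine ⟨e, e.2, fun p ↦ ?_, rfl⟩
  have h1 : p ∈ PrimeSpectrum.basicOpen (e : R) ↔ p ∈ K.toOpens := by rw [h]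
  exact h1.symm

theorem idempotent_eq {e e' : R} (he : e * e = e) (he' : e' * e' = e')
    (h : ∀ p : PrimeSpectrum R, e ∉ p.asIdeal ↔ e' ∉ p.asIdeal) : e = e' := by
  have := PrimeSpectrum.isIdempotentElemEquivClopens.injective
    (a₁ := (⟨e, he⟩ : {e : R // IsIdempotentElem e})) (a₂ := ⟨e', he'⟩)
    (SetLike.coe_injective (Set.ext fun p ↦ h p))
  exact congrArg Subtype.val this

theorem signUnit_eq {s : LocallyConstant (PrimeSpectrum R) (ZMod 2)} {e : R} (he : e * e = e)
    (h : ∀ p, s p = 1 ↔ e ∉ p.asIdeal) : (signUnit s : R) = 1 - 2 * e := by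
  obtain ⟨e', he', h', hs⟩ := exists_signUnit_eq s
  rw [hs, idempotent_eq he' he fun p ↦ (h' p).symm.trans (h p)]

theorem signUnit_zero {s : LocallyConstant (PrimeSpectrum R) (ZMod 2)} (h : ∀ p, s p = 0) :
    signUnit s = 1 :=
  Units.ext (by rw [signUnit_eq (e := 0) (by simp) (by simp [h])]; simp)

theorem signUnit_one {s : LocallyConstant (PrimeSpectrum R) (ZMod 2)} (h : ∀ p, s p = 1) :
    signUnit s = -1 := by
  refine Units.ext ?_
  rw [signUnit_eq (e := 1) (by simp) fun p ↦ by simpa [h] using p.2.one_notMem]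
  norm_num

/-- The idempotents of two open and closed subsets and of their symmetric difference are related
by `e'' = e + e' - 2 e e'`. -/
theorem signUnit_add (s s' : LocallyConstant (PrimeSpectrum R) (ZMod 2)) :
    signUnit (s + s') = signUnit s * signUnit s' := by
  obtain ⟨e, he, h, hs⟩ := exists_signUnit_eq s
  obtain ⟨e', he', h', hs'⟩ := exists_signUnit_eq s'
  refine Units.ext ?_
  rw [Units.val_mul, hs, hs', signUnit_eq (e := e + e' - 2 * (e * e'))]
  · ring
  · linear_combination (1 - 4 * e' + 4 * e' * e') * he + (1 - 4 * e + 4 * e) * he'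
  · intro p
    have hp := p.2
    have key (e : R) (he : e * e = e) : e ∈ p.asIdeal ∨ 1 - e ∈ p.asIdeal :=
      hp.mem_or_mem (by rw [mul_sub, mul_one, he, sub_self]; exact zero_mem _)
    have z2 : ∀ x y : ZMod 2, x + y = 1 ↔ ((x = 1 ∧ ¬ y = 1) ∨ (¬ x = 1 ∧ y = 1)) := by decide
    rw [LocallyConstant.add_apply, z2, h, h']
    have h1 := hp.one_notMem
    rcases key e he with a | a <;> rcases key e' he' with a' | a'
    · simp only [a, a', not_true_eq_false, false_and, and_false, or_self, false_iff, not_not]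
      exact sub_mem (add_mem a a') (Ideal.mul_mem_left _ _ (Ideal.mul_mem_left _ _ a'))
    · have b : e' ∉ p.asIdeal := fun hb ↦ h1 (by simpa using add_mem a' hb)
      simp only [a, b, not_true_eq_false, false_and, true_and, not_false_eq_true, or_true, true_iff]
      intro hc
      refine b ?_
      have : e' = e + e' - 2 * (e * e') - (1 - 2 * e') * e := by ring
      rw [this]
      exact sub_mem hc (Ideal.mul_mem_left _ _ a)
    · have b : e ∉ p.asIdeal := fun hb ↦ h1 (by simpa using add_mem a hb)
      simp only [a', b, not_true_eq_false, not_false_eq_true, and_true, and_false, or_false,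
        true_iff]
      intro hc
      refine b ?_
      have : e = e + e' - 2 * (e * e') - (1 - 2 * e) * e' := by ring
      rw [this]
      exact sub_mem hc (Ideal.mul_mem_left _ _ a')
    · have b : e ∉ p.asIdeal := fun hb ↦ h1 (by simpa using add_mem a hb)
      have b' : e' ∉ p.asIdeal := fun hb ↦ h1 (by simpa using add_mem a' hb)
      simp only [b, b', not_true_eq_false, not_false_eq_true, and_false, false_and, or_self,
        false_iff, not_not]
      have : e + e' - 2 * (e * e') = e * (1 - e') + e' * (1 - e) := by ring
      rw [this]
      exact add_mem (Ideal.mul_mem_left _ _ a') (Ideal.mul_mem_left _ _ a)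

theorem signUnit_map (φ : R →+* S) {s : LocallyConstant (PrimeSpectrum R) (ZMod 2)}
    {s' : LocallyConstant (PrimeSpectrum S) (ZMod 2)}
    (h : ∀ p, s' p = s (PrimeSpectrum.comap φ p)) :
    Units.map (φ : R →* S) (signUnit s) = signUnit s' := by
  obtain ⟨e, he, hs, h1⟩ := exists_signUnit_eq s
  refine Units.ext ?_
  rw [signUnit_eq (e := φ e) (by rw [← map_mul, he]) fun p ↦ by rw [h, hs]; rfl]
  simp [h1, map_ofNat φ 2]

end Sign

/-! ### Points of an extension -/

namespace SymHeisExt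

variable {k : Type u} [Field k] {Γ : Type v} [AddCommGroup Γ] {c : LinearMap.BilinForm ℤ Γ}
  (E : SymHeisExt (k := k) c)

section Basic

variable {R S T : CommAlgCat.{u} k}

theorem map_comp_apply (φ : R ⟶ S) (ψ : S ⟶ T) (h : E.H.obj R) :
    E.H.map (φ ≫ ψ) h = E.H.map ψ (E.H.map φ h) := by
  rw [E.H.map_comp]; rfl

theorem map_id_apply (h : E.H.obj R) : E.H.map (𝟙 R) h = h := by
  rw [E.H.map_id]; rfl

theorem proj_incl (z : (R : Type u)ˣ) : E.proj R (E.incl R z) = 1 :=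
  (E.proj_eq_one_iff R _).2 ⟨z, rfl⟩

theorem exists_incl_mul {h h' : E.H.obj R} (e : E.proj R h' = E.proj R h) :
    ∃ z, h' = E.incl R z * h := by
  obtain ⟨z, hz⟩ := (E.proj_eq_one_iff R (h' * h⁻¹)).1 (by rw [map_mul, map_inv, e, mul_inv_cancel])
  exact ⟨z, by rw [hz, inv_mul_cancel_right]⟩

theorem incl_mul_cancel {z z' : (R : Type u)ˣ} {h : E.H.obj R}
    (e : E.incl R z * h = E.incl R z' * h) : z = z' :=
  E.incl_injective R (mul_right_cancel e)

/-- Points of the extension that are equal locally are equal. -/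
theorem eq_of_locally [Module.Free ℤ Γ] [Module.Finite ℤ Γ] {h h' : E.H.obj R}
    (e : Locally R fun _ φ ↦ E.H.map φ h = E.H.map φ h') : h = h' := by
  have hp : E.proj R h = E.proj R h' := (loopSheaf k Γ).sep R _ _ (e.mono fun S φ hφ ↦ by
    change loopMap Γ _ _ = loopMap Γ _ _
    rw [← E.proj_nat, ← E.proj_nat, hφ])
  obtain ⟨z, rfl⟩ := E.exists_incl_mul hp
  have hz : z = 1 := (unitsSheaf k).sep R _ _ (e.mono fun S φ hφ ↦ by
    rw [map_mul, E.incl_nat, mul_eq_right] at hφ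
    refine E.incl_injective S ?_
    change E.incl S (Units.map _ z) = E.incl S (Units.map _ 1)
    rw [hφ, map_one, map_one])
  rw [hz, map_one, one_mul]

/-- The extension, as a sheaf. -/
def sheaf [Module.Free ℤ Γ] [Module.Finite ℤ Γ] : ZSheaf.{u, u} k where
  obj R := E.H.obj R
  nonempty R := ⟨1⟩
  map φ h := E.H.map φ h
  map_comp φ ψ h := E.map_comp_apply φ ψ h
  sep R h h' e := E.eq_of_locally e
  glue R s hs h compat := E.glue R s hs h fun r hr r' hr' S φ ψ e ↦
    compat r hr r' hr' S φ ψ (by ext x; exact e x)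

theorem locally_exists_lift (a : Loop Γ R) :
    Locally R fun S φ ↦ ∃ h : E.H.obj S, E.proj S h = loopMap Γ (φ.hom : R →+* S) a := by
  obtain ⟨s, hs, h⟩ := E.exists_lift R a
  exact Locally.of_cover s hs h

theorem stable_exists_lift (a : Loop Γ R) :
    Stable R fun S φ ↦ ∃ h : E.H.obj S, E.proj S h = loopMap Γ (φ.hom : R →+* S) a := by
  rintro S T φ ψ ⟨h, hh⟩
  exact ⟨E.H.map ψ h, by rw [E.proj_nat, hh, loopMap_comp_hom]⟩

/-! ### Commutators -/

theorem exists_commutator (h h' : E.H.obj R) : ∃ z, E.incl R z = h * h' * h⁻¹ * h'⁻¹ :=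
  (E.proj_eq_one_iff R _).1 (by
    rw [map_mul, map_mul, map_mul, map_inv, map_inv, mul_right_comm, mul_inv_cancel_right,
      mul_inv_cancel])

/-- The commutator of two points of the extension, as an element of `𝔾ₘ`. -/
def chi (h h' : E.H.obj R) : (R : Type u)ˣ := (E.exists_commutator h h').choose

theorem incl_chi (h h' : E.H.obj R) : E.incl R (E.chi h h') = h * h' * h⁻¹ * h'⁻¹ :=
  (E.exists_commutator h h').choose_spec

theorem mul_eq_chi (h h' : E.H.obj R) : h * h' = E.incl R (E.chi h h') * (h' * h) := by
  rw [incl_chi]; group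

theorem chi_eq_iff {h h' : E.H.obj R} {z : (R : Type u)ˣ} :
    E.chi h h' = z ↔ h * h' = E.incl R z * (h' * h) := by
  refine ⟨fun e ↦ e ▸ E.mul_eq_chi h h', fun e ↦ ?_⟩
  rw [mul_eq_chi] at e
  exact E.incl_mul_cancel e

theorem incl_left_comm (z : (R : Type u)ˣ) (h h' : E.H.obj R) :
    h * (E.incl R z * h') = E.incl R z * (h * h') := by
  rw [← mul_assoc, ← E.central, mul_assoc]

theorem chi_mul_left (h₁ h₂ h : E.H.obj R) :
    E.chi (h₁ * h₂) h = E.chi h₁ h * E.chi h₂ h := by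
  rw [chi_eq_iff, mul_assoc, E.mul_eq_chi h₂ h, incl_left_comm, ← mul_assoc h₁, E.mul_eq_chi h₁ h,
    mul_comm (E.chi h₁ h), map_mul]
  simp only [mul_assoc]

theorem chi_mul_right (h h₁ h₂ : E.H.obj R) :
    E.chi h (h₁ * h₂) = E.chi h h₁ * E.chi h h₂ := by
  rw [chi_eq_iff, ← mul_assoc, E.mul_eq_chi h h₁, mul_assoc, mul_assoc, E.mul_eq_chi h h₂,
    incl_left_comm, map_mul]
  simp only [mul_assoc]

theorem chi_incl_left (z : (R : Type u)ˣ) (h : E.H.obj R) : E.chi (E.incl R z) h = 1 := by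
  rw [chi_eq_iff, map_one, one_mul, E.central]

theorem chi_incl_right (z : (R : Type u)ˣ) (h : E.H.obj R) : E.chi h (E.incl R z) = 1 := by
  rw [chi_eq_iff, map_one, one_mul, E.central]

theorem chi_map (φ : R ⟶ S) (h h' : E.H.obj R) :
    E.chi (E.H.map φ h) (E.H.map φ h') = Units.map (φ.hom : R →* S) (E.chi h h') := by
  rw [chi_eq_iff, ← map_mul, E.mul_eq_chi h h', map_mul, E.incl_nat, map_mul]

theorem parity_eq_zero {a : Loop Γ R} (h : ∀ p, loopVal p a = 0) : E.parity R a = 0 := by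
  ext p
  rw [E.parity_eq, h]
  simp

end Basic

section Pairing

variable [CharZero k]

/-- The commutator of `h` and `h'` is given by the Contou-Carrère symbol. -/
def HasSymbol {R : CommAlgCat.{u} k} (h h' : E.H.obj R) : Prop :=
  signUnit (E.parity R (E.proj R h) * E.parity R (E.proj R h')) * E.chi h h' =
    (symLoop c R (E.proj R h) (E.proj R h'))⁻¹

variable {R S : CommAlgCat.{u} k}

theorem HasSymbol.mul_left {h₁ h₂ h : E.H.obj R} (H₁ : E.HasSymbol h₁ h) (H₂ : E.HasSymbol h₂ h) :
    E.HasSymbol (h₁ * h₂) h := by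
  unfold HasSymbol at *
  rw [map_mul, E.parity_mul, add_mul, signUnit_add, chi_mul_left, mul_mul_mul_comm, H₁, H₂, map_mul,
    MonoidHom.mul_apply, mul_inv]

theorem HasSymbol.mul_right {h h₁ h₂ : E.H.obj R} (H₁ : E.HasSymbol h h₁) (H₂ : E.HasSymbol h h₂) :
    E.HasSymbol h (h₁ * h₂) := by
  unfold HasSymbol at *
  rw [map_mul, E.parity_mul, mul_add, signUnit_add, chi_mul_right, mul_mul_mul_comm, H₁, H₂,
    map_mul, mul_inv]

theorem hasSymbol_incl_left (z : (R : Type u)ˣ) (h : E.H.obj R) : E.HasSymbol (E.incl R z) h := by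
  unfold HasSymbol
  rw [proj_incl, E.parity_eq_zero (a := 1) (fun p ↦ loopVal_one p), zero_mul, chi_incl_left,
    signUnit_zero fun _ ↦ rfl]
  simp

theorem hasSymbol_incl_right (z : (R : Type u)ˣ) (h : E.H.obj R) : E.HasSymbol h (E.incl R z) := by
  unfold HasSymbol
  rw [proj_incl, E.parity_eq_zero (a := 1) (fun p ↦ loopVal_one p), mul_zero, chi_incl_right,
    signUnit_zero fun _ ↦ rfl]
  simp

theorem hasSymbol_of_locally {h h' : E.H.obj R}
    (H : Locally R fun _ φ ↦ E.HasSymbol (E.H.map φ h) (E.H.map φ h')) : E.HasSymbol h h' := by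
  refine (unitsSheaf k).sep R _ _ (H.mono fun S φ e ↦ ?_)
  unfold HasSymbol at e
  change Units.map (φ.hom : R →* S) _ = Units.map (φ.hom : R →* S) _
  rw [map_mul, map_inv, ← symLoop_map, ← chi_map, ← E.proj_nat, ← E.proj_nat, ← e]
  congr 1
  refine signUnit_map (φ.hom : R →+* S) fun p ↦ ?_
  rw [LocallyConstant.mul_apply, LocallyConstant.mul_apply, E.proj_nat, E.proj_nat, E.parity_nat,
    E.parity_nat]

theorem hasSymbol_expPt (f f' : ((R : Type u)⸨X⸩)ˣ) (γ γ' : Γ) {h h' : E.H.obj R}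
    (hh : E.proj R h = expPt f γ) (hh' : E.proj R h' = expPt f' γ') : E.HasSymbol h h' := by
  have := E.comm_pairing R f f' γ γ' h h' hh hh'
  rw [← incl_chi, ← map_mul, contouCarrere_eq_symbol, zpow_neg] at this
  unfold HasSymbol
  rw [hh, hh', E.incl_injective R this]
  rfl

/-- All commutators in the extension are given by the Contou-Carrère symbol. -/
theorem hasSymbol (h h' : E.H.obj R) : E.HasSymbol h h' := by
  -- the elements `f^γ` generate the loop group, and they lift locally
  have key (f' : ((R : Type u)⸨X⸩)ˣ) (γ' : Γ) (a : Loop Γ R) : ∀ (S : CommAlgCat.{u} k) (φ : R ⟶ S)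
      (h h' : E.H.obj S), E.proj S h = loopMap Γ (φ.hom : R →+* S) a →
        E.proj S h' = loopMap Γ (φ.hom : R →+* S) (expPt f' γ') → E.HasSymbol h h' := by
    induction a using torus_induction with
    | one =>
      intro S φ h h' hh _
      rw [map_one] at hh
      obtain ⟨z, rfl⟩ := (E.proj_eq_one_iff S h).1 hh
      exact E.hasSymbol_incl_left z h'
    | exp f γ => exact fun S φ h h' hh hh' ↦ E.hasSymbol_expPt _ _ γ γ' hh hh'
    | mul a b ha hb =>
      intro S φ h h' hh hh'
      refine E.hasSymbol_of_locally (((E.locally_exists_lift (loopMap Γ (φ.hom : R →+* S) a)).and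
        (E.stable_exists_lift _) (E.locally_exists_lift (loopMap Γ (φ.hom : R →+* S) b))
        (E.stable_exists_lift _)).mono ?_)
      rintro T ψ ⟨⟨g₁, h₁⟩, g₂, h₂⟩
      have h₀ : E.proj T (E.H.map ψ h) = E.proj T (g₁ * g₂) := by
        rw [E.proj_nat, hh, map_mul, map_mul, map_mul, h₁, h₂]
      have h₀' : E.proj T (E.H.map ψ h') = loopMap Γ ((φ ≫ ψ).hom : R →+* T) (expPt f' γ') := by
        rw [E.proj_nat, hh', loopMap_comp_hom]
      obtain ⟨z, hz⟩ := E.exists_incl_mul h₀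
      rw [hz]
      refine HasSymbol.mul_left E (E.hasSymbol_incl_left _ _) (HasSymbol.mul_left E
        (ha T (φ ≫ ψ) _ _ (by rw [h₁, loopMap_comp_hom]) h₀')
        (hb T (φ ≫ ψ) _ _ (by rw [h₂, loopMap_comp_hom]) h₀'))
  have key' (a a' : Loop Γ R) : ∀ (S : CommAlgCat.{u} k) (φ : R ⟶ S)
      (h h' : E.H.obj S), E.proj S h = loopMap Γ (φ.hom : R →+* S) a →
        E.proj S h' = loopMap Γ (φ.hom : R →+* S) a' → E.HasSymbol h h' := by
    induction a' using torus_induction with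
    | one =>
      intro S φ h h' _ hh'
      rw [map_one] at hh'
      obtain ⟨z, rfl⟩ := (E.proj_eq_one_iff S h').1 hh'
      exact E.hasSymbol_incl_right z h
    | exp f γ => exact key f γ a
    | mul a' b' ha hb =>
      intro S φ h h' hh hh'
      refine E.hasSymbol_of_locally (((E.locally_exists_lift (loopMap Γ (φ.hom : R →+* S) a')).and
        (E.stable_exists_lift _) (E.locally_exists_lift (loopMap Γ (φ.hom : R →+* S) b'))
        (E.stable_exists_lift _)).mono ?_)
      rintro T ψ ⟨⟨g₁, h₁⟩, g₂, h₂⟩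
      have h₀ : E.proj T (E.H.map ψ h') = E.proj T (g₁ * g₂) := by
        rw [E.proj_nat, hh', map_mul, map_mul, map_mul, h₁, h₂]
      have h₀' : E.proj T (E.H.map ψ h) = loopMap Γ ((φ ≫ ψ).hom : R →+* T) a := by
        rw [E.proj_nat, hh, loopMap_comp_hom]
      obtain ⟨z, hz⟩ := E.exists_incl_mul h₀
      rw [hz]
      refine HasSymbol.mul_right E (E.hasSymbol_incl_right _ _) (HasSymbol.mul_right E
        (ha T (φ ≫ ψ) _ _ h₀' (by rw [h₁, loopMap_comp_hom]))
        (hb T (φ ≫ ψ) _ _ h₀' (by rw [h₂, loopMap_comp_hom])))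
  exact key' (E.proj R h) (E.proj R h') R (𝟙 R) h h' (loopMap_id _).symm (loopMap_id _).symm

/-- If one of the two points is even, no sign appears in the commutator. -/
theorem chi_of_even_left {h h' : E.H.obj R} (hp : ∀ p, loopVal p (E.proj R h) = 0) :
    E.chi h h' = (symLoop c R (E.proj R h) (E.proj R h'))⁻¹ := by
  have := E.hasSymbol h h'
  unfold HasSymbol at this
  rwa [E.parity_eq_zero hp, zero_mul, signUnit_zero fun _ ↦ rfl, one_mul] at this

end Pairing

/-! ### The canonical lift of `Γ ⊗ Minus R` -/

section MinusLift

variable {R S : CommAlgCat.{u} k}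

/-- The lift `h` of a point `x` of `Γ ⊗ Minus R` that is inverted by the symmetric structure, and
becomes trivial over reduced rings. -/
structure IsMinusLift (x : TorusPts Γ (Minus R)) (h : E.H.obj R) : Prop where
  proj_eq : E.proj R h = minusToLoop Γ R x
  symm_eq : E.symm R h = h⁻¹
  map_eq_one : ∀ (T : CommAlgCat.{u} k) [IsReduced T] (ψ : R ⟶ T), E.H.map ψ h = 1

variable {E}

theorem IsMinusLift.map {x : TorusPts Γ (Minus R)} {h : E.H.obj R} (H : E.IsMinusLift x h)
    (φ : R ⟶ S) : E.IsMinusLift (torusMap Γ (minusMap (φ.hom : R →+* S)) x) (E.H.map φ h) where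
  proj_eq := by rw [E.proj_nat, H.proj_eq, loopMap_minusToLoop]
  symm_eq := by rw [← E.symm_nat, H.symm_eq, map_inv]
  map_eq_one T _ ψ := by rw [← map_comp_apply, H.map_eq_one]

/-- The reduction of a `k`-algebra. -/
abbrev redObj (R : CommAlgCat.{u} k) : CommAlgCat.{u} k := CommAlgCat.of k (R ⧸ nilradical R)

/-- The projection to the reduction. -/
abbrev redHom (R : CommAlgCat.{u} k) : R ⟶ redObj R :=
  CommAlgCat.ofHom (Ideal.Quotient.mkₐ k (nilradical R))

instance (R : CommAlgCat.{u} k) : IsReduced (redObj R) :=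
  (Ideal.isRadical_iff_quotient_reduced (nilradical R)).1 (Ideal.radical_isRadical ⊥)

theorem redHom_eq {x y : R} : (redHom R).hom x = (redHom R).hom y ↔ IsNilpotent (x - y) :=
  Ideal.Quotient.eq.trans mem_nilradical

theorem torusPts_minus_eq_one_of_isReduced [IsReduced R] (x : TorusPts Γ (Minus R)) : x = 1 := by
  have : MonoidHom.id (TorusPts Γ (Minus R)) = 1 := torus_hom_ext fun m γ ↦ by
    rw [minus_eq_one_of_isReduced m]
    simp
  exact DFunLike.congr_fun this x

theorem IsMinusLift.of_isReduced [IsReduced R] (x : TorusPts Γ (Minus R)) :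
    E.IsMinusLift x (1 : E.H.obj R) where
  proj_eq := by rw [torusPts_minus_eq_one_of_isReduced x, map_one, map_one]
  symm_eq := by rw [map_one, inv_one]
  map_eq_one T _ ψ := map_one _

theorem isNilpotent_sub_one_of_incl {z : (R : Type u)ˣ}
    (h : E.incl (redObj R) (Units.map ((redHom R).hom : R →* redObj R) z) = 1) :
    IsNilpotent ((z : R) - 1) := by
  rw [← map_one (E.incl (redObj R))] at h
  refine redHom_eq.1 ?_
  rw [map_one]
  exact congrArg Units.val (E.incl_injective _ h)

/-- Two lifts differ by a unit `z` with `z² = 1` that is unipotent, whence `z = 1`. -/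
theorem IsMinusLift.unique [CharZero k] {x : TorusPts Γ (Minus R)} {h h' : E.H.obj R}
    (H : E.IsMinusLift x h) (H' : E.IsMinusLift x h') : h = h' := by
  obtain ⟨z, hz⟩ := E.exists_incl_mul (H'.proj_eq.trans H.proj_eq.symm)
  have h1 : z * z = 1 := by
    have h2 := H'.symm_eq
    rw [hz, map_mul, E.symm_incl, H.symm_eq, mul_inv_rev, ← map_inv, ← E.central] at h2
    exact eq_inv_iff_mul_eq_one.1 (E.incl_mul_cancel h2)
  have h3 : IsNilpotent ((z : R) - 1) := by
    refine isNilpotent_sub_one_of_incl (E := E) ?_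
    have h4 := H'.map_eq_one (redObj R) (redHom R)
    rwa [hz, map_mul, H.map_eq_one, mul_one, E.incl_nat] at h4
  have h5 : IsUnit ((z : R) + 1) := by
    have : (z : R) + 1 = algebraMap k R 2 + ((z : R) - 1) := by
      rw [map_ofNat]; ring
    rw [this]
    exact h3.isUnit_add_left_of_commute ((isUnit_iff_ne_zero.2 two_ne_zero).map _)
      (Commute.all _ _)
  have h6 : ((z : R) - 1) * (z + 1) = 0 := by
    have := congrArg Units.val h1
    rw [Units.val_mul, Units.val_one] at this
    linear_combination this
  have h7 : z = 1 := Units.ext (sub_eq_zero.1 ((h5.mul_left_eq_zero).1 h6))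
  rw [hz, h7, map_one, one_mul]

/-- Let `h₁` be a lift that is trivial over the reduction, and let `σ(h₁) h₁ = w ∈ 𝔾ₘ`. Then `w` is
unipotent, and `v⁻¹ h₁` is the desired lift, if `v² = w` and `v` is unipotent. -/
theorem exists_isMinusLift_of_lift [CharZero k] {x : TorusPts Γ (Minus R)} {h : E.H.obj R}
    (hh : E.proj R h = minusToLoop Γ R x) : ∃ h', E.IsMinusLift x h' := by
  obtain ⟨zbar, hz⟩ : ∃ z, E.incl (redObj R) z = E.H.map (redHom R) h := by
    rw [← E.proj_eq_one_iff, E.proj_nat, hh, loopMap_minusToLoop,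
      torusPts_minus_eq_one_of_isReduced (torusMap Γ _ x), map_one]
  -- lift `zbar` to a unit
  obtain ⟨z, hz'⟩ : ∃ z : (R : Type u)ˣ, Units.map ((redHom R).hom : R →* redObj R) z = zbar := by
    obtain ⟨a, ha⟩ := Ideal.Quotient.mk_surjective (zbar : R ⧸ nilradical R)
    obtain ⟨b, hb⟩ := Ideal.Quotient.mk_surjective
      ((zbar⁻¹ : (redObj R : Type u)ˣ) : R ⧸ nilradical R)
    have hab : IsNilpotent (a * b - 1) := by
      rw [← redHom_eq]
      change Ideal.Quotient.mk (nilradical R) (a * b) = Ideal.Quotient.mk (nilradical R) 1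
      rw [map_mul, ha, hb, map_one]
      exact zbar.mul_inv
    have hu : IsUnit a := by
      have h1 := hab.isUnit_add_one
      rw [sub_add_cancel] at h1
      exact isUnit_of_mul_isUnit_left h1
    obtain ⟨z, rfl⟩ := hu
    exact ⟨z, Units.ext ha⟩
  set h₁ : E.H.obj R := E.incl R z⁻¹ * h with hh₁
  have h₁red : E.H.map (redHom R) h₁ = 1 := by
    rw [hh₁, map_mul, E.incl_nat, map_inv, hz', ← hz, ← map_mul, inv_mul_cancel, map_one]
  have h₁proj : E.proj R h₁ = minusToLoop Γ R x := by
    rw [hh₁, map_mul, proj_incl, one_mul, hh]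
  obtain ⟨w, hw⟩ : ∃ w, E.incl R w = E.symm R h₁ * h₁ := by
    rw [← E.proj_eq_one_iff, map_mul, E.proj_symm, inv_mul_cancel]
  have hwn : IsNilpotent ((w : R) - 1) := by
    refine isNilpotent_sub_one_of_incl (E := E) ?_
    rw [← E.incl_nat, hw, map_mul, E.symm_nat, h₁red, map_one, mul_one]
  obtain ⟨y, hy, hyw⟩ := exists_sq_eq k hwn
  obtain ⟨v, hv⟩ := hy.isUnit_one_add
  have hvw : v * v = w := Units.ext (by rw [Units.val_mul, hv, hyw, add_sub_cancel])
  refine ⟨E.incl R v⁻¹ * h₁, by rw [map_mul, proj_incl, one_mul, h₁proj], ?_, fun T _ ψ ↦ ?_⟩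
  · rw [eq_inv_iff_mul_eq_one, map_mul, E.symm_incl, mul_assoc, incl_left_comm, ← mul_assoc,
      ← map_mul, ← hw, ← map_mul, ← hvw]
    simp
  · have h1 : ∀ x ∈ nilradical R, ψ.hom x = 0 := fun x hx ↦
      ((mem_nilradical.1 hx).map ψ.hom).eq_zero
    have h2 : ψ = redHom R ≫ CommAlgCat.ofHom (Ideal.Quotient.liftₐ (nilradical R) ψ.hom h1) := by
      ext x
      rfl
    have h3 : E.H.map ψ h₁ = 1 := by
      rw [h2, map_comp_apply, h₁red, map_one]
    rw [map_mul, h3, mul_one, E.incl_nat]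
    have h4 : Units.map (ψ.hom : R →* T) v⁻¹ = 1 := by
      rw [map_inv, inv_eq_one]
      refine Units.ext ?_
      change ψ.hom (v : R) = 1
      rw [hv, map_add, map_one, h1 y (mem_nilradical.2 hy), add_zero]
    rw [h4, map_one]

variable (E)

/-- The lift exists because it exists locally and is unique. -/
theorem exists_isMinusLift [CharZero k] [Module.Free ℤ Γ] [Module.Finite ℤ Γ]
    (x : TorusPts Γ (Minus R)) : ∃ h, E.IsMinusLift x h := by
  have mm {S T : CommAlgCat.{u} k} (φ : R ⟶ S) (ψ : S ⟶ T) :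
      torusMap Γ (minusMap ((φ ≫ ψ).hom : R →+* T)) x =
        torusMap Γ (minusMap (ψ.hom : S →+* T)) (torusMap Γ (minusMap (φ.hom : R →+* S)) x) := by
    rw [← torusMap_comp]
    rfl
  obtain ⟨h, hh, hl⟩ : ∃ h : E.H.obj R,
      (∀ ⦃S : CommAlgCat.{u} k⦄ (φ : R ⟶ S) (h' : E.H.obj S),
        E.IsMinusLift (torusMap Γ (minusMap (φ.hom : R →+* S)) x) h' → E.H.map φ h = h') ∧
      Locally R fun S φ ↦
        E.IsMinusLift (torusMap Γ (minusMap (φ.hom : R →+* S)) x) (E.H.map φ h) :=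
    E.sheaf.exists_of_local R
    (fun S φ h ↦ E.IsMinusLift (torusMap Γ (minusMap (φ.hom : R →+* S)) x) h)
    (fun S T φ ψ h H ↦ by rw [mm]; exact H.map ψ)
    (fun S φ h h' H H' ↦ H.unique H')
    ((E.locally_exists_lift (minusToLoop Γ R x)).mono fun S φ ⟨h, hh⟩ ↦
      exists_isMinusLift_of_lift (by rw [hh, loopMap_minusToLoop]))
  refine ⟨h, (loopSheaf k Γ).sep R _ _ (hl.mono fun S φ H ↦ ?_),
    E.eq_of_locally (hl.mono fun S φ H ↦ ?_), fun T _ ψ ↦ hh ψ 1 (IsMinusLift.of_isReduced _)⟩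
  · change loopMap Γ _ _ = loopMap Γ _ _
    rw [← E.proj_nat, loopMap_minusToLoop]
    exact H.proj_eq
  · rw [E.symm_nat, map_inv]
    exact H.symm_eq

variable [CharZero k] [Module.Free ℤ Γ] [Module.Finite ℤ Γ]

/-- The canonical lift of `Γ ⊗ Minus R` to the extension. It is a homomorphism because the symbol is
trivial on `Minus R`, so that the lifts commute. -/
def minusLift (R : CommAlgCat.{u} k) : TorusPts Γ (Minus R) →* E.H.obj R :=
  MonoidHom.mk' (fun x ↦ (E.exists_isMinusLift x).choose) fun x y ↦ by
    have hx := (E.exists_isMinusLift x).choose_spec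
    have hy := (E.exists_isMinusLift y).choose_spec
    refine (E.exists_isMinusLift (x * y)).choose_spec.unique ⟨?_, ?_, fun T _ ψ ↦ ?_⟩
    · rw [map_mul, hx.proj_eq, hy.proj_eq, map_mul]
    · -- the lifts of `x` and `y` commute
      have hc := E.mul_eq_chi (E.exists_isMinusLift x).choose (E.exists_isMinusLift y).choose
      rw [chi_of_even_left, hx.proj_eq, hy.proj_eq, symLoop_minus_minus, inv_one, map_one,
        one_mul] at hc
      · rw [map_mul, hx.symm_eq, hy.symm_eq, ← mul_inv_rev, hc]
      · intro p
        rw [hx.proj_eq, loopVal_minusToLoop]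
    · rw [map_mul, hx.map_eq_one, hy.map_eq_one, one_mul]

theorem isMinusLift_minusLift (x : TorusPts Γ (Minus R)) : E.IsMinusLift x (E.minusLift R x) :=
  (E.exists_isMinusLift x).choose_spec

theorem map_minusLift (φ : R ⟶ S) (x : TorusPts Γ (Minus R)) :
    E.H.map φ (E.minusLift R x) = E.minusLift S (torusMap Γ (minusMap (φ.hom : R →+* S)) x) :=
  ((E.isMinusLift_minusLift x).map φ).unique (E.isMinusLift_minusLift _)

end MinusLift

end SymHeisExt

/-! ### Frames of an extension -/

section Base

variable {k : Type u} [Field k]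

/-- The structure morphism of a `k`-algebra. -/
def base (R : CommAlgCat.{u} k) : CommAlgCat.of k k ⟶ R := CommAlgCat.ofHom (Algebra.ofId k R)

theorem base_comp {R S : CommAlgCat.{u} k} (φ : R ⟶ S) : base R ≫ φ = base S := by
  ext

/-- A unit of `k`, as a unit of a `k`-algebra. -/
def kUnit (R : CommAlgCat.{u} k) : kˣ →* (R : Type u)ˣ := Units.map (algebraMap k R : k →* R)

theorem kUnit_self (z : kˣ) : kUnit (CommAlgCat.of k k) z = z := Units.ext rfl

theorem map_kUnit {R S : CommAlgCat.{u} k} (φ : R ⟶ S) (z : kˣ) :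
    Units.map (φ.hom : R →* S) (kUnit R z) = kUnit S z :=
  Units.ext (φ.hom.commutes (z : k))

/-- What exists locally over a field and is stable under base change exists. -/
theorem Locally.of_field {P : ∀ ⦃S : CommAlgCat.{u} k⦄, (CommAlgCat.of k k ⟶ S) → Prop}
    (h : Locally (CommAlgCat.of k k) P) (hP : Stable (CommAlgCat.of k k) P) :
    P (𝟙 (CommAlgCat.of k k)) := by
  obtain ⟨r, hr, h⟩ := h ⟨(⊥ : Ideal k), Ideal.isPrime_bot⟩
  obtain ⟨φ, hφ⟩ := exists_awayHom_comp (𝟙 (CommAlgCat.of k k)) r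
    (isUnit_iff_ne_zero.2 fun h0 : r = 0 ↦ hr (by rw [h0]; exact zero_mem _))
  exact hφ ▸ hP _ φ h

theorem Locally.of_subsingleton {R : CommAlgCat.{u} k} [Subsingleton R]
    {P : ∀ ⦃S : CommAlgCat.{u} k⦄, (R ⟶ S) → Prop} : Locally R P := fun p ↦
  (p.2.ne_top (Ideal.eq_top_of_unit_mem _ 0 0 (zero_mem _) (Subsingleton.elim _ _))).elim

end Base

namespace SymHeisExt

variable {k : Type u} [Field k] {Γ : Type v} [AddCommGroup Γ] {c : LinearMap.BilinForm ℤ Γ}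

/-- A frame of an extension: a family of lifts `q(γ)` of the `k`-points `t^{-γ}`. No compatibility
of the lifts with the product is required. -/
structure Frame (E : SymHeisExt (k := k) c) where
  q (γ : Γ) : E.H.obj (CommAlgCat.of k k)
  proj_q (γ : Γ) : E.proj _ (q γ) = expPt (tUnit k) (-γ)

theorem exists_lift_of_field (E : SymHeisExt (k := k) c) (a : Loop Γ k) :
    ∃ h, E.proj (CommAlgCat.of k k) h = a := by
  obtain ⟨h, hh⟩ := (E.locally_exists_lift (R := CommAlgCat.of k k) a).of_field
    (E.stable_exists_lift (R := CommAlgCat.of k k) a)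
  exact ⟨h, hh.trans (loopMap_id (R := k) a)⟩

/-- A frame exists, since over a field points lift globally. -/
def frame (E : SymHeisExt (k := k) c) : Frame E where
  q γ := (E.exists_lift_of_field (expPt (tUnit k) (-γ))).choose
  proj_q γ := (E.exists_lift_of_field (expPt (tUnit k) (-γ))).choose_spec

namespace Frame

variable {E : SymHeisExt (k := k) c} (Q : Frame E)

theorem exists_m (γ₁ γ₂ : Γ) :
    ∃ z : kˣ, Q.q γ₁ * Q.q γ₂ = E.incl (CommAlgCat.of k k) z * Q.q (γ₁ + γ₂) :=
  E.exists_incl_mul (R := CommAlgCat.of k k) (by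
    rw [map_mul, Q.proj_q, Q.proj_q, Q.proj_q, neg_add, expPt_add])

/-- The structure constants of the product: `q(γ₁) q(γ₂) = m(γ₁, γ₂) q(γ₁ + γ₂)`. -/
def m (γ₁ γ₂ : Γ) : kˣ := (Q.exists_m γ₁ γ₂).choose

theorem q_mul (γ₁ γ₂ : Γ) :
    Q.q γ₁ * Q.q γ₂ = E.incl (CommAlgCat.of k k) (Q.m γ₁ γ₂) * Q.q (γ₁ + γ₂) :=
  (Q.exists_m γ₁ γ₂).choose_spec

theorem exists_s (γ : Γ) :
    ∃ z : kˣ, E.symm _ (Q.q γ) = E.incl (CommAlgCat.of k k) z * Q.q (-γ) :=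
  E.exists_incl_mul (R := CommAlgCat.of k k) (by
    rw [E.proj_symm, Q.proj_q, Q.proj_q, ← expPt_neg])

/-- The structure constants of the involution: `σ(q(γ)) = s(γ) q(-γ)`. -/
def s (γ : Γ) : kˣ := (Q.exists_s γ).choose

theorem symm_q (γ : Γ) :
    E.symm _ (Q.q γ) = E.incl (CommAlgCat.of k k) (Q.s γ) * Q.q (-γ) :=
  (Q.exists_s γ).choose_spec

/-- The lift `q(γ)` over a `k`-algebra. -/
def qr (R : CommAlgCat.{u} k) (γ : Γ) : E.H.obj R := E.H.map (base R) (Q.q γ)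

variable {R S : CommAlgCat.{u} k}

theorem map_qr (φ : R ⟶ S) (γ : Γ) : E.H.map φ (Q.qr R γ) = Q.qr S γ := by
  rw [qr, ← map_comp_apply, base_comp, qr]

theorem proj_qr (γ : Γ) : E.proj R (Q.qr R γ) = expPt (tUnit R) (-γ) := by
  rw [qr, E.proj_nat, Q.proj_q]
  exact loopMap_tUnit ((base R).hom : k →+* R) _

theorem qr_mul (γ₁ γ₂ : Γ) :
    Q.qr R γ₁ * Q.qr R γ₂ = E.incl R (kUnit R (Q.m γ₁ γ₂)) * Q.qr R (γ₁ + γ₂) := by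
  rw [qr, qr, ← map_mul, Q.q_mul, map_mul, E.incl_nat]
  rfl

theorem symm_qr (γ : Γ) :
    E.symm R (Q.qr R γ) = E.incl R (kUnit R (Q.s γ)) * Q.qr R (-γ) := by
  rw [qr, ← E.symm_nat, Q.symm_q, map_mul, E.incl_nat]
  rfl

theorem qr_zero : Q.qr R 0 = E.incl R (kUnit R (Q.m 0 0)) := by
  have h := Q.qr_mul (R := R) 0 0
  rwa [add_zero, mul_left_inj] at h

variable [CharZero k]

theorem split_mul_qr (b : Arc Γ R) (γ : Γ) : E.split R b * Q.qr R γ =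
    E.incl R (halfLoop c R (arcToLoop Γ R b) (expPt (tUnit R) (-γ)))⁻¹ *
      (Q.qr R γ * E.split R b) := by
  rw [E.mul_eq_chi, chi_of_even_left, E.proj_split, proj_qr, symLoop_arc_t]
  intro p
  rw [E.proj_split, loopVal_arcToLoop]

variable [Module.Free ℤ Γ] [Module.Finite ℤ Γ]

variable (R) in
/-- The lift `q(γ) i(b) x̃` of a factored point `t^{-γ} b x` of the loop group, with the canonical
lift `x̃` of `x`. -/
def lift (x : LoopFac Γ R) : E.H.obj R :=
  Q.qr R x.1.toAdd * (E.split R x.2.1 * E.minusLift R x.2.2)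

theorem proj_lift (x : LoopFac Γ R) : E.proj R (Q.lift R x) = loopFacVal Γ R x := by
  rw [lift, map_mul, map_mul, proj_qr, E.proj_split, (E.isMinusLift_minusLift _).proj_eq,
    loopFacVal_apply]

theorem map_lift (φ : R ⟶ S) (x : LoopFac Γ R) :
    E.H.map φ (Q.lift R x) = Q.lift S (loopFacMap Γ (φ.hom : R →+* S) x) := by
  rw [lift, map_mul, map_mul, map_qr, E.split_nat, map_minusLift]
  rfl

theorem minusLift_mul_qr (x : TorusPts Γ (Minus R)) (γ : Γ) :
    E.minusLift R x * Q.qr R γ = Q.qr R γ * E.minusLift R x := by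
  rw [E.mul_eq_chi, chi_of_even_left, (E.isMinusLift_minusLift x).proj_eq, proj_qr,
    symLoop_minus_t, inv_one, map_one, one_mul]
  intro p
  rw [(E.isMinusLift_minusLift x).proj_eq, loopVal_minusToLoop]

variable (E) in
theorem minusLift_mul_split (x : TorusPts Γ (Minus R)) (b : Arc Γ R) :
    E.minusLift R x * E.split R b =
      E.incl R (halfLoop c R (minusToLoop Γ R x) (arcToLoop Γ R b))⁻¹ *
        (E.split R b * E.minusLift R x) := by
  rw [E.mul_eq_chi, chi_of_even_left, (E.isMinusLift_minusLift x).proj_eq, E.proj_split,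
    symLoop_minus_arc]
  intro p
  rw [(E.isMinusLift_minusLift x).proj_eq, loopVal_minusToLoop]

/-- The product of the lifts of two factored points. -/
theorem lift_mul (x y : LoopFac Γ R) : Q.lift R x * Q.lift R y =
    E.incl R (kUnit R (Q.m x.1.toAdd y.1.toAdd) *
      (halfLoop c R (loopFacVal Γ R x) (loopFacVal Γ R y))⁻¹) * Q.lift R (x * y) := by
  have e : Q.lift R x * Q.lift R y = Q.qr R x.1.toAdd * (E.split R x.2.1 *
      ((E.minusLift R x.2.2 * Q.qr R y.1.toAdd) *
        (E.split R y.2.1 * E.minusLift R y.2.2))) := by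
    simp only [lift, mul_assoc]
  have e' : Q.lift R (x * y) = Q.qr R (x.1.toAdd + y.1.toAdd) *
      ((E.split R x.2.1 * E.split R y.2.1) * (E.minusLift R x.2.2 * E.minusLift R y.2.2)) := by
    rw [← map_mul, ← map_mul]
    rfl
  rw [e, minusLift_mul_qr, mul_assoc (Q.qr R y.1.toAdd), ← mul_assoc (E.split R x.2.1),
    split_mul_qr, ← mul_assoc (E.minusLift R x.2.2), minusLift_mul_split, halfLoop_loopFacVal, e']
  simp only [mul_assoc]
  -- move the two central factors to the left
  rw [incl_left_comm, incl_left_comm, incl_left_comm, incl_left_comm,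
    ← mul_assoc (Q.qr R x.1.toAdd) (Q.qr R y.1.toAdd), qr_mul]
  simp only [← mul_assoc, ← map_mul]
  rw [mul_inv, mul_comm (kUnit R _)]

theorem symm_lift (x : LoopFac Γ R) :
    E.symm R (Q.lift R x) = E.incl R (kUnit R (Q.s x.1.toAdd)) * Q.lift R x⁻¹ := by
  rw [lift, map_mul, map_mul, symm_qr, E.symm_split, (E.isMinusLift_minusLift _).symm_eq,
    ← map_inv (E.minusLift R), mul_assoc]
  rfl

/-- The element `q(0)` of a frame need not be `1`, but it is the scalar `m(0, 0)`. -/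
theorem incl_eq_lift (z : (R : Type u)ˣ) :
    E.incl R z = E.incl R (z * (kUnit R (Q.m 0 0))⁻¹) * Q.lift R 1 := by
  have h : Q.lift R 1 = Q.qr R 0 * (E.split R 1 * E.minusLift R 1) := rfl
  rw [h, map_one, map_one, mul_one, mul_one, qr_zero, ← map_mul, inv_mul_cancel_right]

theorem split_eq_lift (b : Arc Γ R) :
    E.split R b = E.incl R (kUnit R (Q.m 0 0))⁻¹ * Q.lift R (1, b, 1) := by
  have h : Q.lift R (1, b, 1) = Q.qr R 0 * (E.split R b * E.minusLift R 1) := rfl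
  rw [h, map_one, mul_one, qr_zero, ← mul_assoc, ← map_mul, inv_mul_cancel, map_one, one_mul]

end Frame

end SymHeisExt

/-! ### Comparison of extensions with the same structure constants -/

namespace SymHeisExt

variable {k : Type u} [Field k] {Γ : Type v} [AddCommGroup Γ] {c : LinearMap.BilinForm ℤ Γ}

theorem base_self : base (CommAlgCat.of k k) = 𝟙 _ := by
  ext

namespace Frame

variable {E E' : SymHeisExt (k := k) c} (Q : Frame E) (Q' : Frame E')

variable {R S T : CommAlgCat.{u} k}

theorem qr_self (γ : Γ) : Q.qr (CommAlgCat.of k k) γ = Q.q γ := by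
  rw [qr, base_self, map_id_apply]

variable [CharZero k] [Module.Free ℤ Γ] [Module.Finite ℤ Γ]

theorem q_eq_lift (γ : Γ) :
    Q.q γ = Q.lift (CommAlgCat.of k k) (Multiplicative.ofAdd γ, 1, 1) := by
  rw [lift, toAdd_ofAdd, qr_self, map_one, map_one, mul_one, mul_one]

theorem locally_eq_lift (h : E.H.obj R) :
    Locally R fun S φ ↦ ∃ z x, E.H.map φ h = E.incl S z * Q.lift S x := by
  refine (locally_exists_loopFac (E.proj R h)).mono fun S φ ⟨x, hx⟩ ↦ ?_
  obtain ⟨z, hz⟩ := E.exists_incl_mul (h := Q.lift S x) (h' := E.H.map φ h)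
    (by rw [proj_lift, hx, E.proj_nat])
  exact ⟨z, x, hz⟩

/-- The points `z q(γ) i(b) x̃` of two extensions, with the same `z`, `γ`, `b`, `x`, correspond to
each other. -/
def Rel (h : E.H.obj R) (h' : E'.H.obj R) : Prop :=
  ∃ z x, h = E.incl R z * Q.lift R x ∧ h' = E'.incl R z * Q'.lift R x

variable {Q Q'}

theorem Rel.map {h : E.H.obj R} {h' : E'.H.obj R} (H : Rel Q Q' h h') (φ : R ⟶ S) :
    Rel Q Q' (E.H.map φ h) (E'.H.map φ h') := by
  obtain ⟨z, x, rfl, rfl⟩ := H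
  exact ⟨Units.map (φ.hom : R →* S) z, loopFacMap Γ (φ.hom : R →+* S) x,
    by rw [map_mul, E.incl_nat, map_lift], by rw [map_mul, E'.incl_nat, map_lift]⟩

theorem Rel.unique {h : E.H.obj R} {h' h'' : E'.H.obj R} (H : Rel Q Q' h h')
    (H' : Rel Q Q' h h'') : h' = h'' := by
  rcases subsingleton_or_nontrivial R with hR | hR
  · exact E'.eq_of_locally Locally.of_subsingleton
  obtain ⟨z, x, rfl, rfl⟩ := H
  obtain ⟨z', x', e, rfl⟩ := H'
  have hx : x = x' := loopFacVal_injective (by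
    have := congrArg (E.proj R) e
    rwa [map_mul, map_mul, proj_incl, proj_incl, one_mul, one_mul, proj_lift, proj_lift] at this)
  subst hx
  rw [E.incl_mul_cancel e]

theorem Rel.mul (hm : Q.m = Q'.m) {g h : E.H.obj R} {g' h' : E'.H.obj R} (H : Rel Q Q' g g')
    (H' : Rel Q Q' h h') : Rel Q Q' (g * h) (g' * h') := by
  obtain ⟨z, x, rfl, rfl⟩ := H
  obtain ⟨w, y, rfl, rfl⟩ := H'
  refine ⟨z * w * (kUnit R (Q.m x.1.toAdd y.1.toAdd) *
      (halfLoop c R (loopFacVal Γ R x) (loopFacVal Γ R y))⁻¹), x * y, ?_, ?_⟩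
  · rw [mul_assoc, incl_left_comm, lift_mul]
    simp only [map_mul, mul_assoc]
  · rw [mul_assoc, incl_left_comm, lift_mul, hm]
    simp only [map_mul, mul_assoc]

theorem Rel.symm (hs : Q.s = Q'.s) {h : E.H.obj R} {h' : E'.H.obj R} (H : Rel Q Q' h h') :
    Rel Q Q' (E.symm R h) (E'.symm R h') := by
  obtain ⟨z, x, rfl, rfl⟩ := H
  refine ⟨z * kUnit R (Q.s x.1.toAdd), x⁻¹, ?_, ?_⟩
  · rw [map_mul, E.symm_incl, symm_lift, map_mul, mul_assoc]
  · rw [map_mul, E'.symm_incl, symm_lift, map_mul, mul_assoc, hs]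

theorem rel_incl (hm : Q.m = Q'.m) (z : (R : Type u)ˣ) : Rel Q Q' (E.incl R z) (E'.incl R z) :=
  ⟨_, _, Q.incl_eq_lift z, hm ▸ Q'.incl_eq_lift z⟩

theorem rel_split (hm : Q.m = Q'.m) (b : Arc Γ R) : Rel Q Q' (E.split R b) (E'.split R b) :=
  ⟨_, _, Q.split_eq_lift b, hm ▸ Q'.split_eq_lift b⟩

theorem rel_q (γ : Γ) : Rel Q Q' (Q.q γ) (Q'.q γ) :=
  ⟨1, _, by rw [map_one, one_mul]; exact Q.q_eq_lift γ,
    by rw [map_one, one_mul]; exact Q'.q_eq_lift γ⟩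

variable (Q Q') in
/-- Points of two extensions that correspond to each other locally. -/
def LRel (h : E.H.obj R) (h' : E'.H.obj R) : Prop :=
  Locally R fun _ φ ↦ Rel Q Q' (E.H.map φ h) (E'.H.map φ h')

theorem stable_rel (h : E.H.obj R) (h' : E'.H.obj R) :
    Stable R fun _ φ ↦ Rel Q Q' (E.H.map φ h) (E'.H.map φ h') := fun S T φ ψ H ↦ by
  have := Rel.map H ψ
  rwa [← map_comp_apply, ← map_comp_apply] at this

theorem Rel.lrel {h : E.H.obj R} {h' : E'.H.obj R} (H : Rel Q Q' h h') : LRel Q Q' h h' :=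
  fun p ↦ ⟨1, p.2.one_notMem, H.map _⟩

theorem LRel.map {h : E.H.obj R} {h' : E'.H.obj R} (H : LRel Q Q' h h') (φ : R ⟶ S) :
    LRel Q Q' (E.H.map φ h) (E'.H.map φ h') :=
  (Locally.comp H (stable_rel h h') φ).mono fun T ψ H ↦ by
    rwa [map_comp_apply, map_comp_apply] at H

theorem LRel.unique {h : E.H.obj R} {h' h'' : E'.H.obj R} (H : LRel Q Q' h h')
    (H' : LRel Q Q' h h'') : h' = h'' :=
  E'.eq_of_locally ((Locally.and H (stable_rel _ _) H' (stable_rel _ _)).mono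
    fun _ _ e ↦ e.1.unique e.2)

theorem LRel.swap {h : E.H.obj R} {h' : E'.H.obj R} (H : LRel Q Q' h h') : LRel Q' Q h' h :=
  Locally.mono H fun _ _ ⟨z, x, e, e'⟩ ↦ ⟨z, x, e', e⟩

theorem LRel.mul (hm : Q.m = Q'.m) {g h : E.H.obj R} {g' h' : E'.H.obj R} (H : LRel Q Q' g g')
    (H' : LRel Q Q' h h') : LRel Q Q' (g * h) (g' * h') :=
  (Locally.and H (stable_rel _ _) H' (stable_rel _ _)).mono fun _ _ e ↦ by
    rw [map_mul, map_mul]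
    exact e.1.mul hm e.2

theorem LRel.symm (hs : Q.s = Q'.s) {h : E.H.obj R} {h' : E'.H.obj R} (H : LRel Q Q' h h') :
    LRel Q Q' (E.symm R h) (E'.symm R h') :=
  Locally.mono H fun _ _ e ↦ by
    rw [E.symm_nat, E'.symm_nat]
    exact e.symm hs

variable (Q Q')

theorem exists_lrel (h : E.H.obj R) : ∃ h' : E'.H.obj R, LRel Q Q' h h' := by
  obtain ⟨h', -, hl⟩ := E'.sheaf.exists_of_local R (fun S φ h' ↦ Rel Q Q' (E.H.map φ h) h')
    (fun S T φ ψ h' H ↦ by rw [map_comp_apply]; exact H.map ψ)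
    (fun S φ h' h'' H H' ↦ H.unique H')
    ((Q.locally_eq_lift h).mono fun S φ ⟨z, x, e⟩ ↦ ⟨E'.incl S z * Q'.lift S x, z, x, e, rfl⟩)
  exact ⟨h', hl⟩

/-- The point of `E'` that corresponds to a point of `E`. -/
def corr (R : CommAlgCat.{u} k) (h : E.H.obj R) : E'.H.obj R := (exists_lrel Q Q' h).choose

theorem lrel_corr (h : E.H.obj R) : LRel Q Q' h (corr Q Q' R h) :=
  (exists_lrel Q Q' h).choose_spec

theorem corr_eq_iff {h : E.H.obj R} {h' : E'.H.obj R} : corr Q Q' R h = h' ↔ LRel Q Q' h h' :=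
  ⟨fun e ↦ e ▸ lrel_corr Q Q' h, fun H ↦ (lrel_corr Q Q' h).unique H⟩

/-- The isomorphism of extensions that matches two frames with the same structure constants. -/
def iso (hm : Q.m = Q'.m) (hs : Q.s = Q'.s) : Iso E E' where
  equiv R :=
    { toFun := corr Q Q' R
      invFun := corr Q' Q R
      left_inv := fun h ↦ (corr_eq_iff Q' Q).2 (lrel_corr Q Q' h).swap
      right_inv := fun h ↦ (corr_eq_iff Q Q').2 (lrel_corr Q' Q h).swap
      map_mul' := fun h h' ↦
        (corr_eq_iff Q Q').2 ((lrel_corr Q Q' h).mul hm (lrel_corr Q Q' h')) }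
  nat φ h := (corr_eq_iff Q Q').2 ((lrel_corr Q Q' h).map φ)
  equiv_incl R z := (corr_eq_iff Q Q').2 (rel_incl hm z).lrel
  proj_equiv R h := (loopSheaf k Γ).sep R _ _ <|
    Locally.mono (lrel_corr Q Q' h) fun S φ ⟨z, x, e, e'⟩ ↦ by
      change loopMap Γ _ _ = loopMap Γ _ _
      rw [← E.proj_nat, e, ← E'.proj_nat]
      change E'.proj S (E'.H.map φ (corr Q Q' R h)) = _
      rw [e', map_mul, map_mul, proj_incl, proj_incl, proj_lift, proj_lift]
  equiv_split R b := (corr_eq_iff Q Q').2 (rel_split hm b).lrel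
  equiv_symm R h := (corr_eq_iff Q Q').2 ((lrel_corr Q Q' h).symm hs)

theorem iso_q (hm : Q.m = Q'.m) (hs : Q.s = Q'.s) (γ : Γ) :
    (iso Q Q' hm hs).equiv _ (Q.q γ) = Q'.q γ :=
  (corr_eq_iff Q Q').2 (rel_q γ).lrel

/-- The image of a frame under an isomorphism. -/
def mapIso (e : Iso E E') : Frame E' where
  q γ := e.equiv _ (Q.q γ)
  proj_q γ := by rw [e.proj_equiv, Q.proj_q]

theorem equiv_minusLift (e : Iso E E') (x : TorusPts Γ (Minus R)) :
    e.equiv R (E.minusLift R x) = E'.minusLift R x := by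
  refine IsMinusLift.unique ⟨?_, ?_, fun T _ ψ ↦ ?_⟩ (E'.isMinusLift_minusLift x)
  · rw [e.proj_equiv, (E.isMinusLift_minusLift x).proj_eq]
  · rw [← e.equiv_symm, (E.isMinusLift_minusLift x).symm_eq, map_inv]
  · rw [← e.nat, (E.isMinusLift_minusLift x).map_eq_one, map_one]

theorem equiv_lift (e : Iso E E') (x : LoopFac Γ R) :
    e.equiv R (Q.lift R x) = (Q.mapIso e).lift R x := by
  rw [lift, map_mul, map_mul, e.equiv_split, equiv_minusLift, qr, e.nat]
  rfl

/-- An isomorphism of extensions is determined by the images of the elements of a frame. -/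
theorem iso_ext {e e' : Iso E E'} (h : ∀ γ, e.equiv _ (Q.q γ) = e'.equiv _ (Q.q γ)) : e = e' := by
  refine Iso.ext (funext fun R ↦ MulEquiv.ext fun g ↦ E'.eq_of_locally ?_)
  refine (Q.locally_eq_lift g).mono fun S φ ⟨z, x, hx⟩ ↦ ?_
  have hQ : Q.mapIso e = Q.mapIso e' := by
    unfold mapIso
    congr 1
    exact funext h
  rw [← e.nat, ← e'.nat, hx, map_mul, map_mul, e.equiv_incl, e'.equiv_incl, equiv_lift, equiv_lift,
    hQ]

end Frame

end SymHeisExt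

/-! ### Contraction with a cotangent vector -/

section Cotangent

variable {k : Type u} [Field k]

theorem X_mem_maximalIdeal : (PowerSeries.X : k⟦X⟧) ∈ IsLocalRing.maximalIdeal k⟦X⟧ := by
  rw [PowerSeries.maximalIdeal_eq_span_X]
  exact Ideal.mem_span_singleton_self _

theorem mem_maximalIdeal_sq {f : k⟦X⟧} :
    f ∈ IsLocalRing.maximalIdeal k⟦X⟧ ^ 2 ↔
      PowerSeries.coeff 0 f = 0 ∧ PowerSeries.coeff 1 f = 0 := by
  rw [PowerSeries.maximalIdeal_eq_span_X, Ideal.span_singleton_pow, Ideal.mem_span_singleton,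
    PowerSeries.X_pow_dvd_iff]
  refine ⟨fun h ↦ ⟨h 0 (by norm_num), h 1 (by norm_num)⟩, fun h m hm ↦ ?_⟩
  interval_cases m
  exacts [h.1, h.2]

variable (k) in
/-- The cotangent vector `dt`. -/
def dt : {w : Cot k // w ≠ 0} :=
  ⟨(IsLocalRing.maximalIdeal k⟦X⟧).toCotangent ⟨PowerSeries.X, X_mem_maximalIdeal⟩, fun h ↦ by
    rw [Ideal.toCotangent_eq_zero, mem_maximalIdeal_sq, PowerSeries.coeff_one_X] at h
    exact one_ne_zero h.2⟩

theorem toCotangent_eq_smul_dt (τ : IsLocalRing.maximalIdeal k⟦X⟧) :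
    (IsLocalRing.maximalIdeal k⟦X⟧).toCotangent τ = PowerSeries.coeff 1 τ.1 • (dt k).1 := by
  obtain ⟨f, hf⟩ := τ
  have h : PowerSeries.constantCoeff f = 0 := by
    rwa [PowerSeries.maximalIdeal_eq_span_X, Ideal.mem_span_singleton, PowerSeries.X_dvd_iff] at hf
  rw [dt, ← algebraMap_smul k⟦X⟧ (PowerSeries.coeff 1 f), ← map_smul, Ideal.toCotangent_eq,
    mem_maximalIdeal_sq]
  simp [h]

theorem finrank_cot : Module.finrank k (Cot k) = 1 :=
  finrank_eq_one (dt k).1 (dt k).2 fun w ↦ by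
    obtain ⟨τ, rfl⟩ := Ideal.toCotangent_surjective _ w
    exact ⟨_, (toCotangent_eq_smul_dt τ).symm⟩

theorem exists_units_smul_eq (w w' : {w : Cot k // w ≠ 0}) :
    ∃ z : kˣ, w'.1 = (z : k) • w.1 := by
  obtain ⟨z, hz⟩ := (finrank_eq_one_iff_of_nonzero' w.1 w.2).1 finrank_cot w'.1
  have hz0 : z ≠ 0 := by
    rintro rfl
    exact w'.2 (by rw [← hz, zero_smul])
  exact ⟨Units.mk0 z hz0, hz.symm⟩

/-- The evaluation of elements of `ω^{⊗ n}` at a nonzero cotangent vector. -/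
def cotEval (n : ℤ) (w : {w : Cot k // w ≠ 0}) : cotPow k n ≃ₗ[k] k :=
  LinearEquiv.ofBijective ((LinearMap.proj w).comp (cotPow k n).subtype) <| by
    constructor
    · rw [← LinearMap.ker_eq_bot, LinearMap.ker_eq_bot']
      intro φ h
      refine Subtype.ext (funext fun w' ↦ ?_)
      obtain ⟨z, hz⟩ := exists_units_smul_eq w w'
      have h' : φ.1 w = 0 := h
      rw [φ.2 z w w' hz, h', mul_zero]
      rfl
    · intro x
      choose z hz using exists_units_smul_eq w
      have hu (y y' : kˣ) (h : (y : k) • w.1 = (y' : k) • w.1) : y = y' :=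
        Units.ext (smul_left_injective k w.2 h)
      refine ⟨⟨fun w' ↦ ((z w' ^ (-n) : kˣ) : k) * x, fun y w₁ w₂ h ↦ ?_⟩, ?_⟩
      · have : z w₂ = y * z w₁ := hu _ _ (by rw [← hz, h, hz w₁, smul_smul, Units.val_mul])
        change ((z w₂ ^ (-n) : kˣ) : k) * x = ((y ^ (-n) : kˣ) : k) * (((z w₁ ^ (-n) : kˣ) : k) * x)
        rw [this, mul_zpow, Units.val_mul, mul_assoc]
      · have : z w = 1 := hu _ _ (by rw [← hz, Units.val_one, one_smul])
        change ((z w ^ (-n) : kˣ) : k) * x = x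
        rw [this, one_zpow, Units.val_one, one_mul]

variable {V : Type*} [AddCommGroup V] [Module k V] {n : ℤ}

/-- Contraction with a nonzero cotangent vector, as an isomorphism. -/
def contractEquiv (n : ℤ) (w : {w : Cot k // w ≠ 0}) : V ⊗[k] cotPow k n ≃ₗ[k] V :=
  (TensorProduct.congr (LinearEquiv.refl k V) (cotEval n w)).trans (TensorProduct.rid k V)

theorem contractEquiv_apply (w : {w : Cot k // w ≠ 0}) (x : V ⊗[k] cotPow k n) :
    contractEquiv n w x = contract w x := rfl

@[simp] theorem contract_tmul (w : {w : Cot k // w ≠ 0}) (l : V) (φ : cotPow k n) :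
    contract w (l ⊗ₜ φ) = φ.1 w • l := by
  simp [contract]

theorem contract_injective (w : {w : Cot k // w ≠ 0}) :
    Function.Injective (contract (V := V) (n := n) w) := (contractEquiv n w).injective

/-- Homogeneity of degree `-n` in the cotangent vector. -/
theorem contract_smul (w w' : {w : Cot k // w ≠ 0}) (z : kˣ) (h : w'.1 = (z : k) • w.1)
    (x : V ⊗[k] cotPow k n) : contract w' x = ((z ^ (-n) : kˣ) : k) • contract w x := by
  induction x with
  | zero => simp
  | tmul l φ => rw [contract_tmul, contract_tmul, φ.2 z w w' h, mul_smul]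
  | add x y hx hy => rw [map_add, map_add, hx, hy, smul_add]

theorem contract_rTensor {V' : Type*} [AddCommGroup V'] [Module k V'] (e : V →ₗ[k] V')
    (w : {w : Cot k // w ≠ 0}) (x : V ⊗[k] cotPow k n) :
    contract w (e.rTensor (cotPow k n) x) = e (contract w x) := by
  induction x with
  | zero => simp
  | tmul l φ => simp
  | add x y hx hy => rw [map_add, map_add, hx, hy, map_add, map_add]

end Cotangent

/-! ### Structure constants of triples -/

section Coeff

variable {k : Type u} [Field k]

section

variable {ι : Type v} {V : ι → Type*} [∀ i, AddCommGroup (V i)] [∀ i, Module k (V i)]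
  (w : {w : Cot k // w ≠ 0}) (co : ∀ i, V i ≃ₗ[k] k)

theorem co_contract_castTw {i i' : ι} {n n' : ℤ} (hi : i = i') (hn : n = n')
    (x : Tw (k := k) V i n) :
    co i' (contract w (castTw hi hn x)) = co i (contract w x) := by
  subst hi hn
  rfl

theorem co_cast {i i' : ι} (hi : i = i') (l : V i) :
    co i' (cast (congrArg V hi) l) = co i l := by
  subst hi
  rfl

theorem tw_ext {i : ι} {n : ℤ} {x y : Tw (k := k) V i n}
    (h : co i (contract w x) = co i (contract w y)) : x = y :=
  contract_injective w ((co i).injective h)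

end

variable {Γ : Type v} [AddCommGroup Γ]

section

variable {c : LinearMap.BilinForm ℤ Γ} {V : Γ → Type*} [∀ γ, AddCommGroup (V γ)]
  [∀ γ, Module k (V γ)]
  (μ : ∀ γ₁ γ₂ : Γ, V γ₁ ⊗[k] V γ₂ ≃ₗ[k] Tw (k := k) V (γ₁ + γ₂) (c γ₁ γ₂))
  (w : {w : Cot k // w ≠ 0})

theorem contract_muTw (γ₁ γ₂ : Γ) (m : ℤ) (x : (V γ₁ ⊗[k] V γ₂) ⊗[k] cotPow k m) :
    contract w (muTw μ γ₁ γ₂ m x) = contract w (μ γ₁ γ₂ (contract w x)) := by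
  have key (y : Tw (k := k) V (γ₁ + γ₂) (c γ₁ γ₂)) (φ : cotPow k m) :
      contract w ((cotPowMul k (c γ₁ γ₂) m).lTensor (V (γ₁ + γ₂))
        (TensorProduct.assoc k (V (γ₁ + γ₂)) (cotPow k (c γ₁ γ₂)) (cotPow k m) (y ⊗ₜ φ))) =
        φ.1 w • contract w y := by
    induction y using TensorProduct.induction_on with
    | zero => simp
    | tmul l ψ =>
      rw [TensorProduct.assoc_tmul, LinearMap.lTensor_tmul, contract_tmul, contract_tmul, smul_smul,
        mul_comm]
      rfl
    | add y y' hy hy' => rw [add_tmul, map_add, map_add, map_add, hy, hy', map_add, smul_add]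
  induction x with
  | zero => simp
  | tmul l φ =>
    rw [contract_tmul, map_smul, map_smul]
    exact key _ _
  | add x y hx hy => simp only [map_add, hx, hy]

theorem contract_muLeft {γ₁ γ₂ γ₃ : Γ} (l₁ : V γ₁) (l₂ : V γ₂) (l₃ : V γ₃) :
    contract w (muLeft μ l₁ l₂ l₃) =
      contract w (μ (γ₁ + γ₂) γ₃ (contract w (μ γ₁ γ₂ (l₁ ⊗ₜ l₂)) ⊗ₜ l₃)) := by
  rw [muLeft, contract_muTw]
  congr 2
  induction μ γ₁ γ₂ (l₁ ⊗ₜ l₂) using TensorProduct.induction_on with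
  | zero => simp
  | tmul l φ => rw [TensorProduct.rightComm_tmul, contract_tmul, contract_tmul, smul_tmul']
  | add x y hx hy => rw [add_tmul, map_add, map_add, hx, hy, map_add, add_tmul]

theorem contract_muRight {γ₁ γ₂ γ₃ : Γ} (l₁ : V γ₁) (l₂ : V γ₂) (l₃ : V γ₃) :
    contract w (muRight μ l₁ l₂ l₃) =
      contract w (μ γ₁ (γ₂ + γ₃) (l₁ ⊗ₜ contract w (μ γ₂ γ₃ (l₂ ⊗ₜ l₃)))) := by
  rw [muRight, contract_muTw]
  congr 2
  induction μ γ₂ γ₃ (l₂ ⊗ₜ l₃) using TensorProduct.induction_on with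
  | zero => simp
  | tmul l φ => rw [TensorProduct.assoc_symm_tmul, contract_tmul, contract_tmul, tmul_smul]
  | add x y hx hy => rw [tmul_add, map_add, map_add, hx, hy, map_add, tmul_add]

end

/-- The properties (a), (b), (c) of a triple, in terms of the structure constants `m`, `s` of `μ`
and `σ` in some coordinates. -/
structure IsCoeff (c : LinearMap.BilinForm ℤ Γ) (m : Γ → Γ → kˣ) (s : Γ → kˣ) : Prop where
  assoc (γ₁ γ₂ γ₃ : Γ) : m γ₁ γ₂ * m (γ₁ + γ₂) γ₃ = m γ₂ γ₃ * m γ₁ (γ₂ + γ₃)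
  comm (γ₁ γ₂ : Γ) : m γ₁ γ₂ = (-1) ^ (c γ₁ γ₂ + c γ₁ γ₁ * c γ₂ γ₂) * m γ₂ γ₁
  sigma_sigma (γ : Γ) : s γ * s (-γ) = 1
  mu_sigma (γ₁ γ₂ : Γ) : m γ₁ γ₂ * s (γ₁ + γ₂) = s γ₁ * s γ₂ * m (-γ₁) (-γ₂)

theorem negOnePow_eq (a : ℤ) : (((a.negOnePow : ℤˣ) : ℤ) : k) = (((-1) ^ a : kˣ) : k) := by
  rcases Int.even_or_odd a with h | h
  · rw [Int.negOnePow_even _ h, h.neg_one_zpow]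
    simp
  · rw [Int.negOnePow_odd _ h, h.neg_one_zpow]
    simp

theorem sgn_eq (a b : ℤ) : ((sgn ((a : ZMod 2) * (b : ZMod 2)) : ℤ) : k) =
    (((-1) ^ (a * b) : kˣ) : k) := by
  rw [← Int.cast_mul, sgn]
  split_ifs with h
  · rw [ZMod.intCast_eq_zero_iff_even] at h
    rw [h.neg_one_zpow]
    simp
  · rw [ZMod.intCast_eq_zero_iff_even, Int.not_even_iff_odd] at h
    rw [h.neg_one_zpow]
    simp

variable {c : LinearMap.BilinForm ℤ Γ} {hc : ∀ x y, c x y = c y x} {V : Γ → Type*}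
  [∀ γ, AddCommGroup (V γ)] [∀ γ, Module k (V γ)] {par : Γ → ZMod 2}

/-- The data `μ`, `σ` have structure constants `m`, `s` with respect to a nonzero cotangent vector
and linear coordinates on the lines `V^γ`. -/
structure LineDatum.HasCoeff (D : LineDatum (k := k) c hc V par) (w : {w : Cot k // w ≠ 0})
    (co : ∀ γ, V γ ≃ₗ[k] k) (m : Γ → Γ → kˣ) (s : Γ → kˣ) : Prop where
  mu (γ₁ γ₂ : Γ) (l₁ : V γ₁) (l₂ : V γ₂) :
    co _ (contract w (D.mu γ₁ γ₂ (l₁ ⊗ₜ l₂))) = m γ₁ γ₂ * (co _ l₁ * co _ l₂)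
  sigma (γ : Γ) (l : V γ) : co _ (D.sigma γ l) = s γ * co _ l

theorem exists_smul_of_equiv (e : k ≃ₗ[k] k) : ∃ z : kˣ, ∀ x, e x = z * x := by
  have h : e 1 ≠ 0 := fun h ↦ one_ne_zero (e.injective (h.trans (map_zero e).symm))
  refine ⟨Units.mk0 _ h, fun x ↦ ?_⟩
  rw [← mul_one x, ← smul_eq_mul x, map_smul, smul_eq_mul, Units.val_mk0, smul_eq_mul]
  ring

theorem LineDatum.exists_hasCoeff (D : LineDatum (k := k) c hc V par) (w : {w : Cot k // w ≠ 0})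
    (co : ∀ γ, V γ ≃ₗ[k] k) : ∃ m s, D.HasCoeff w co m s := by
  have h1 (γ₁ γ₂ : Γ) : ∃ z : kˣ, ∀ l₁ l₂,
      co _ (contract w (D.mu γ₁ γ₂ (l₁ ⊗ₜ l₂))) = z * (co _ l₁ * co _ l₂) := by
    let f := ((TensorProduct.congr (co γ₁) (co γ₂)).trans (TensorProduct.rid k k))
    obtain ⟨z, hz⟩ := exists_smul_of_equiv
      (((f.symm.trans (D.mu γ₁ γ₂)).trans (contractEquiv _ w)).trans (co _))
    refine ⟨z, fun l₁ l₂ ↦ ?_⟩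
    have h2 : f (l₁ ⊗ₜ l₂) = co _ l₁ * co _ l₂ := by
      simp [f, mul_comm]
    rw [← h2, ← hz]
    simp [contractEquiv_apply]
  have h2 (γ : Γ) : ∃ z : kˣ, ∀ l, co _ (D.sigma γ l) = z * co _ l := by
    obtain ⟨z, hz⟩ := exists_smul_of_equiv (((co γ).symm.trans (D.sigma γ)).trans (co _))
    exact ⟨z, fun l ↦ by rw [← hz]; simp⟩
  choose m hm using h1
  choose s hs using h2
  exact ⟨m, s, hm, hs⟩

namespace LineDatum.HasCoeff

variable {D : LineDatum (k := k) c hc V par} {w : {w : Cot k // w ≠ 0}}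
  {co : ∀ γ, V γ ≃ₗ[k] k} {m : Γ → Γ → kˣ} {s : Γ → kˣ}

theorem isCoeff (H : D.HasCoeff w co m s) : IsCoeff c m s where
  assoc γ₁ γ₂ γ₃ := by
    have h := congrArg (fun x ↦ co _ (contract w x))
      (D.assoc γ₁ γ₂ γ₃ ((co _).symm 1) ((co _).symm 1) ((co _).symm 1))
    simp only [co_contract_castTw, contract_muLeft, contract_muRight, H.mu,
      LinearEquiv.apply_symm_apply, mul_one, one_mul] at h
    refine Units.ext ?_
    rw [Units.val_mul, Units.val_mul, mul_comm, h, mul_comm]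
  comm γ₁ γ₂ := by
    have h := congrArg (fun x ↦ co _ (contract w x))
      (D.comm γ₁ γ₂ ((co _).symm 1 ⊗ₜ (co _).symm 1))
    simp only [map_smul, co_contract_castTw, superComm, LinearMap.smul_apply,
      LinearEquiv.coe_coe, TensorProduct.comm_tmul, H.mu, smul_eq_mul,
      LinearEquiv.apply_symm_apply, mul_one, D.parity_eq, sgn_eq, negOnePow_eq] at h
    refine Units.ext ?_
    rw [h, zpow_add, Units.val_mul, Units.val_mul, mul_assoc]
  sigma_sigma γ := by
    have h := congrArg (co _) (D.sigma_sigma γ ((co _).symm 1))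
    rw [H.sigma, H.sigma, co_cast co (neg_neg γ).symm, LinearEquiv.apply_symm_apply, mul_one] at h
    refine Units.ext ?_
    rw [Units.val_mul, mul_comm, h, Units.val_one]
  mu_sigma γ₁ γ₂ := by
    have h := congrArg (fun x ↦ co _ (contract w x))
      (D.mu_sigma γ₁ γ₂ ((co _).symm 1) ((co _).symm 1))
    simp only [contract_rTensor, co_contract_castTw, LinearEquiv.coe_coe, H.mu, H.sigma,
      LinearEquiv.apply_symm_apply, mul_one] at h
    refine Units.ext ?_
    simp only [Units.val_mul]
    rw [mul_comm, h, mul_comm]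

/-- The data are determined by their structure constants. -/
theorem unique {D' : LineDatum (k := k) c hc V par} (H : D.HasCoeff w co m s)
    (H' : D'.HasCoeff w co m s) : D = D' := by
  refine LineDatum.ext (funext fun γ₁ ↦ funext fun γ₂ ↦ LinearEquiv.toLinearMap_injective
    (TensorProduct.ext' fun l₁ l₂ ↦ tw_ext w co ?_)) (funext fun γ ↦ LinearEquiv.ext fun l ↦
      (co _).injective ?_)
  · exact (H.mu _ _ _ _).trans (H'.mu _ _ _ _).symm
  · exact (H.sigma _ _).trans (H'.sigma _ _).symm

/-- Isomorphisms of lines that match the coordinates commute with the data exactly if the structure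
constants agree. -/
theorem isHom_iff {V' : Γ → Type*} [∀ γ, AddCommGroup (V' γ)] [∀ γ, Module k (V' γ)]
    {par' : Γ → ZMod 2} {D' : LineDatum (k := k) c hc V' par'} {co' : ∀ γ, V' γ ≃ₗ[k] k}
    {m' : Γ → Γ → kˣ} {s' : Γ → kˣ} (H : D.HasCoeff w co m s) (H' : D'.HasCoeff w co' m' s')
    {e : ∀ γ, V γ ≃ₗ[k] V' γ} (he : ∀ γ l, co' γ (e γ l) = co γ l) :
    D.IsHom D' e ↔ m = m' ∧ s = s' := by
  constructor
  · rintro ⟨h1, h2⟩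
    constructor
    · ext γ₁ γ₂
      have h := congrArg (fun x ↦ co' _ (contract w x)) (h1 γ₁ γ₂ ((co _).symm 1) ((co _).symm 1))
      simpa only [contract_rTensor, LinearEquiv.coe_coe, he, H.mu, H'.mu,
        LinearEquiv.apply_symm_apply, mul_one] using h
    · ext γ
      have h := congrArg (co' _) (h2 γ ((co _).symm 1))
      simpa only [he, H.sigma, H'.sigma, LinearEquiv.apply_symm_apply, mul_one] using h
  · rintro ⟨rfl, rfl⟩
    refine ⟨fun γ₁ γ₂ l₁ l₂ ↦ tw_ext w co' ?_, fun γ l ↦ (co' _).injective ?_⟩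
    · simp only [contract_rTensor, LinearEquiv.coe_coe, he, H.mu, H'.mu]
    · simp only [he, H.sigma, H'.sigma]

end LineDatum.HasCoeff

/-- The datum with given structure constants. -/
def LineDatum.ofCoeff (hpar : ∀ γ, par γ = (c γ γ : ZMod 2)) (w : {w : Cot k // w ≠ 0})
    (co : ∀ γ, V γ ≃ₗ[k] k) {m : Γ → Γ → kˣ} {s : Γ → kˣ} (H : IsCoeff c m s) :
    LineDatum (k := k) c hc V par := by
  let mu (γ₁ γ₂ : Γ) : V γ₁ ⊗[k] V γ₂ ≃ₗ[k] Tw (k := k) V (γ₁ + γ₂) (c γ₁ γ₂) :=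
    (((TensorProduct.congr (co γ₁) (co γ₂)).trans (TensorProduct.lid k k)).trans
      ((LinearEquiv.smulOfUnit (m γ₁ γ₂)).trans (co (γ₁ + γ₂)).symm)).trans
        (contractEquiv _ w).symm
  let sigma (γ : Γ) : V γ ≃ₗ[k] V (-γ) :=
    ((co γ).trans (LinearEquiv.smulOfUnit (s γ))).trans (co (-γ)).symm
  have hmu (γ₁ γ₂ : Γ) (l₁ : V γ₁) (l₂ : V γ₂) :
      co _ (contract w (mu γ₁ γ₂ (l₁ ⊗ₜ l₂))) = m γ₁ γ₂ * (co _ l₁ * co _ l₂) := by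
    rw [← contractEquiv_apply]
    simp [mu]
    rfl
  have hsigma (γ : Γ) (l : V γ) : co _ (sigma γ l) = s γ * co _ l := by
    simp [sigma]
    rfl
  exact
  { finrank_eq := fun γ ↦ by rw [(co γ).finrank_eq, Module.finrank_self]
    parity_eq := hpar
    mu := mu
    sigma := sigma
    assoc := fun γ₁ γ₂ γ₃ l₁ l₂ l₃ ↦ tw_ext w co <| by
      have h := congrArg Units.val (H.assoc γ₁ γ₂ γ₃)
      simp only [Units.val_mul] at h
      simp only [co_contract_castTw, contract_muLeft, contract_muRight, hmu]
      linear_combination (co _ l₁ * co _ l₂ * co _ l₃) * h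
    comm := fun γ₁ γ₂ l ↦ tw_ext w co <| by
      induction l with
      | zero => simp only [map_zero, map_smul, co_contract_castTw, smul_zero]
      | tmul l₁ l₂ =>
        have h := congrArg Units.val (H.comm γ₁ γ₂)
        simp only [zpow_add, Units.val_mul] at h
        simp only [map_smul, co_contract_castTw, superComm, LinearMap.smul_apply,
          LinearEquiv.coe_coe, TensorProduct.comm_tmul, hmu, smul_eq_mul, hpar, sgn_eq,
          negOnePow_eq, h]
        ring
      | add x y hx hy =>
        simp only [map_smul, co_contract_castTw, map_add, smul_add] at hx hy ⊢
        rw [hx, hy]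
    sigma_sigma := fun γ l ↦ (co _).injective <| by
      have h := congrArg Units.val (H.sigma_sigma γ)
      simp only [Units.val_mul, Units.val_one] at h
      rw [hsigma, hsigma, co_cast co (neg_neg γ).symm]
      linear_combination (co _ l) * h
    mu_sigma := fun γ₁ γ₂ l₁ l₂ ↦ tw_ext w co <| by
      have h := congrArg Units.val (H.mu_sigma γ₁ γ₂)
      simp only [Units.val_mul] at h
      simp only [contract_rTensor, co_contract_castTw, LinearEquiv.coe_coe, hmu, hsigma]
      linear_combination (co _ l₁ * co _ l₂) * h }

theorem LineDatum.hasCoeff_ofCoeff (hpar : ∀ γ, par γ = (c γ γ : ZMod 2))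
    (w : {w : Cot k // w ≠ 0}) (co : ∀ γ, V γ ≃ₗ[k] k) {m : Γ → Γ → kˣ} {s : Γ → kˣ}
    (H : IsCoeff c m s) :
    (LineDatum.ofCoeff (hc := hc) hpar w co H).HasCoeff w co m s where
  mu γ₁ γ₂ l₁ l₂ := by
    rw [← contractEquiv_apply]
    simp [LineDatum.ofCoeff]
    rfl
  sigma γ l := by
    simp [LineDatum.ofCoeff]
    rfl

/-- Coordinates can be chosen so that `m(0, 0) = 1`: multiply all of them by `m(0, 0)`. -/
theorem LineDatum.exists_hasCoeff_normalized (D : LineDatum (k := k) c hc V par)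
    (w : {w : Cot k // w ≠ 0}) : ∃ (co : ∀ γ, V γ ≃ₗ[k] k) (m : Γ → Γ → kˣ) (s : Γ → kˣ),
      D.HasCoeff w co m s ∧ m 0 0 = 1 := by
  have h (γ : Γ) : Nonempty (V γ ≃ₗ[k] k) := by
    have h := D.finrank_eq γ
    have := Module.finite_of_finrank_eq_succ h
    exact ⟨LinearEquiv.ofFinrankEq _ _ (by rw [h, Module.finrank_self])⟩
  let co₀ (γ : Γ) : V γ ≃ₗ[k] k := (h γ).some
  obtain ⟨m, s, H⟩ := D.exists_hasCoeff w co₀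
  refine ⟨fun γ ↦ (co₀ γ).trans (LinearEquiv.smulOfUnit (m 0 0)),
    fun γ₁ γ₂ ↦ m γ₁ γ₂ * (m 0 0)⁻¹, s, ⟨fun γ₁ γ₂ l₁ l₂ ↦ ?_, fun γ l ↦ ?_⟩, mul_inv_cancel _⟩
  · change (m 0 0 : k) * co₀ _ _ = _ * ((m 0 0 : k) * co₀ _ _ * ((m 0 0 : k) * co₀ _ _))
    rw [H.mu, Units.val_mul]
    linear_combination
      (-(m γ₁ γ₂ : k) * (m 0 0 : k) * co₀ _ l₁ * co₀ _ l₂) * (m 0 0).inv_mul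
  · change (m 0 0 : k) * co₀ _ _ = _ * ((m 0 0 : k) * co₀ _ _)
    rw [H.sigma]
    ring

end Coeff

/-! ### The lines of equivariant sections -/

theorem signUnit_const {R : Type*} [CommRing R] {s : LocallyConstant (PrimeSpectrum R) (ZMod 2)}
    {a : ℤ} (h : ∀ p, s p = (a : ZMod 2)) : signUnit s = (-1) ^ a := by
  rcases Int.even_or_odd a with ha | ha
  · rw [ha.neg_one_zpow]
    refine signUnit_zero fun p ↦ ?_
    rw [h, ZMod.intCast_eq_zero_iff_even]
    exact ha
  · rw [ha.neg_one_zpow]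
    refine signUnit_one fun p ↦ ?_
    rw [h]
    obtain ⟨b, rfl⟩ := ha
    have : ((2 : ℤ) : ZMod 2) = 0 := rfl
    rw [Int.cast_add, Int.cast_mul, this, zero_mul, zero_add, Int.cast_one]

theorem neg_one_zpow_inv {G : Type*} [Ring G] (n : ℤ) : (((-1 : Gˣ) ^ n)⁻¹) = (-1) ^ n := by
  rw [← inv_zpow, inv_neg, inv_one]

namespace SymHeisExt

variable {k : Type u} [Field k] {Γ : Type v} [AddCommGroup Γ] {c : LinearMap.BilinForm ℤ Γ}
  {E E' : SymHeisExt (k := k) c}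

variable (E) in
theorem lineParity_eq (γ : Γ) : E.lineParity γ = (c γ γ : ZMod 2) := by
  rw [lineParity, E.parity_eq, loopVal_expPt, ordAt_tUnit]
  simp

namespace Frame

variable (Q : Frame E) {R : CommAlgCat.{u} k}

section IsCoeff

variable [CharZero k]

/-- The commutator of `q(γ₁)` and `q(γ₂)`, since the symbol of `t` and `t` is `-1`. -/
theorem chi_q (γ₁ γ₂ : Γ) :
    E.chi (Q.q γ₁) (Q.q γ₂) = (-1) ^ (c γ₁ γ₂ + c γ₁ γ₁ * c γ₂ γ₂) := by
  have h := E.hasSymbol (Q.q γ₁) (Q.q γ₂)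
  unfold HasSymbol at h
  rw [Q.proj_q, Q.proj_q] at h
  rw [symLoop_t_t c (R := CommAlgCat.of k k), signUnit_const (a := c γ₁ γ₁ * c γ₂ γ₂),
    neg_one_zpow_inv] at h
  · rw [zpow_add, ← neg_one_zpow_inv (c γ₁ γ₁ * c γ₂ γ₂), eq_mul_inv_iff_mul_eq, mul_comm, h]
    simp
  · intro p
    rw [LocallyConstant.mul_apply, E.parity_eq, E.parity_eq, loopVal_expPt, loopVal_expPt,
      ordAt_tUnit]
    simp

/-- The structure constants of an extension have the properties (a), (b), (c). -/
theorem isCoeff : IsCoeff c Q.m Q.s where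
  assoc γ₁ γ₂ γ₃ := by
    refine E.incl_mul_cancel (R := CommAlgCat.of k k) (h := Q.q (γ₁ + γ₂ + γ₃)) ?_
    rw [map_mul, map_mul, mul_assoc, ← Q.q_mul, ← mul_assoc, ← Q.q_mul, add_assoc, mul_assoc,
      mul_assoc, ← Q.q_mul, ← incl_left_comm, ← Q.q_mul]
  comm γ₁ γ₂ := by
    refine E.incl_mul_cancel (R := CommAlgCat.of k k) (h := Q.q (γ₁ + γ₂)) ?_
    rw [← Q.q_mul, E.mul_eq_chi, chi_q, Q.q_mul, ← mul_assoc, ← map_mul, add_comm γ₂]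
  sigma_sigma γ := by
    refine E.incl_mul_cancel (R := CommAlgCat.of k k) (h := Q.q γ) ?_
    have h := E.symm_symm _ (Q.q γ)
    rw [Q.symm_q, map_mul, E.symm_incl, Q.symm_q, neg_neg, ← mul_assoc, ← map_mul] at h
    rw [h, map_one, one_mul]
  mu_sigma γ₁ γ₂ := by
    refine E.incl_mul_cancel (R := CommAlgCat.of k k) (h := Q.q (-(γ₁ + γ₂))) ?_
    have h := congrArg (E.symm _) (Q.q_mul γ₁ γ₂)
    rw [map_mul, map_mul, E.symm_incl, Q.symm_q, Q.symm_q, Q.symm_q, mul_assoc, incl_left_comm,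
      Q.q_mul, ← neg_add, ← mul_assoc, ← mul_assoc, ← mul_assoc, ← map_mul, ← map_mul,
      ← map_mul] at h
    exact h.symm

end IsCoeff

theorem exists_of_over {γ : Γ} (h : E.Over (-γ) R) :
    ∃ z b, h.1 = E.incl R z * (Q.qr R γ * E.split R b) := by
  obtain ⟨b, hb⟩ := h.2
  obtain ⟨z, hz⟩ := E.exists_incl_mul (h := Q.qr R γ * E.split R b) (h' := h.1)
    (by rw [hb, map_mul, Q.proj_qr, E.proj_split])
  exact ⟨z, b, hz⟩

theorem over_unique [Module.Free ℤ Γ] [Module.Finite ℤ Γ] {γ : Γ} {z z' : (R : Type u)ˣ}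
    {b b' : Arc Γ R} (h : E.incl R z * (Q.qr R γ * E.split R b) =
      E.incl R z' * (Q.qr R γ * E.split R b')) : z = z' := by
  have h' := congrArg (E.proj R) h
  simp only [map_mul, proj_incl, one_mul, Q.proj_qr, E.proj_split, mul_right_inj] at h'
  rw [arcToLoop_injective h'] at h
  exact E.incl_mul_cancel h

/-- The point `q(γ)` over `t^{-γ}`. -/
def qOver (γ : Γ) : E.Over (-γ) (CommAlgCat.of k k) :=
  ⟨Q.q γ, 1, by rw [Q.proj_q, map_one, mul_one]⟩

/-- An equivariant section is determined by its value at `q(γ)`. -/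
theorem line_apply {γ : Γ} (l : E.line γ) (h : E.Over (-γ) R) (z : (R : Type u)ˣ) (b : Arc Γ R)
    (e : h.1 = E.incl R z * (Q.qr R γ * E.split R b)) :
    l.1 R h = ((z⁻¹ : (R : Type u)ˣ) : R) * algebraMap k R (l.1 _ (Q.qOver γ)) := by
  obtain ⟨h1, h2, h3⟩ := l.2
  have m1 : E.proj R (Q.qr R γ) ∈ redComp (-γ) R := ⟨1, by rw [Q.proj_qr, map_one, mul_one]⟩
  have m2 : E.proj R (Q.qr R γ * E.split R b) ∈ redComp (-γ) R :=
    ⟨b, by rw [map_mul, Q.proj_qr, E.proj_split]⟩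
  rw [h2 R z ⟨_, m2⟩ h e, h3 R b ⟨_, m1⟩ ⟨_, m2⟩ rfl, h1 _ R (base R) (Q.qOver γ) ⟨_, m1⟩ rfl]
  rfl

variable [Module.Free ℤ Γ] [Module.Finite ℤ Γ]

/-- The coordinate on the line `λ^γ`: the value of sections at `q(γ)`. -/
def co (γ : Γ) : E.line γ ≃ₗ[k] k :=
  LinearEquiv.ofBijective
    { toFun := fun l ↦ l.1 (CommAlgCat.of k k) (Q.qOver γ)
      map_add' := fun _ _ ↦ rfl
      map_smul' := fun _ _ ↦ rfl } <| by
    constructor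
    · intro l l' h
      refine Subtype.ext (funext fun R ↦ funext fun g ↦ ?_)
      obtain ⟨z, b, e⟩ := Q.exists_of_over g
      rw [Q.line_apply l g z b e, Q.line_apply l' g z b e]
      exact congrArg (fun x ↦ _ * algebraMap k R x) h
    · intro x
      choose z b e using fun R ↦ Q.exists_of_over (R := R) (γ := γ)
      have hz (R : CommAlgCat.{u} k) (g : E.Over (-γ) R) (z' b')
          (h : g.1 = E.incl R z' * (Q.qr R γ * E.split R b')) : z R g = z' :=
        Q.over_unique ((e R g).symm.trans h)
      refine ⟨⟨fun R g ↦ (((z R g)⁻¹ : (R : Type u)ˣ) : R) * algebraMap k R x,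
        fun R S φ g g' h ↦ ?_, fun R y g g' h ↦ ?_, fun R y g g' h ↦ ?_⟩, ?_⟩
      · change (((z S g')⁻¹ : (S : Type u)ˣ) : S) * _ =
          φ.hom ((((z R g)⁻¹ : (R : Type u)ˣ) : R) * _)
        rw [hz S g' (Units.map (φ.hom : R →* S) (z R g)) (arcMap Γ (φ.hom : R →+* S) (b R g))
          (by rw [h, e R g, map_mul, map_mul, E.incl_nat, Q.map_qr, E.split_nat]), ← map_inv,
          map_mul, AlgHom.commutes]
        rfl
      · change (((z R g')⁻¹ : (R : Type u)ˣ) : R) * _ = _ * ((((z R g)⁻¹ : (R : Type u)ˣ) : R) * _)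
        rw [hz R g' (y * z R g) (b R g) (by rw [h, map_mul, mul_assoc, ← e R g]), mul_inv,
          Units.val_mul, mul_assoc]
      · change (((z R g')⁻¹ : (R : Type u)ˣ) : R) * _ = (((z R g)⁻¹ : (R : Type u)ˣ) : R) * _
        rw [hz R g' (z R g) (b R g * y)
          (by rw [h, map_mul, ← mul_assoc (Q.qr R γ), ← mul_assoc, ← e R g])]
      · change (((z _ (Q.qOver γ))⁻¹ : kˣ) : k) * x = x
        rw [hz _ (Q.qOver γ) 1 1 (by rw [map_one, map_one, one_mul, mul_one, Q.qr_self]; rfl),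
          inv_one, Units.val_one, one_mul]

theorem line_eq_co {γ : Γ} (l : E.line γ) (h : E.Over (-γ) R) (z : (R : Type u)ˣ) (b : Arc Γ R)
    (e : h.1 = E.incl R z * (Q.qr R γ * E.split R b)) :
    l.1 R h = ((z⁻¹ : (R : Type u)ˣ) : R) * algebraMap k R (Q.co γ l) :=
  Q.line_apply l h z b e

variable {hc : ∀ x y, c x y = c y x}

/-- The conditions that characterize the canonical data, at `τ = t`, determine the structure
constants. -/
theorem hasCoeff_of_isCanonical {D : LineDatum (k := k) c hc (fun γ ↦ E.line γ) E.lineParity}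
    (H : E.IsCanonical D) : D.HasCoeff (dt k) Q.co Q.m Q.s where
  mu γ₁ γ₂ l₁ l₂ := by
    have hm : E.proj (CommAlgCat.of k k) (Q.q γ₁ * Q.q γ₂) ∈ redComp (-(γ₁ + γ₂)) k :=
      ⟨1, by rw [map_mul, Q.proj_q, Q.proj_q, map_one, mul_one, neg_add, expPt_add]⟩
    have h := H.1 ⟨PowerSeries.X, X_mem_maximalIdeal⟩ (dt k).2 (tUnit k)
      (HahnSeries.ofPowerSeries_X).symm γ₁ γ₂ l₁ l₂ (Q.qOver γ₁) (Q.qOver γ₂) ⟨_, hm⟩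
      (Q.proj_q γ₁) (Q.proj_q γ₂) rfl
    rw [Q.line_eq_co (R := CommAlgCat.of k k) _ ⟨_, hm⟩ (Q.m γ₁ γ₂) 1
      (by rw [map_one, mul_one, Q.qr_self]; exact Q.q_mul γ₁ γ₂)] at h
    change _ = Q.co _ l₁ * Q.co _ l₂ at h
    rw [← h]
    exact (Units.mul_inv_cancel_left (Q.m γ₁ γ₂) _).symm
  sigma γ l := by
    have hm : E.proj (CommAlgCat.of k k) (E.symm _ (Q.q γ)) ∈ redComp (-(-γ)) k :=
      ⟨1, by rw [E.proj_symm, Q.proj_q, map_one, mul_one, ← expPt_neg]⟩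
    have h := H.2 γ l (CommAlgCat.of k k) (Q.qOver γ) ⟨_, hm⟩ rfl
    rw [Q.line_eq_co (R := CommAlgCat.of k k) _ ⟨_, hm⟩ (Q.s γ) 1
      (by rw [map_one, mul_one, Q.qr_self]; exact Q.symm_q γ)] at h
    change _ = Q.co _ l at h
    rw [← h]
    exact (Units.mul_inv_cancel_left (Q.s γ) _).symm

variable [CharZero k]

/-- The conditions that characterize the canonical data hold at every parameter `τ` if they hold
at `t`. -/
theorem isCanonical_of_hasCoeff {D : LineDatum (k := k) c hc (fun γ ↦ E.line γ) E.lineParity}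
    (H : D.HasCoeff (dt k) Q.co Q.m Q.s) : E.IsCanonical D := by
  constructor
  · intro τ hτ f hf γ₁ γ₂ l₁ l₂ h₁ h₂ h₁₂ e₁ e₂ e₁₂
    -- `τ = t u` for a unit `u`, and `dτ = u(0) dt`
    obtain ⟨τ, hτm⟩ := τ
    obtain ⟨g, rfl⟩ : (PowerSeries.X : k⟦X⟧) ∣ τ := by
      rwa [PowerSeries.maximalIdeal_eq_span_X, Ideal.mem_span_singleton] at hτm
    have hdτ := toCotangent_eq_smul_dt ⟨PowerSeries.X * g, hτm⟩
    have hg : PowerSeries.coeff 1 (PowerSeries.X * g) = PowerSeries.constantCoeff g := by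
      rw [PowerSeries.coeff_succ_X_mul 0, PowerSeries.coeff_zero_eq_constantCoeff_apply]
    rw [hg] at hdτ
    have hg0 : PowerSeries.constantCoeff g ≠ 0 := fun h0 ↦ hτ (by rw [hdτ, h0, zero_smul])
    obtain ⟨u, rfl⟩ : IsUnit g :=
      PowerSeries.isUnit_iff_constantCoeff.2 (isUnit_iff_ne_zero.2 hg0)
    have hfu : f = tUnit k * arcUnit k u := Units.ext (by
      rw [hf, map_mul, HahnSeries.ofPowerSeries_X]
      rfl)
    have hcontr := contract_smul (dt k) ⟨_, hτ⟩ (constUnit k u) hdτ (D.mu γ₁ γ₂ (l₁ ⊗ₜ l₂))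
    let b (γ : Γ) : Arc Γ k := expPt u (-γ)
    have hfb (γ : Γ) : expPt f (-γ) = expPt (tUnit k) (-γ) * arcToLoop Γ k (b γ) := by
      rw [hfu, expPt_mul]
      rfl
    have hq (γ : Γ) (h : E.Over (-γ) (CommAlgCat.of k k)) (e : E.proj _ h.1 = expPt f (-γ)) :
        ∃ z, h.1 = E.incl (CommAlgCat.of k k) z *
          (Q.qr (CommAlgCat.of k k) γ * E.split (CommAlgCat.of k k) (b γ)) :=
      E.exists_incl_mul (by rw [e, hfb, map_mul, Q.proj_qr, E.proj_split])
    obtain ⟨z₁, hz₁⟩ := hq γ₁ h₁ e₁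
    obtain ⟨z₂, hz₂⟩ := hq γ₂ h₂ e₂
    have hhalf : halfLoop c (CommAlgCat.of k k) (arcToLoop Γ k (b γ₁)) (expPt (tUnit k) (-γ₂)) =
        constUnit k u ^ c γ₁ γ₂ := by
      have h1 := symLoop_arc_t c (R := CommAlgCat.of k k) (b γ₁) (-γ₂)
      rw [← h1]
      have h2 := symbol_arc_t (R := CommAlgCat.of k k) u 1
      rw [zpow_one, zpow_one] at h2
      change symbol (CommAlgCat.of k k) (arcUnit k u) (tUnit k) ^ c (-γ₁) (-γ₂) = _
      rw [h2]
      simp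
    have hz₁₂ : h₁₂.1 = E.incl (CommAlgCat.of k k)
        (z₁ * z₂ * ((constUnit k u ^ c γ₁ γ₂)⁻¹ * Q.m γ₁ γ₂)) *
          (Q.qr (CommAlgCat.of k k) (γ₁ + γ₂) * E.split (CommAlgCat.of k k) (b γ₁ * b γ₂)) := by
      have h1 := Q.split_mul_qr (R := CommAlgCat.of k k) (b γ₁) γ₂
      have h2 : kUnit (CommAlgCat.of k k) (Q.m γ₁ γ₂) = Q.m γ₁ γ₂ := Units.ext rfl
      have h3 := Q.qr_mul (R := CommAlgCat.of k k) γ₁ γ₂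
      rw [hhalf] at h1
      rw [h2] at h3
      rw [e₁₂, hz₁, hz₂, mul_assoc, incl_left_comm, mul_assoc (Q.qr _ γ₁),
        ← mul_assoc (E.split (CommAlgCat.of k k) (b γ₁)) (Q.qr _ γ₂), h1,
        mul_assoc (E.incl _ _) (_ * _), E.incl_left_comm _ (Q.qr _ γ₁), mul_assoc (Q.qr _ γ₂),
        ← mul_assoc (Q.qr _ γ₁), h3]
      simp only [map_mul, mul_assoc]
    rw [Q.line_eq_co _ h₁ z₁ _ hz₁, Q.line_eq_co _ h₂ z₂ _ hz₂, Q.line_eq_co _ h₁₂ _ _ hz₁₂,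
      hcontr, map_smul, H.mu]
    simp only [mul_inv, inv_inv, zpow_neg, Units.val_mul, smul_eq_mul]
    change _ * ((((constUnit k u ^ c γ₁ γ₂)⁻¹ : kˣ) : k) * _) =
      ((z₁⁻¹ : kˣ) : k) * _ * (((z₂⁻¹ : kˣ) : k) * _)
    linear_combination (((z₁⁻¹ : kˣ) : k) * ((z₂⁻¹ : kˣ) : k) * (Q.co γ₁ l₁ * Q.co γ₂ l₂)) *
      ((((Q.m γ₁ γ₂)⁻¹ : kˣ) : k) * (Q.m γ₁ γ₂ : k) * (constUnit k u ^ c γ₁ γ₂).mul_inv +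
        (Q.m γ₁ γ₂).inv_mul)
  · intro γ l R h h' e
    obtain ⟨z, b, hz⟩ := Q.exists_of_over h
    rw [Q.line_eq_co l h z b hz, Q.line_eq_co _ h' (z * kUnit R (Q.s γ)) b⁻¹, H.sigma, mul_inv,
      Units.val_mul, map_mul, mul_assoc]
    · congr 1
      exact Units.inv_mul_cancel_left (kUnit R (Q.s γ)) _
    · rw [e, hz, map_mul, map_mul, E.symm_incl, Q.symm_qr, E.symm_split, map_mul]
      simp only [mul_assoc]

end Frame

theorem Frame.mapIso_m (Q : Frame E) (e : Iso E E') : (Q.mapIso e).m = Q.m := by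
  ext γ₁ γ₂ : 2
  refine E'.incl_mul_cancel (R := CommAlgCat.of k k) (h := (Q.mapIso e).q (γ₁ + γ₂)) ?_
  rw [← Frame.q_mul]
  simp only [Frame.mapIso]
  rw [← map_mul, Q.q_mul, map_mul, e.equiv_incl]

theorem Frame.mapIso_s (Q : Frame E) (e : Iso E E') : (Q.mapIso e).s = Q.s := by
  ext γ : 1
  refine E'.incl_mul_cancel (R := CommAlgCat.of k k) (h := (Q.mapIso e).q (-γ)) ?_
  rw [← Frame.symm_q]
  simp only [Frame.mapIso]
  rw [← e.equiv_symm, Q.symm_q, map_mul, e.equiv_incl]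

/-- The frame `z(γ) q(γ)`. -/
def Frame.rescale (Q : Frame E) (z : Γ → kˣ) : Frame E where
  q γ := E.incl (CommAlgCat.of k k) (z γ) * Q.q γ
  proj_q γ := by rw [map_mul, proj_incl, one_mul, Q.proj_q]

variable [Module.Free ℤ Γ] [Module.Finite ℤ Γ]

theorem Frame.mapIso_co (Q : Frame E) (e : Iso E E') {γ : Γ} (l : E.line γ) :
    (Q.mapIso e).co γ (e.lineEquiv γ l) = Q.co γ l :=
  congrArg (l.1 _) (Subtype.ext ((e.equiv _).symm_apply_apply (Q.q γ)))

theorem Frame.rescale_co (Q : Frame E) (z : Γ → kˣ) {γ : Γ} (l : E.line γ) :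
    (Q.rescale z).co γ l = ((z γ)⁻¹ : kˣ) * Q.co γ l :=
  Q.line_eq_co (R := CommAlgCat.of k k) l _ (z γ) 1
    (by rw [map_one, mul_one, Q.qr_self]; rfl)

section

variable [CharZero k]

variable (E) in
/-- The canonical data `μ`, `σ` on the lines of an extension. -/
def lineDatum (hc : ∀ x y, c x y = c y x) :
    LineDatum (k := k) c hc (fun γ ↦ E.line γ) E.lineParity :=
  LineDatum.ofCoeff E.lineParity_eq (dt k) E.frame.co E.frame.isCoeff

variable {hc : ∀ x y, c x y = c y x}

theorem isCanonical_lineDatum : E.IsCanonical (E.lineDatum hc) :=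
  E.frame.isCanonical_of_hasCoeff (LineDatum.hasCoeff_ofCoeff ..)

theorem isCanonical_iff {D : LineDatum (k := k) c hc (fun γ ↦ E.line γ) E.lineParity} :
    E.IsCanonical D ↔ D = E.lineDatum hc :=
  ⟨fun H ↦ (E.frame.hasCoeff_of_isCanonical H).unique
    (E.frame.hasCoeff_of_isCanonical isCanonical_lineDatum), fun h ↦ h ▸ isCanonical_lineDatum⟩

theorem Frame.hasCoeff (Q : Frame E) : (E.lineDatum hc).HasCoeff (dt k) Q.co Q.m Q.s :=
  Q.hasCoeff_of_isCanonical isCanonical_lineDatum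

/-- Isomorphisms of extensions are compatible with the canonical data. -/
theorem isHom_lineEquiv (e : Iso E E') : (E.lineDatum hc).IsHom (E'.lineDatum hc) e.lineEquiv :=
  ((E.frame.hasCoeff).isHom_iff (E.frame.mapIso e).hasCoeff
    fun _ l ↦ E.frame.mapIso_co e l).2 ⟨(E.frame.mapIso_m e).symm, (E.frame.mapIso_s e).symm⟩

/-- An isomorphism of extensions is determined by its action on sections. -/
theorem iso_ext_of_lineEquiv {e e' : Iso E E'} (h : e.lineEquiv = e'.lineEquiv) : e = e' := by
  refine E.frame.iso_ext fun γ ↦ ?_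
  -- the values of the sections at `q(γ)` determine `q(γ)`
  obtain ⟨z, hz⟩ := E'.exists_incl_mul (R := CommAlgCat.of k k) (h := e.equiv _ (E.frame.q γ))
    (h' := e'.equiv _ (E.frame.q γ)) (by rw [e.proj_equiv, e'.proj_equiv])
  have h2 : (E.frame.mapIso e').co γ (e'.lineEquiv γ ((E.frame.co γ).symm 1)) =
      ((z⁻¹ : kˣ) : k) * (E.frame.mapIso e).co γ (e'.lineEquiv γ ((E.frame.co γ).symm 1)) :=
    (E.frame.mapIso e).line_eq_co (R := CommAlgCat.of k k)
      (e'.lineEquiv γ ((E.frame.co γ).symm 1)) ((E.frame.mapIso e').qOver γ) z 1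
      (by rw [map_one, mul_one, Frame.qr_self]; exact hz)
  rw [Frame.mapIso_co, ← h, Frame.mapIso_co, LinearEquiv.apply_symm_apply, mul_one] at h2
  have hz1 : z = 1 := inv_eq_one.1 (Units.ext h2.symm)
  rw [hz, hz1, map_one, one_mul]

/-- Each isomorphism of triples comes from an isomorphism of extensions. -/
theorem exists_lineEquiv_eq (f : ∀ γ, E.line γ ≃ₗ[k] E'.line γ)
    (hf : (E.lineDatum hc).IsHom (E'.lineDatum hc) f) : ∃ e : Iso E E', e.lineEquiv = f := by
  have h (γ : Γ) : ∃ z : kˣ, ∀ l, E'.frame.co γ (f γ l) = z * E.frame.co γ l := by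
    obtain ⟨z, hz⟩ := exists_smul_of_equiv
      (((E.frame.co γ).symm.trans (f γ)).trans (E'.frame.co γ))
    exact ⟨z, fun l ↦ by rw [← hz]; simp⟩
  choose z hz using h
  have hco (γ : Γ) (l : E.line γ) : (E'.frame.rescale z).co γ (f γ l) = E.frame.co γ l := by
    rw [Frame.rescale_co, hz]
    exact Units.inv_mul_cancel_left (z γ) _
  obtain ⟨hm, hs⟩ := ((E.frame.hasCoeff).isHom_iff (E'.frame.rescale z).hasCoeff hco).1 hf
  let e := Frame.iso E.frame (E'.frame.rescale z) hm hs
  have he : E.frame.mapIso e = E'.frame.rescale z := by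
    unfold Frame.mapIso
    congr 1
    exact funext fun γ ↦ Frame.iso_q E.frame (E'.frame.rescale z) hm hs γ
  refine ⟨e, funext fun γ ↦ LinearEquiv.ext fun l ↦ ((E'.frame.rescale z).co γ).injective ?_⟩
  rw [hco, ← he, Frame.mapIso_co]

end

end SymHeisExt

/-! ### Units given by locally constant functions -/

section ConstUnits

variable {k : Type u} [Field k] {R S : CommAlgCat.{u} k}

theorem comap_awayHom_notMem (r : R) (p : PrimeSpectrum (Localization.Away r)) :
    r ∉ (PrimeSpectrum.comap ((awayHom R r).hom : R →+* Localization.Away r) p).asIdeal := fun h ↦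
  p.2.ne_top (Ideal.eq_top_of_isUnit_mem _ h (isUnit_awayHom R r))

theorem exists_comap_awayHom {r : R} {p : PrimeSpectrum R} (hr : r ∉ p.asIdeal) :
    ∃ p', PrimeSpectrum.comap ((awayHom R r).hom : R →+* Localization.Away r) p' = p := by
  have h := PrimeSpectrum.localization_away_comap_range (Localization.Away r) r
  have hp : p ∈ (PrimeSpectrum.basicOpen r : Set (PrimeSpectrum R)) := hr
  rw [← h] at hp
  exact hp

/-- A locally constant function on `Spec R` is constant Zariski-locally. -/
theorem locally_isConst {X : Type*} (F : LocallyConstant (PrimeSpectrum R) X) :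
    Locally R fun S φ ↦ ∃ x, ∀ p : PrimeSpectrum S,
      F (PrimeSpectrum.comap (φ.hom : R →+* S) p) = x := fun p ↦ by
  obtain ⟨_, ⟨r, rfl⟩, hp, hr⟩ :=
    PrimeSpectrum.isTopologicalBasis_basic_opens.exists_subset_of_mem_open
      (show p ∈ F ⁻¹' {F p} from rfl) (F.isLocallyConstant.isOpen_fiber (F p))
  exact ⟨r, hp, F p, fun p' ↦ hr (comap_awayHom_notMem r p')⟩

theorem stable_const {X : Type*} (F : LocallyConstant (PrimeSpectrum R) X) :
    Stable R fun S φ ↦ ∃ x, ∀ p : PrimeSpectrum S,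
      F (PrimeSpectrum.comap (φ.hom : R →+* S) p) = x := by
  rintro S T φ ψ ⟨x, hx⟩
  exact ⟨x, fun p ↦ hx (PrimeSpectrum.comap (ψ.hom : S →+* T) p)⟩

theorem exists_constUnits (F : LocallyConstant (PrimeSpectrum R) kˣ) : ∃ z : (R : Type u)ˣ,
    ∀ ⦃S : CommAlgCat.{u} k⦄ (φ : R ⟶ S) (x : kˣ),
      (∀ p : PrimeSpectrum S, F (PrimeSpectrum.comap (φ.hom : R →+* S) p) = x) →
        Units.map (φ.hom : R →* S) z = kUnit S x := by
  have h := (unitsSheaf k).exists_of_local R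
    (fun S φ z ↦ ∃ x, (∀ p : PrimeSpectrum S, F (PrimeSpectrum.comap (φ.hom : R →+* S) p) = x) ∧
      z = kUnit S x)
    (by
      rintro S T φ ψ _ ⟨x, hx, rfl⟩
      exact ⟨x, fun p ↦ hx (PrimeSpectrum.comap (ψ.hom : S →+* T) p), map_kUnit ψ x⟩)
    (by
      rintro S φ _ _ ⟨x, hx, rfl⟩ ⟨y, hy, rfl⟩
      rcases subsingleton_or_nontrivial S with hS | hS
      · exact Units.ext (Subsingleton.elim _ _)
      · obtain ⟨p⟩ : Nonempty (PrimeSpectrum S) := inferInstance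
        rw [← hx p, hy p])
    ((locally_isConst F).mono fun S φ ⟨x, hx⟩ ↦ ⟨_, x, hx, rfl⟩)
  exact ⟨h.choose, fun S φ x hx ↦ h.choose_spec.1 φ _ ⟨x, hx, rfl⟩⟩

/-- The unit of `R` given by a locally constant function on `Spec R` with values in `kˣ`. -/
def constUnits (R : CommAlgCat.{u} k) :
    LocallyConstant (PrimeSpectrum R) kˣ →* (R : Type u)ˣ :=
  MonoidHom.mk' (fun F ↦ (exists_constUnits F).choose) fun F G ↦ by
    refine (unitsSheaf k).sep R _ _ (((locally_isConst F).and (stable_const F) (locally_isConst G)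
      (stable_const G)).mono ?_)
    rintro S φ ⟨⟨x, hx⟩, y, hy⟩
    change Units.map (φ.hom : R →* S) _ = Units.map (φ.hom : R →* S) _
    rw [map_mul, (exists_constUnits F).choose_spec φ x hx,
      (exists_constUnits G).choose_spec φ y hy, (exists_constUnits (F * G)).choose_spec φ (x * y)
        (fun p ↦ by rw [LocallyConstant.mul_apply, hx, hy]), map_mul]

theorem map_constUnits_of_const {F : LocallyConstant (PrimeSpectrum R) kˣ} (φ : R ⟶ S) {x : kˣ}
    (h : ∀ p : PrimeSpectrum S, F (PrimeSpectrum.comap (φ.hom : R →+* S) p) = x) :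
    Units.map (φ.hom : R →* S) (constUnits R F) = kUnit S x :=
  (exists_constUnits F).choose_spec φ x h

theorem constUnits_of_const {F : LocallyConstant (PrimeSpectrum R) kˣ} {x : kˣ}
    (h : ∀ p, F p = x) : constUnits R F = kUnit R x := by
  have := map_constUnits_of_const (F := F) (𝟙 R) (x := x) fun p ↦ h _
  rw [← this]
  rfl

theorem map_constUnits {F : LocallyConstant (PrimeSpectrum R) kˣ}
    {G : LocallyConstant (PrimeSpectrum S) kˣ} (φ : R ⟶ S)
    (h : ∀ p, G p = F (PrimeSpectrum.comap (φ.hom : R →+* S) p)) :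
    Units.map (φ.hom : R →* S) (constUnits R F) = constUnits S G := by
  refine (unitsSheaf k).sep S _ _ (((locally_isConst F).comp (stable_const F) φ).mono ?_)
  rintro T ψ ⟨x, hx⟩
  have h2 : Units.map (ψ.hom : S →* T) (constUnits S G) = kUnit T x :=
    map_constUnits_of_const ψ fun p ↦ by rw [h]; exact hx p
  exact (map_constUnits_of_const (φ ≫ ψ) hx).trans h2.symm

theorem signUnit_eq_constUnits {s : LocallyConstant (PrimeSpectrum R) (ZMod 2)}
    (n : LocallyConstant (PrimeSpectrum R) ℤ) (h : ∀ p, s p = (n p : ZMod 2)) :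
    signUnit s = constUnits R (n.map fun n ↦ (-1) ^ n) := by
  refine (unitsSheaf k).sep R _ _ ((locally_isConst n).mono ?_)
  rintro S φ ⟨x, hx⟩
  change Units.map (φ.hom : R →* S) _ = Units.map (φ.hom : R →* S) _
  rw [map_constUnits_of_const φ (x := (-1) ^ x) fun p ↦ by rw [LocallyConstant.map_apply,
    Function.comp_apply, hx]]
  have := signUnit_map (φ.hom : R →+* S) (s := s)
    (s' := LocallyConstant.const _ (x : ZMod 2)) fun p ↦ by
      rw [h, hx]
      rfl
  refine this.trans ?_
  rw [signUnit_const (a := x) fun p ↦ rfl, map_zpow]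
  congr 1
  ext
  simp [kUnit]

end ConstUnits

/-! ### The degree of a point of the loop group -/

section LoopDeg

theorem stable_exists_fac {k : Type u} [Field k] {R : CommAlgCat.{u} k} (f : ((R : Type u)⸨X⸩)ˣ) :
    Stable R fun S φ ↦ ∃ x : Fac S, facVal S x = laurentUnits (φ.hom : R →+* S) f := by
  rintro S T φ ψ ⟨x, hx⟩
  refine ⟨facMap (ψ.hom : S →+* T) x, ?_⟩
  rw [facVal_facMap, hx]
  rfl

variable {k : Type u} [Field k] [CharZero k] {Γ : Type v} [AddCommGroup Γ] {R S : CommAlgCat.{u} k}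

/-- The locally constant function `γ` on `Spec R`, for a point of the loop group that lies
in the component of `t^{-γ}`. -/
def loopDeg (a : Loop Γ R) : LocallyConstant (PrimeSpectrum R) Γ where
  toFun p := -loopVal p a
  isLocallyConstant := by
    refine (IsLocallyConstant.iff_exists_open _).2 fun p ↦ ?_
    obtain ⟨r, hr, x, hx⟩ := locally_exists_loopFac a p
    refine ⟨PrimeSpectrum.basicOpen r, (PrimeSpectrum.basicOpen r).2, hr, fun p' hp' ↦ ?_⟩
    have key (p' : PrimeSpectrum R) (hp' : r ∉ p'.asIdeal) : -loopVal p' a = x.1.toAdd := by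
      obtain ⟨q, rfl⟩ := exists_comap_awayHom hp'
      rw [← loopVal_loopMap, ← hx, loopVal_loopFacVal, neg_neg]
    rw [key p' hp', key p hr]

theorem loopDeg_apply (a : Loop Γ R) (p : PrimeSpectrum R) : loopDeg a p = -loopVal p a := rfl

theorem loopDeg_mul (a b : Loop Γ R) (p : PrimeSpectrum R) :
    loopDeg (a * b) p = loopDeg a p + loopDeg b p := by
  rw [loopDeg_apply, loopVal_mul, neg_add]
  rfl

@[simp] theorem loopDeg_one (p : PrimeSpectrum R) : loopDeg (1 : Loop Γ R) p = 0 := by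
  rw [loopDeg_apply, loopVal_one, neg_zero]

theorem loopDeg_inv (a : Loop Γ R) (p : PrimeSpectrum R) : loopDeg a⁻¹ p = -loopDeg a p := by
  rw [loopDeg_apply, loopVal_inv]
  rfl

@[simp] theorem loopDeg_arcToLoop (b : Arc Γ R) (p : PrimeSpectrum R) :
    loopDeg (arcToLoop Γ R b) p = 0 := by
  rw [loopDeg_apply, loopVal_arcToLoop, neg_zero]

theorem loopDeg_loopMap (φ : R ⟶ S) (a : Loop Γ R) (p : PrimeSpectrum S) :
    loopDeg (loopMap Γ (φ.hom : R →+* S) a) p =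
      loopDeg a (PrimeSpectrum.comap (φ.hom : R →+* S) p) := by
  rw [loopDeg_apply, loopVal_loopMap]
  rfl

theorem loopDeg_tUnit (γ : Γ) (p : PrimeSpectrum R) :
    loopDeg (expPt (tUnit R) (-γ)) p = γ := by
  rw [loopDeg_apply, loopVal_expPt, ordAt_tUnit, one_smul, neg_neg]

/-- The locally constant function `f(γ, γ')` on `Spec R`, for points in the components
of `t^{-γ}` and `t^{-γ'}`. -/
def degMap₂ {X : Type*} (f : Γ → Γ → X) (a b : Loop Γ R) : LocallyConstant (PrimeSpectrum R) X where
  toFun p := f (loopDeg a p) (loopDeg b p)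
  isLocallyConstant := (loopDeg a).isLocallyConstant.comp₂ (loopDeg b).isLocallyConstant f

theorem degMap₂_apply {X : Type*} (f : Γ → Γ → X) (a b : Loop Γ R) (p : PrimeSpectrum R) :
    degMap₂ f a b p = f (loopDeg a p) (loopDeg b p) := rfl

/-- The symbol pairing is the antisymmetrization of the half symbol pairing, up to a sign. -/
theorem symLoop_eq {c : LinearMap.BilinForm ℤ Γ} (hc : ∀ x y, c x y = c y x) (a b : Loop Γ R) :
    symLoop c R a b = constUnits R (degMap₂ (fun γ γ' ↦ (-1) ^ c γ γ') a b) *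
      (halfLoop c R a b * (halfLoop c R b a)⁻¹) := by
  have hl (a a' b : Loop Γ R) : degMap₂ (fun γ γ' ↦ (-1 : kˣ) ^ c γ γ') (a * a') b =
      degMap₂ (fun γ γ' ↦ (-1) ^ c γ γ') a b * degMap₂ (fun γ γ' ↦ (-1) ^ c γ γ') a' b := by
    ext p : 1
    simp only [LocallyConstant.mul_apply, degMap₂_apply, loopDeg_mul, map_add, LinearMap.add_apply,
      zpow_add]
  have hr (a b b' : Loop Γ R) : degMap₂ (fun γ γ' ↦ (-1 : kˣ) ^ c γ γ') a (b * b') =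
      degMap₂ (fun γ γ' ↦ (-1) ^ c γ γ') a b * degMap₂ (fun γ γ' ↦ (-1) ^ c γ γ') a b' := by
    ext p : 1
    simp only [LocallyConstant.mul_apply, degMap₂_apply, loopDeg_mul, map_add, zpow_add]
  induction a using torus_induction with
  | one =>
    rw [constUnits_of_const (x := 1) fun p ↦ by simp [degMap₂_apply]]
    simp
  | mul a a' ha ha' =>
    rw [hl]
    simp only [map_mul, MonoidHom.mul_apply, ha, ha', mul_inv]
    ac_rfl
  | exp f γ =>
    induction b using torus_induction with
    | one =>
      rw [constUnits_of_const (x := 1) fun p ↦ by simp [degMap₂_apply]]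
      simp
    | mul b b' hb hb' =>
      rw [hr]
      simp only [map_mul, MonoidHom.mul_apply, hb, hb', mul_inv]
      ac_rfl
    | exp g γ' =>
      refine (unitsSheaf k).sep R _ _ (((locally_exists_fac f).and (stable_exists_fac f)
        (locally_exists_fac g) (stable_exists_fac g)).mono ?_)
      rintro S φ ⟨⟨x, hx⟩, y, hy⟩
      change Units.map (φ.hom : R →* S) _ = Units.map (φ.hom : R →* S) _
      have hord (p : PrimeSpectrum S) : degMap₂ (fun γ γ' ↦ (-1 : kˣ) ^ c γ γ') (expPt f γ)
          (expPt g γ') (PrimeSpectrum.comap (φ.hom : R →+* S) p) =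
            ((-1) ^ (x.1.toAdd * y.1.toAdd)) ^ c γ γ' := by
        have h1 (f : ((R : Type u)⸨X⸩)ˣ) (γ : Γ) (x : Fac S)
            (hx : facVal S x = laurentUnits (φ.hom : R →+* S) f) :
            loopDeg (expPt f γ) (PrimeSpectrum.comap (φ.hom : R →+* S) p) = -(x.1.toAdd • γ) := by
          rw [loopDeg_apply, loopVal_expPt, ← ordAt_comap, ← hx, facVal_apply, ← mul_assoc,
            ordAt_factored]
        rw [degMap₂_apply, h1 f γ x hx, h1 g γ' y hy, ← zpow_mul]
        congr 1
        simp only [map_neg, LinearMap.neg_apply, map_zsmul, LinearMap.smul_apply, smul_eq_mul]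
        ring
      rw [map_mul, map_mul, map_inv, map_constUnits_of_const φ hord, ← symLoop_map, ← halfLoop_map,
        ← halfLoop_map]
      change symbol S (laurentUnits (φ.hom : R →+* S) f)
        (laurentUnits (φ.hom : R →+* S) g) ^ c γ γ' = _ *
          (halfSymbol S (laurentUnits (φ.hom : R →+* S) f)
          (laurentUnits (φ.hom : R →+* S) g) ^ c γ γ' * (halfSymbol S
            (laurentUnits (φ.hom : R →+* S) g) (laurentUnits (φ.hom : R →+* S) f) ^ c γ' γ)⁻¹)
      rw [symbol_eq_half hx hy, hc γ' γ, mul_zpow, mul_zpow, inv_zpow, mul_assoc, map_zpow,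
        map_zpow]
      congr 3
      ext
      simp [kUnit]

end LoopDeg

section

/-! ### The extension with given structure constants -/

variable {k : Type u} [Field k] {Γ : Type v} [AddCommGroup Γ]

variable (k) in
/-- Structure constants with `m(0, 0) = 1`, for a symmetric form. -/
structure CoeffData (c : LinearMap.BilinForm ℤ Γ) where
  hc (x y : Γ) : c x y = c y x
  m : Γ → Γ → kˣ
  s : Γ → kˣ
  isCoeff : IsCoeff c m s
  m_zero : m 0 0 = 1

namespace CoeffData

variable {c : LinearMap.BilinForm ℤ Γ} (D : CoeffData k c)

theorem m_zero_left (γ : Γ) : D.m 0 γ = 1 := by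
  have h := D.isCoeff.assoc 0 0 γ
  rw [D.m_zero, one_mul, zero_add, zero_add] at h
  exact mul_eq_left.1 h.symm

theorem s_zero : D.s 0 = 1 := by
  have h := D.isCoeff.mu_sigma 0 0
  rw [neg_zero, D.m_zero, one_mul, mul_one, add_zero] at h
  exact mul_eq_left.1 h.symm

variable [CharZero k] {R S : CommAlgCat.{u} k}

/-- The cocycle of the extension with structure constants `m`, `s`: the product of `m(γ, γ')`, for
points in the components of `t^{-γ}` and `t^{-γ'}`, and the inverse of the half symbol. -/
def cocycle (a b : Loop Γ R) : (R : Type u)ˣ :=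
  constUnits R (degMap₂ D.m a b) * (halfLoop c R a b)⁻¹

/-- The unit `s(γ)`, for a point in the component of `t^{-γ}`. -/
def sUnit (a : Loop Γ R) : (R : Type u)ˣ := constUnits R ((loopDeg a).map D.s)

/-- The cocycle condition holds for the part of `m` by associativity, and for the half symbol
because it is bimultiplicative. -/
theorem cocycle_assoc (a a' a'' : Loop Γ R) :
    D.cocycle a a' * D.cocycle (a * a') a'' = D.cocycle a' a'' * D.cocycle a (a' * a'') := by
  have h : degMap₂ D.m a a' * degMap₂ D.m (a * a') a'' =
      degMap₂ D.m a' a'' * degMap₂ D.m a (a' * a'') := by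
    ext p : 1
    simp only [LocallyConstant.mul_apply, degMap₂_apply, loopDeg_mul, D.isCoeff.assoc]
  have h' := congrArg (constUnits R) h
  rw [map_mul, map_mul] at h'
  have h'' : halfLoop c R a a' * halfLoop c R (a * a') a'' =
      halfLoop c R a' a'' * halfLoop c R a (a' * a'') := by
    simp only [map_mul, MonoidHom.mul_apply]
    ac_rfl
  simp only [cocycle]
  rw [mul_mul_mul_comm, h', ← mul_inv, h'', mul_inv, mul_mul_mul_comm]

theorem cocycle_one_left (a : Loop Γ R) : D.cocycle 1 a = 1 := by
  rw [cocycle, constUnits_of_const (x := 1) fun p ↦ by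
    rw [degMap₂_apply, loopDeg_one, m_zero_left]]
  simp

theorem cocycle_arcToLoop (b b' : Arc Γ R) :
    D.cocycle (arcToLoop Γ R b) (arcToLoop Γ R b') = 1 := by
  have h := halfLoop_loopFacVal c (R := R) (1, b, 1) (1, b', 1)
  have e (b : Arc Γ R) : loopFacVal Γ R (1, b, 1) = arcToLoop Γ R b := by
    simp [loopFacVal_apply]
  rw [e, e] at h
  rw [cocycle, constUnits_of_const (x := 1) fun p ↦ by
    rw [degMap₂_apply, loopDeg_arcToLoop, m_zero_left], h]
  simp

theorem cocycle_tUnit (γ γ' : Γ) :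
    D.cocycle (expPt (tUnit R) (-γ)) (expPt (tUnit R) (-γ')) = kUnit R (D.m γ γ') := by
  have h := halfLoop_loopFacVal c (R := R) (Multiplicative.ofAdd γ, 1, 1)
    (Multiplicative.ofAdd γ', 1, 1)
  have e (γ : Γ) : loopFacVal Γ R (Multiplicative.ofAdd γ, 1, 1) = expPt (tUnit R) (-γ) := by
    simp [loopFacVal_apply]
  rw [e, e] at h
  rw [cocycle, constUnits_of_const (x := D.m γ γ') fun p ↦ by
    rw [degMap₂_apply, loopDeg_tUnit, loopDeg_tUnit], h]
  simp

theorem map_cocycle (φ : R ⟶ S) (a b : Loop Γ R) :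
    Units.map (φ.hom : R →* S) (D.cocycle a b) =
      D.cocycle (loopMap Γ (φ.hom : R →+* S) a) (loopMap Γ (φ.hom : R →+* S) b) := by
  rw [cocycle, map_mul, map_inv, ← halfLoop_map, cocycle]
  congr 1
  exact map_constUnits φ fun p ↦ by
    rw [degMap₂_apply, loopDeg_loopMap, loopDeg_loopMap]
    rfl

theorem sUnit_tUnit (γ : Γ) : D.sUnit (expPt (tUnit R) (-γ)) = kUnit R (D.s γ) :=
  constUnits_of_const fun p ↦ by
    rw [LocallyConstant.map_apply, Function.comp_apply, loopDeg_tUnit]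

theorem sUnit_arcToLoop (b : Arc Γ R) : D.sUnit (arcToLoop Γ R b) = 1 := by
  rw [sUnit, constUnits_of_const (x := 1) fun p ↦ by
    rw [LocallyConstant.map_apply, Function.comp_apply, loopDeg_arcToLoop, s_zero], map_one]

theorem map_sUnit (φ : R ⟶ S) (a : Loop Γ R) :
    Units.map (φ.hom : R →* S) (D.sUnit a) = D.sUnit (loopMap Γ (φ.hom : R →+* S) a) :=
  map_constUnits φ fun p ↦ by
    rw [LocallyConstant.map_apply, LocallyConstant.map_apply, Function.comp_apply,
      Function.comp_apply, loopDeg_loopMap]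

theorem sUnit_mul_inv (a : Loop Γ R) : D.sUnit a * D.sUnit a⁻¹ = 1 := by
  rw [sUnit, sUnit, ← map_mul, constUnits_of_const (x := 1) fun p ↦ ?_, map_one]
  rw [LocallyConstant.mul_apply, LocallyConstant.map_apply, LocallyConstant.map_apply,
    Function.comp_apply, Function.comp_apply, loopDeg_inv, D.isCoeff.sigma_sigma]

theorem cocycle_mul_sUnit (a b : Loop Γ R) :
    D.cocycle a b * D.sUnit (a * b) = D.sUnit a * D.sUnit b * D.cocycle a⁻¹ b⁻¹ := by
  have h : degMap₂ D.m a b * (loopDeg (a * b)).map D.s =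
      (loopDeg a).map D.s * (loopDeg b).map D.s * degMap₂ D.m a⁻¹ b⁻¹ := by
    ext p : 1
    simp only [LocallyConstant.mul_apply, LocallyConstant.map_apply, Function.comp_apply,
      degMap₂_apply, loopDeg_mul, loopDeg_inv, D.isCoeff.mu_sigma]
  have h' := congrArg (constUnits R) h
  simp only [map_mul] at h'
  have h2 : halfLoop c R a⁻¹ b⁻¹ = halfLoop c R a b := by
    rw [map_inv, map_inv, MonoidHom.inv_apply, inv_inv]
  rw [cocycle, cocycle, h2, ← mul_assoc]
  unfold sUnit
  rw [← h']
  ac_rfl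

/-- Antisymmetrization of the cocycle gives the inverse of the symbol, up to the sign of the
parities. -/
theorem sign_mul_cocycle {s : LocallyConstant (PrimeSpectrum R) (ZMod 2)} (a b : Loop Γ R)
    (hs : ∀ p, s p = ((c (loopVal p a) (loopVal p a) * c (loopVal p b) (loopVal p b) : ℤ) :
      ZMod 2)) :
    signUnit s * D.cocycle a b = (symLoop c R a b)⁻¹ * D.cocycle b a := by
  have h1 : signUnit s = constUnits R
      ((degMap₂ (fun γ γ' ↦ c γ γ * c γ' γ') a b).map fun n ↦ (-1) ^ n) :=
    signUnit_eq_constUnits _ fun p ↦ by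
      rw [hs, degMap₂_apply, loopDeg_apply, loopDeg_apply]
      simp
  have h2 : ((degMap₂ (fun γ γ' ↦ c γ γ * c γ' γ') a b).map fun n ↦ (-1 : kˣ) ^ n) *
      degMap₂ D.m a b = (degMap₂ (fun γ γ' ↦ (-1) ^ c γ γ') a b)⁻¹ * degMap₂ D.m b a := by
    ext p : 1
    simp only [LocallyConstant.mul_apply, LocallyConstant.map_apply, Function.comp_apply,
      degMap₂_apply, LocallyConstant.inv_apply]
    rw [D.isCoeff.comm (loopDeg a p), ← mul_assoc, zpow_add, mul_left_comm, ← zpow_add,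
      neg_one_zpow_inv, ← two_mul, zpow_mul]
    simp
  have h3 := congrArg (constUnits R) h2
  rw [map_mul, map_mul, map_inv, ← h1] at h3
  have h4 (x y z w : (R : Type u)ˣ) : x⁻¹ * w * y⁻¹ = (x * (y * z⁻¹))⁻¹ * (w * z⁻¹) := by
    rw [← mul_inv_cancel_right (x⁻¹ * w * y⁻¹) z]
    simp only [mul_inv, inv_inv, mul_assoc, mul_comm, mul_left_comm]
  rw [symLoop_eq D.hc, cocycle, cocycle, ← mul_assoc, h3, h4]

end CoeffData

/-- The `R`-points of the extension with given structure constants: pairs of a unit and a point of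
the loop group, multiplied by means of the cocycle. -/
@[ext]
structure StdPt {c : LinearMap.BilinForm ℤ Γ} (D : CoeffData k c) (R : CommAlgCat.{u} k) where
  unit : (R : Type u)ˣ
  pt : Loop Γ R

namespace StdPt

variable {c : LinearMap.BilinForm ℤ Γ} {D : CoeffData k c} {R S T : CommAlgCat.{u} k}

/-- A point of the loop group is given by its finitely many coordinates with respect to a basis
of `Γ`, so that the points form a small set in the universe of `k`, whatever the universe
of `Γ`. -/
instance [Module.Free ℤ Γ] [Module.Finite ℤ Γ] : Small.{u} (StdPt D R) := by
  let b := Module.Free.chooseBasis ℤ Γ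
  have : Countable (Module.Free.ChooseBasisIndex ℤ Γ) := Finite.to_countable
  refine small_of_injective (β := (R : Type u)ˣ ×
    (Shrink.{u} (Module.Free.ChooseBasisIndex ℤ Γ) → ((R : Type u)⸨X⸩)ˣ))
    (f := fun x ↦ (x.unit, fun i ↦ torusCoord b _ ((equivShrink _).symm i) x.pt)) fun x y h ↦ ?_
  obtain ⟨h1, h2⟩ := Prod.mk.inj h
  refine StdPt.ext h1 (torusCoord_ext b fun i ↦ ?_)
  simpa using congrFun h2 (equivShrink _ i)

variable [CharZero k]

instance : Group (StdPt D R) where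
  mul x y := ⟨x.unit * y.unit * D.cocycle x.pt y.pt, x.pt * y.pt⟩
  one := ⟨1, 1⟩
  inv x := ⟨(x.unit * D.cocycle x.pt⁻¹ x.pt)⁻¹, x.pt⁻¹⟩
  mul_assoc x y z := StdPt.ext (by
    change x.unit * y.unit * D.cocycle x.pt y.pt * z.unit * D.cocycle (x.pt * y.pt) z.pt =
      x.unit * (y.unit * z.unit * D.cocycle y.pt z.pt) * D.cocycle x.pt (y.pt * z.pt)
    have h := D.cocycle_assoc x.pt y.pt z.pt
    rw [mul_right_comm _ _ z.unit, mul_assoc, h]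
    ac_rfl) (mul_assoc _ _ _)
  one_mul x := StdPt.ext (by
    change 1 * x.unit * D.cocycle 1 x.pt = x.unit
    rw [D.cocycle_one_left, one_mul, mul_one]) (one_mul _)
  mul_one x := StdPt.ext (by
    change x.unit * 1 * D.cocycle x.pt 1 = x.unit
    have h := D.cocycle_assoc x.pt 1 1
    rw [mul_one, D.cocycle_one_left, mul_one, one_mul, mul_eq_right] at h
    rw [h, mul_one, mul_one]) (mul_one _)
  inv_mul_cancel x := StdPt.ext (by
    change (x.unit * D.cocycle x.pt⁻¹ x.pt)⁻¹ * x.unit * D.cocycle x.pt⁻¹ x.pt = 1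
    rw [mul_assoc, inv_mul_cancel]) (inv_mul_cancel _)

theorem unit_mul (x y : StdPt D R) : (x * y).unit = x.unit * y.unit * D.cocycle x.pt y.pt := rfl

theorem pt_mul (x y : StdPt D R) : (x * y).pt = x.pt * y.pt := rfl

variable (D) in
/-- The inclusion of `𝔾ₘ`. -/
def incl (R : CommAlgCat.{u} k) : (R : Type u)ˣ →* StdPt D R :=
  MonoidHom.mk' (fun z ↦ ⟨z, 1⟩) fun z w ↦ StdPt.ext (by
    rw [unit_mul, D.cocycle_one_left, mul_one]) (mul_one _).symm

variable (D) in
/-- The projection to the loop group. -/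
def proj (R : CommAlgCat.{u} k) : StdPt D R →* Loop Γ R := MonoidHom.mk' pt pt_mul

variable (D) in
/-- Base change. -/
def map (φ : R ⟶ S) : StdPt D R →* StdPt D S :=
  MonoidHom.mk' (fun x ↦ ⟨Units.map (φ.hom : R →* S) x.unit, loopMap Γ (φ.hom : R →+* S) x.pt⟩)
    fun x y ↦ StdPt.ext (by
      rw [unit_mul, unit_mul, map_mul, map_mul, D.map_cocycle]) (map_mul _ _ _)

variable (D) in
/-- The splitting over the arc group. -/
def split (R : CommAlgCat.{u} k) : Arc Γ R →* StdPt D R :=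
  MonoidHom.mk' (fun b ↦ ⟨1, arcToLoop Γ R b⟩) fun b b' ↦ StdPt.ext (by
    rw [unit_mul, D.cocycle_arcToLoop, mul_one, mul_one]) (map_mul _ _ _)

variable (D) in
/-- The involution. -/
def symm (R : CommAlgCat.{u} k) : StdPt D R →* StdPt D R :=
  MonoidHom.mk' (fun x ↦ ⟨x.unit * D.sUnit x.pt, x.pt⁻¹⟩) fun x y ↦ StdPt.ext (by
    change x.unit * y.unit * D.cocycle x.pt y.pt * D.sUnit (x.pt * y.pt) =
      x.unit * D.sUnit x.pt * (y.unit * D.sUnit y.pt) * D.cocycle x.pt⁻¹ y.pt⁻¹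
    rw [mul_assoc, D.cocycle_mul_sUnit]
    ac_rfl) (mul_inv _ _)

theorem incl_mul_comm (z : (R : Type u)ˣ) (x : StdPt D R) : incl D R z * x = x * incl D R z := by
  have h := D.cocycle_assoc x.pt 1 1
  rw [mul_one, D.cocycle_one_left, mul_one, one_mul, mul_eq_right] at h
  refine StdPt.ext ?_ ((one_mul _).trans (mul_one _).symm)
  change z * x.unit * D.cocycle 1 x.pt = x.unit * z * D.cocycle x.pt 1
  rw [D.cocycle_one_left, h, mul_comm z]

theorem sign_mul_comm {s : LocallyConstant (PrimeSpectrum R) (ZMod 2)} (x y : StdPt D R)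
    (hs : ∀ p, s p = ((c (loopVal p x.pt) (loopVal p x.pt) *
      c (loopVal p y.pt) (loopVal p y.pt) : ℤ) : ZMod 2)) :
    incl D R (signUnit s) * (x * y) = incl D R (symLoop c R x.pt y.pt)⁻¹ * (y * x) := by
  refine StdPt.ext ?_ ?_
  · change signUnit s * (x.unit * y.unit * D.cocycle x.pt y.pt) * D.cocycle 1 _ =
      (symLoop c R x.pt y.pt)⁻¹ * (y.unit * x.unit * D.cocycle y.pt x.pt) * D.cocycle 1 _
    rw [D.cocycle_one_left, D.cocycle_one_left, mul_one, mul_one, mul_left_comm,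
      D.sign_mul_cocycle _ _ hs]
    ac_rfl
  · change 1 * (x.pt * y.pt) = 1 * (y.pt * x.pt)
    rw [mul_comm x.pt]

variable (D) in
/-- The point `t^{-γ}` of the extension. -/
def tPt (R : CommAlgCat.{u} k) (γ : Γ) : StdPt D R := ⟨1, expPt (tUnit R) (-γ)⟩

variable (D) in
theorem tPt_mul (γ₁ γ₂ : Γ) : tPt D R γ₁ * tPt D R γ₂ =
    incl D R (kUnit R (D.m γ₁ γ₂)) * tPt D R (γ₁ + γ₂) := by
  refine StdPt.ext ?_ ?_
  · change 1 * 1 * D.cocycle (expPt (tUnit R) (-γ₁)) (expPt (tUnit R) (-γ₂)) =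
      kUnit R (D.m γ₁ γ₂) * 1 * D.cocycle 1 (expPt (tUnit R) (-(γ₁ + γ₂)))
    rw [D.cocycle_one_left, D.cocycle_tUnit, mul_one, mul_one, mul_one, one_mul]
  · change expPt (tUnit R) (-γ₁) * expPt (tUnit R) (-γ₂) = 1 * expPt (tUnit R) (-(γ₁ + γ₂))
    rw [neg_add, expPt_add, one_mul]

variable (D) in
theorem symm_tPt (γ : Γ) :
    symm D R (tPt D R γ) = incl D R (kUnit R (D.s γ)) * tPt D R (-γ) := by
  refine StdPt.ext ?_ ?_
  · change 1 * D.sUnit (expPt (tUnit R) (-γ)) =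
      kUnit R (D.s γ) * 1 * D.cocycle 1 (expPt (tUnit R) (- -γ))
    rw [D.cocycle_one_left, D.sUnit_tUnit, mul_one, mul_one, one_mul]
  · change (expPt (tUnit R) (-γ))⁻¹ = 1 * expPt (tUnit R) (- -γ)
    rw [one_mul, expPt_neg _ (-γ)]

end StdPt

end

/-! ### The extension as a functor of points -/

section

variable {k : Type u} [Field k] [CharZero k] {Γ : Type v} [AddCommGroup Γ] [Module.Free ℤ Γ]
  [Module.Finite ℤ Γ] {c : LinearMap.BilinForm ℤ Γ}

namespace StdPt

variable (D : CoeffData k c) {R S T : CommAlgCat.{u} k}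

/-- The identification of the points of the extension with a group in the universe of `k`. -/
abbrev toShrink (R : CommAlgCat.{u} k) : StdPt D R ≃* Shrink.{u} (StdPt D R) :=
  Shrink.mulEquiv.symm

/-- The functor of points of the extension. -/
def functor : CommAlgCat.{u} k ⥤ GrpCat.{u} where
  obj R := GrpCat.of (Shrink.{u} (StdPt D R))
  map {R S} φ := GrpCat.ofHom
    ((toShrink D S).toMonoidHom.comp ((map D φ).comp (toShrink D R).symm.toMonoidHom))
  map_id R := by
    refine GrpCat.hom_ext (MonoidHom.ext fun x ↦ ?_)
    refine (toShrink D R).symm.injective ?_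
    refine ((toShrink D R).symm_apply_apply _).trans (StdPt.ext ?_ (loopMap_id _))
    exact Units.ext rfl
  map_comp {R S T} φ ψ := by
    refine GrpCat.hom_ext (MonoidHom.ext fun x ↦ ?_)
    refine congrArg (toShrink D T) ?_
    refine Eq.trans ?_ (congrArg (map D ψ) ((toShrink D S).symm_apply_apply _).symm)
    exact StdPt.ext rfl (loopMap_comp_hom φ ψ _)

theorem functor_map (φ : R ⟶ S) (x : StdPt D R) :
    (functor D).map φ (toShrink D R x) = toShrink D S (map D φ x) :=
  congrArg (fun y ↦ toShrink D S (map D φ y)) ((toShrink D R).symm_apply_apply x)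

end StdPt

open StdPt in
/-- The symmetric Heisenberg extension with given structure constants. -/
def stdExt (D : CoeffData k c) : SymHeisExt (k := k) c where
  H := functor D
  incl R := (toShrink D R).toMonoidHom.comp (incl D R)
  proj R := (proj D R).comp (toShrink D R).symm.toMonoidHom
  incl_nat {R S} φ z := by
    refine (functor_map D φ _).trans (congrArg _ (StdPt.ext rfl (map_one _)))
  proj_nat {R S} φ h := by
    obtain ⟨x, rfl⟩ := (toShrink D R).surjective h
    refine (congrArg (fun y ↦ pt ((toShrink D S).symm y)) (functor_map D φ x)).trans ?_
    refine (congrArg pt ((toShrink D S).symm_apply_apply _)).trans ?_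
    exact congrArg (fun y ↦ loopMap Γ (φ.hom : R →+* S) (pt y))
      ((toShrink D R).symm_apply_apply x).symm
  incl_injective R z z' h := congrArg unit ((toShrink D R).injective h)
  proj_eq_one_iff R h := by
    obtain ⟨x, rfl⟩ := (toShrink D R).surjective h
    have hx : (proj D R) ((toShrink D R).symm (toShrink D R x)) = x.pt :=
      congrArg pt ((toShrink D R).symm_apply_apply x)
    refine ⟨fun h ↦ ⟨x.unit, congrArg (toShrink D R)
      (StdPt.ext rfl (hx.symm.trans h).symm : incl D R x.unit = x)⟩, ?_⟩
    rintro ⟨z, hz⟩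
    exact hx.trans (congrArg pt ((toShrink D R).injective hz)).symm
  central R z h := by
    obtain ⟨x, rfl⟩ := (toShrink D R).surjective h
    change toShrink D R _ * toShrink D R x = toShrink D R x * toShrink D R _
    rw [← map_mul, ← map_mul, incl_mul_comm]
  exists_lift R a := ⟨{1}, by simp, fun r _ ↦
    ⟨toShrink D _ ⟨1, loopMap Γ (algebraMap R (Localization.Away r)) a⟩,
      congrArg pt ((toShrink D _).symm_apply_apply _)⟩⟩
  glue R s hs h compat := by
    let x (r : R) : StdPt D (CommAlgCat.of k (Localization.Away r)) := (toShrink D _).symm (h r)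
    have hx (r : R) : h r = toShrink D _ (x r) := ((toShrink D _).apply_symm_apply _).symm
    have hc : ∀ r ∈ s, ∀ r' ∈ s, ∀ (S : CommAlgCat.{u} k)
        (φ : CommAlgCat.of k (Localization.Away r) ⟶ S)
        (ψ : CommAlgCat.of k (Localization.Away r') ⟶ S),
        awayHom R r ≫ φ = awayHom R r' ≫ ψ → map D φ (x r) = map D ψ (x r') := by
      intro r hr r' hr' S φ ψ e
      have h1 := compat r hr r' hr' S φ ψ fun y ↦ congrArg (fun χ : R ⟶ S ↦ χ.hom y) e
      rw [hx, hx] at h1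
      exact (toShrink D S).injective
        ((functor_map D φ (x r)).symm.trans (h1.trans (functor_map D ψ (x r'))))
    obtain ⟨z, hz⟩ := (unitsSheaf k).glue R s hs (fun r ↦ (x r).unit)
      fun r hr r' hr' S φ ψ e ↦ congrArg unit (hc r hr r' hr' S φ ψ e)
    obtain ⟨a, ha⟩ := (loopSheaf k Γ).glue R s hs (fun r ↦ (x r).pt)
      fun r hr r' hr' S φ ψ e ↦ congrArg pt (hc r hr r' hr' S φ ψ e)
    refine ⟨toShrink D R ⟨z, a⟩, fun r hr ↦ ?_⟩
    rw [hx]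
    exact (functor_map D (awayHom R r) ⟨z, a⟩).trans (congrArg _ (StdPt.ext (hz r hr) (ha r hr)))
  -- `loopDeg` is the negative of the valuation, which does not matter for `c(γ, γ)`
  parity R a := degMap₂ (fun γ γ' ↦ ((c γ γ' : ℤ) : ZMod 2)) a a
  parity_mul R a b := by
    ext p : 1
    have h2 (n : ℤ) : ((2 * n : ℤ) : ZMod 2) = 0 := by
      rw [ZMod.intCast_eq_zero_iff_even]
      exact even_two_mul n
    simp only [LocallyConstant.add_apply, degMap₂_apply, loopDeg_mul, map_add, LinearMap.add_apply]
    rw [D.hc (loopDeg b p) (loopDeg a p)]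
    have h3 := h2 (c (loopDeg a p) (loopDeg b p))
    push_cast at h3 ⊢
    linear_combination h3
  parity_nat φ a p := by
    rw [degMap₂_apply, degMap₂_apply, loopDeg_loopMap]
  split R := (toShrink D R).toMonoidHom.comp (split D R)
  split_nat {R S} φ b :=
    (functor_map D φ _).trans (congrArg _ (StdPt.ext (map_one _) (loopMap_arcToLoop _ _)))
  proj_split R b := congrArg pt ((toShrink D R).symm_apply_apply _)
  parity_eq R a p := by
    rw [degMap₂_apply, loopDeg_apply]
    simp
  comm_pairing R f₁ f₂ γ₁ γ₂ h₁ h₂ hh₁ hh₂ := by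
    obtain ⟨x, rfl⟩ := (toShrink D R).surjective h₁
    obtain ⟨y, rfl⟩ := (toShrink D R).surjective h₂
    have hx : x.pt = expPt f₁ γ₁ := (congrArg pt ((toShrink D R).symm_apply_apply x)).symm.trans hh₁
    have hy : y.pt = expPt f₂ γ₂ := (congrArg pt ((toShrink D R).symm_apply_apply y)).symm.trans hh₂
    have h := sign_mul_comm (s := degMap₂ (fun γ γ' ↦ ((c γ γ' : ℤ) : ZMod 2)) x.pt x.pt *
      degMap₂ (fun γ γ' ↦ ((c γ γ' : ℤ) : ZMod 2)) y.pt y.pt) x y fun p ↦ by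
        rw [LocallyConstant.mul_apply, degMap₂_apply, degMap₂_apply, loopDeg_apply, loopDeg_apply]
        simp
    have hs : (symLoop c R x.pt y.pt)⁻¹ = contouCarrere k f₁ f₂ ^ (-c γ₁ γ₂) := by
      rw [hx, hy, symLoop, torusPairing_expPt, contouCarrere_eq_symbol, zpow_neg]
    rw [hs, hx, hy] at h
    have h' := congrArg (toShrink D R) (mul_inv_eq_iff_eq_mul.2 h)
    refine Eq.trans ?_ h'
    change toShrink D R (incl D R _) * (toShrink D R x * toShrink D R y * (toShrink D R x)⁻¹ *
      (toShrink D R y)⁻¹) = _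
    simp only [map_mul, map_inv, mul_inv_rev, mul_assoc]
  symm R := (toShrink D R).toMonoidHom.comp ((symm D R).comp (toShrink D R).symm.toMonoidHom)
  symm_nat {R S} φ h := by
    obtain ⟨x, rfl⟩ := (toShrink D R).surjective h
    have h1 : toShrink D R (symm D R ((toShrink D R).symm (toShrink D R x))) =
      toShrink D R (symm D R x) := by rw [MulEquiv.symm_apply_apply]
    refine (congrArg ((functor D).map φ) h1).trans ((functor_map D φ _).trans ?_)
    refine Eq.trans ?_
      (congrArg (fun y ↦ toShrink D S (symm D S ((toShrink D S).symm y))) (functor_map D φ x)).symm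
    rw [MulEquiv.symm_apply_apply]
    exact congrArg _ (StdPt.ext (by
      change Units.map _ (_ * _) = _ * _
      rw [map_mul, D.map_sUnit]
      rfl) (map_inv _ _))
  symm_symm R h := by
    obtain ⟨x, rfl⟩ := (toShrink D R).surjective h
    change toShrink D R (symm D R ((toShrink D R).symm (toShrink D R (symm D R
      ((toShrink D R).symm (toShrink D R x)))))) = toShrink D R x
    rw [MulEquiv.symm_apply_apply, MulEquiv.symm_apply_apply]
    refine congrArg _ (StdPt.ext ?_ (inv_inv _))
    change x.unit * D.sUnit x.pt * D.sUnit x.pt⁻¹ = x.unit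
    rw [mul_assoc, D.sUnit_mul_inv, mul_one]
  symm_incl R z := by
    change toShrink D R (symm D R ((toShrink D R).symm (toShrink D R (incl D R z)))) =
      toShrink D R (incl D R z)
    rw [MulEquiv.symm_apply_apply]
    refine congrArg _ (StdPt.ext ?_ inv_one)
    change z * D.sUnit 1 = z
    rw [← map_one (arcToLoop Γ R), D.sUnit_arcToLoop, mul_one]
  proj_symm R h := by
    change pt ((toShrink D R).symm (toShrink D R (symm D R ((toShrink D R).symm h)))) = _
    rw [MulEquiv.symm_apply_apply]
    rfl
  symm_split R b := by
    change toShrink D R (symm D R ((toShrink D R).symm (toShrink D R (split D R b)))) =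
      toShrink D R (split D R b⁻¹)
    rw [MulEquiv.symm_apply_apply]
    refine congrArg _ (StdPt.ext ?_ (map_inv _ _).symm)
    change 1 * D.sUnit (arcToLoop Γ R b) = 1
    rw [D.sUnit_arcToLoop, mul_one]

namespace StdPt

open SymHeisExt

variable (D : CoeffData k c) {R : CommAlgCat.{u} k}

/-- The point of the extension given by a unit and a point of the loop group. -/
def toExt (R : CommAlgCat.{u} k) : StdPt D R →* (stdExt D).H.obj R := (toShrink D R).toMonoidHom

theorem incl_stdExt (z : (R : Type u)ˣ) : (stdExt D).incl R z = toExt D R (incl D R z) := rfl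

theorem symm_toExt (x : StdPt D R) :
    (stdExt D).symm R (toExt D R x) = toExt D R (symm D R x) :=
  congrArg (fun y ↦ toShrink D R (symm D R y)) ((toShrink D R).symm_apply_apply x)

/-- The frame `t^{-γ}` of the extension with given structure constants. -/
def stdFrame : Frame (stdExt D) where
  q γ := toExt D (CommAlgCat.of k k) (tPt D (CommAlgCat.of k k) γ)
  proj_q _ := congrArg pt ((toShrink D (CommAlgCat.of k k)).symm_apply_apply _)

theorem stdFrame_q (γ : Γ) :
    (stdFrame D).q γ = toExt D (CommAlgCat.of k k) (tPt D (CommAlgCat.of k k) γ) := rfl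

theorem stdFrame_m : (stdFrame D).m = D.m := by
  ext γ₁ γ₂ : 2
  refine (stdExt D).incl_mul_cancel (R := CommAlgCat.of k k) (h := (stdFrame D).q (γ₁ + γ₂)) ?_
  rw [← Frame.q_mul, stdFrame_q, stdFrame_q, stdFrame_q, incl_stdExt, ← map_mul, ← map_mul,
    tPt_mul, kUnit_self]

theorem stdFrame_s : (stdFrame D).s = D.s := by
  ext γ : 1
  refine (stdExt D).incl_mul_cancel (R := CommAlgCat.of k k) (h := (stdFrame D).q (-γ)) ?_
  rw [← Frame.symm_q, stdFrame_q, stdFrame_q, incl_stdExt, symm_toExt, ← map_mul, symm_tPt,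
    kUnit_self]

end StdPt

end

end SymHeis

end

theorem lemma1p7 {k : Type u} [Field k] [CharZero k]
    {Γ : Type v} [AddCommGroup Γ] [Module.Free ℤ Γ] [Module.Finite ℤ Γ]
    (c : LinearMap.BilinForm ℤ Γ) (hc : ∀ x y, c x y = c y x) :
    ∃ D : ∀ E : SymHeis.SymHeisExt (k := k) c,
        SymHeis.LineDatum (k := k) c hc (fun γ ↦ E.line γ) E.lineParity,
      (∀ (E : SymHeis.SymHeisExt (k := k) c)
        (D' : SymHeis.LineDatum (k := k) c hc (fun γ ↦ E.line γ) E.lineParity),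
        E.IsCanonical D' ↔ D' = D E) ∧
      ∃ hD : ∀ (E E' : SymHeis.SymHeisExt (k := k) c) (e : SymHeis.SymHeisExt.Iso E E'),
          (D E).IsHom (D E') e.lineEquiv,
        (SymHeis.toTriple D hD).IsEquivalence := by
  refine ⟨fun E ↦ E.lineDatum hc, fun E D' ↦ SymHeis.SymHeisExt.isCanonical_iff,
    fun E E' e ↦ SymHeis.SymHeisExt.isHom_lineEquiv e, ?_⟩
  refine
    { faithful := ⟨fun {E E' e e'} h ↦ ?_⟩
      full := ⟨fun {E E'} f ↦ ?_⟩
      essSurj := ⟨fun A ↦ ?_⟩ }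
  · exact SymHeis.SymHeisExt.iso_ext_of_lineEquiv (congrArg SymHeis.TripleIso.equiv h)
  · obtain ⟨e, he⟩ := SymHeis.SymHeisExt.exists_lineEquiv_eq f.equiv f.isHom
    exact ⟨e, SymHeis.TripleIso.ext he⟩
  · -- the triple is isomorphic to that of the extension with the same structure constants
    obtain ⟨co, m, s, H, h0⟩ := A.datum.exists_hasCoeff_normalized (SymHeis.dt k)
    let D : SymHeis.CoeffData k c := ⟨hc, m, s, H.isCoeff, h0⟩
    let Q := SymHeis.StdPt.stdFrame D
    let f (γ : Γ) : (SymHeis.stdExt D).line γ ≃ₗ[k] A.V γ := (Q.co γ).trans (co γ).symm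
    have hf : ((SymHeis.stdExt D).lineDatum hc).IsHom A.datum f :=
      (Q.hasCoeff.isHom_iff H fun γ l ↦ (co γ).apply_symm_apply _).2
        ⟨SymHeis.StdPt.stdFrame_m D, SymHeis.StdPt.stdFrame_s D⟩
    exact ⟨SymHeis.stdExt D, ⟨(Groupoid.isoEquivHom _ _).symm ⟨f, hf⟩⟩⟩
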